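/- **Model.** Let $\gamma\ge 2$, $\alpha=(\gamma-1)/2$, and $R=2\ln n+C$, where $C\in\mathbb R$ controls the average degree $\bar d$ (for $\gamma>2$ and constant $C$, $\bar d=\frac2\pi\big(\frac{\alpha}{\alpha-1/2}\big)^2e^{-C/2}(1+o(1))$). A random hyperbolic graph has $n$ random vertices with polar coordinates $(r,\theta)$, where $\theta$ is uniform on $[0,2\pi)$ and $r\in[0,R)$ has density $f(r)=\alpha\sinh(\alpha r)/(\cosh(\alpha R)-1)$; two distinct vertices $u,v$ are adjacent iff $\operatorname{arcosh}\big(\cosh r_u\cosh r_v-\sinh r_u\sinh r_v\cos(\theta_u-\theta_v)\big)<R$. Let $m$ be the number of edges. **Sequential in-memory generator.** The disk is split into $k=\lfloor\alpha R/\ln 2\rfloor$ annuli $[\ell_i,\ell_{i+1})$, $\ell_i=iR/k$, $0\le i<k$. With $p_i=\int_{\ell_i}^{\ell_{i+1}}f(r)\,dr$, annulus $i$ is split into $\lfloor np_i/\kappa\rfloor+1$ cells of equal angular width, so that a cell has at most $\kappa$ vertices in expectation, $\kappa>0$ being a constant. The numbers of vertices in the annuli (a multinomial variate with probabilities $p_i$),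 and then those in the cells of each annulus (a multinomial variate with equal probabilities), are drawn through dependent binomial variates. Each binomial variate is drawn by acceptance-rejection whose independent trials are accepted with a constant probability $q\in(0,1]$. Given these numbers, every vertex is placed independently in its cell, its radius following $f$ conditioned on the annulus and its angle being uniform in the cell. Then, from the innermost annulus outwards, each vertex $v=(r,\theta)$ queries its own annulus and every annulus further out. In annulus $i$ let $\delta=\pi$ if $r+\ell_i<R$ and $\delta=\arccos\frac{\cosh r\cosh\ell_i-\cosh R}{\sinh r\sinh\ell_i}$ otherwise. Starting with the cell that contains the angle $\theta$, the generator walks over the cells in both angular directions until it meets a cell outside $[\theta-\delta,\theta+\delta]$ or has visited all cells of the annulus; it compares $v$ to all vertices of each visited cell and outputs the edges found (each edge once). The running time $T$ counts one step for each trial of a binomial variate, each placement of a vertex, each iteration of the loops over annuli, cells and vertices, each test whether a cell lies in the angular range, and each comparison of two vertices. **Lemma.** The running time is $\mathcal O(m)$ with probability at least $1-n^{-c}$ for any constant $c>0$. Precisely: for all $\gamma\ge2$, $C_0\in\mathbb R$, $\kappa>0$ and $q\in(0,1]$ there is a constant $K$ such that for every $c>0$ there is an $n_0$ such that for all $n\ge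 n_0$ and all $C\le C_0$ with $\alpha R\ge\ln 2$ (that is, $k\ge1$), $$\Pr[\,T\le K\,m\,]\ \ge\ 1-n^{-c}.$$ -/

import Mathlib

/-! ## Programs with a step counter -/

/-- A deterministic computation: its result and the number of elementary steps it performed. -/
structure Timed (β : Type) where
  val : β
  steps : ℕ

namespace Timed

instance : Monad Timed where
  pure b := ⟨b, 0⟩
  bind x f := ⟨(f x.val).val, x.steps + (f x.val).steps⟩

/-- One elementary step. -/
def tick : Timed Unit := ⟨(), 1⟩

/-- A `for` loop over a list: every iteration costs one step plus the steps of its body; the outputs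
of the iterations are written one after the other to the output stream. -/
def collect {ι β : Type} (body : ι → Timed (List β)) : List ι → Timed (List β)
  | [] => pure []
  | a :: l => do
      tick
      let x ← body a
      let y ← collect body l
      pure (x ++ y)

open Classical in
/-- A `while` loop with counter `t`: the test `inside t` costs one step; if it succeeds, `visit t` is
executed and the loop goes on with `t + 1`; otherwise it stops. At most `fuel` rounds are made.
Returned are the output and the number of visits. -/
noncomputable def walk {β : Type} (inside : ℕ → Prop) (visit : ℕ → Timed (List β)) :
    (fuel : ℕ) → (t : ℕ) → Timed (List β × ℕ)
  | 0, _ => pure ([], 0)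
  | fuel + 1, t => do
      tick
      if inside t then
        let x ← visit t
        let y ← walk inside visit fuel (t + 1)
        pure (x ++ y.1, y.2 + 1)
      else
        pure ([], 0)

end Timed

namespace RHG

open Real MeasureTheory ProbabilityTheory

/-! ## Hyperbolic geometry in polar coordinates `(r, θ)` -/

/-- Distance in the hyperbolic plane of two points in polar coordinates. -/
noncomputable def hypDist (x y : ℝ × ℝ) : ℝ :=
  arcosh (cosh x.1 * cosh y.1 - sinh x.1 * sinh y.1 * cos (x.2 - y.2))

open Classical in
/-- The largest angular deviation from a point of radius `r` at which a point of radius `b` can have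
hyperbolic distance at most `R`. -/
noncomputable def angularDeviation (R r b : ℝ) : ℝ :=
  if r + b < R then π
  else arccos ((cosh r * cosh b - cosh R) / (sinh r * sinh b))

/-! ## Parameters and grid -/

/-- Number of vertices `n`, disk radius `R`, dispersion `α`; the intended expected number `κ` of
vertices per cell; and the probability `q` with which a trial of the acceptance-rejection sampler for
binomial variates is accepted. -/
structure Params where
  n : ℕ
  R : ℝ
  α : ℝ
  κ : ℝ
  q : unitInterval

variable (P : Params)

/-- The number `k = ⌊α R / ln 2⌋` of annuli. -/
noncomputable def numAnnuli : ℕ := ⌊P.α * P.R / log 2⌋₊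

/-- The radial boundaries `ℓ₀ = 0, …, ℓ_k = R`; annulus `i` (counted from `0`) covers the radii in
`[ℓ_i, ℓ_{i+1})`. -/
noncomputable def radialBound (i : ℕ) : ℝ := i * (P.R / numAnnuli P)

/-- The density of the radial coordinate. -/
noncomputable def radialDensity (r : ℝ) : ℝ :=
  P.α * (sinh (P.α * r) / (cosh (P.α * P.R) - 1))

/-- The probability that a vertex lies in annulus `i`. -/
noncomputable def annulusProb (i : Fin (numAnnuli P)) : ℝ :=
  ∫ r in radialBound P i..radialBound P (i + 1), radialDensity P r

/-- The number of equal-sized angular cells of annulus `i`: about `n p_i / κ`, so that no cell has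
more than `κ` vertices in expectation. -/
noncomputable def numCells (i : Fin (numAnnuli P)) : ℕ := ⌊P.n * annulusProb P i / P.κ⌋₊ + 1

/-- The angular width of the cells of annulus `i`. -/
noncomputable def cellWidth (i : Fin (numAnnuli P)) : ℝ := 2 * π / numCells P i

/-- A cell: an annulus and an angular index; cell `⟨i, j⟩` covers the angles in `[j w, (j + 1) w)`,
where `w = cellWidth P i`. -/
abbrev Cell : Type := Σ i : Fin (numAnnuli P), Fin (numCells P i)

/-- Numbers of vertices in the cells. -/
abbrev Counts : Type := ∀ i : Fin (numAnnuli P), Fin (numCells P i) → ℕ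

variable {P} in
/-- The vertices: those of cell `c` are numbered `0, …, counts c - 1`. -/
abbrev Vertex (N : Counts P) : Type := Σ c : Cell P, Fin (N c.1 c.2)

/-! ## The sampling phase -/

/-- A binomial variate with parameters `n` and `p` (clamped to `[0, 1]`), drawn by
acceptance-rejection: returned are its value and the number of trials, which are accepted
independently with probability `q`. -/
noncomputable def binomialVariate (q : unitInterval) (n : ℕ) (p : ℝ) : PMF (ℕ × ℕ) := do
  let failures ← (geometricMeasure q).toPMF
  let value ← (binomial n (Set.projIcc 0 1 zero_le_one p)).toPMF
  pure (value, failures + 1)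

/-- A multinomial variate: `n` vertices are distributed to `k` outcomes with probabilities
proportional to the weights `w`, by dependent binomial variates. Returned are the counts and the
total number of trials. -/
noncomputable def multinomialVariate (q : unitInterval) :
    (k : ℕ) → (w : Fin k → ℝ) → (n : ℕ) → PMF ((Fin k → ℕ) × ℕ)
  | 0, _, _ => pure (Fin.elim0, 0)
  | k + 1, w, n => do
      let x ← binomialVariate q n (w 0 / ∑ j, w j)
      let y ← multinomialVariate q k (fun j => w j.succ) (n - x.1)
      pure (Fin.cons x.1 y.1, x.2 + y.2)

/-- Independent execution of `k` samplers, one after the other, with the sum of their trials. -/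
noncomputable def sampleAll : (k : ℕ) → {β : Fin k → Type} → (∀ i, PMF (β i × ℕ)) →
    PMF ((∀ i, β i) × ℕ)
  | 0, _, _ => pure (fun i => i.elim0, 0)
  | k + 1, _, f => do
      let x ← f 0
      let y ← sampleAll k (fun i => f i.succ)
      pure (Fin.cons x.1 y.1, x.2 + y.2)

/-- Sampling of the grid: first the numbers of vertices in the annuli, then for each annulus the
numbers of vertices in its cells. -/
noncomputable def sampleCounts : PMF (Counts P × ℕ) := do
  let x ← multinomialVariate P.q (numAnnuli P) (annulusProb P) P.n
  let y ← sampleAll (numAnnuli P) (fun i => multinomialVariate P.q (numCells P i) (fun _ => 1) (x.1 i))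
  pure (y.1, x.2 + y.2)

/-- The law of the radial coordinate. -/
noncomputable def radialLaw : Measure ℝ :=
  (volume.restrict (Set.Ico 0 P.R)).withDensity (fun r => ENNReal.ofReal (radialDensity P r))

/-- The law of a vertex of cell `c`: the radius follows the radial law conditioned on the annulus, and
the angle is uniform in the angular range of the cell. -/
noncomputable def pointLaw (c : Cell P) : Measure (ℝ × ℝ) :=
  (cond (radialLaw P) (Set.Ico (radialBound P c.1) (radialBound P (c.1 + 1)))).prod
    (cond volume (Set.Ico ((c.2 : ℝ) * cellWidth P c.1) (((c.2 : ℝ) + 1) * cellWidth P c.1)))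

/-- An outcome of the sampling phase: the counts, the number of trials, and the polar coordinates
`(r, θ)` of all vertices. -/
abbrev Outcome : Type := Σ s : Counts P × ℕ, (Vertex s.1 → ℝ × ℝ)

/-- The law of the outcome of the sampling phase: given the counts, the vertices are placed
independently. -/
noncomputable def law : Measure (Outcome P) :=
  Measure.sum fun s : Counts P × ℕ =>
    sampleCounts P s •
      (Measure.pi fun v : Vertex s.1 => pointLaw P v.1).map (fun x => (⟨s, x⟩ : Outcome P))

/-! ## The generated graph -/

variable {P}

/-- The random hyperbolic graph on the sampled points. -/
def graph (ω : Outcome P) : SimpleGraph (Vertex ω.1.1) where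
  Adj u v := u ≠ v ∧ hypDist (ω.2 u) (ω.2 v) < P.R
  symm := ⟨fun u v h => ⟨h.1.symm, by
    have h2 := h.2
    rw [hypDist] at h2 ⊢
    rw [← cos_neg, neg_sub, mul_comm (cosh (ω.2 v).1), mul_comm (sinh (ω.2 v).1)]
    exact h2⟩⟩
  loopless := ⟨fun _ h => h.1 rfl⟩

/-- The number `m` of edges. -/
noncomputable def numEdges (ω : Outcome P) : ℕ := (graph ω).edgeSet.ncard

/-! ## The query phase -/

/-- The `j`-th cell of annulus `i`, with `j` taken cyclically. -/
noncomputable def cyclicCell (i : Fin (numAnnuli P)) (j : ℕ) : Cell P :=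
  ⟨i, ⟨j % numCells P i, Nat.mod_lt _ (Nat.succ_pos _)⟩⟩

/-- The order in which the vertices of one annulus are processed. -/
def Before {N : Counts P} (v u : Vertex N) : Prop :=
  (v.1.2 : ℕ) < u.1.2 ∨ (v.1.2 : ℕ) = u.1.2 ∧ (v.2 : ℕ) < u.2

open Classical in
/-- Compare the query vertex `v` to all vertices of cell `c`, one step per comparison, and output an
edge for each neighbor. Pairs within one annulus meet twice; only one of the two is output. -/
noncomputable def scanCell (ω : Outcome P) (v : Vertex ω.1.1) (c : Cell P) :
    Timed (List (Vertex ω.1.1 × Vertex ω.1.1)) :=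
  Timed.collect
    (fun j : Fin (ω.1.1 c.1 c.2) =>
      pure (if hypDist (ω.2 v) (ω.2 ⟨c, j⟩) < P.R ∧ (v.1.1 = c.1 → Before v ⟨c, j⟩)
        then [(v, ⟨c, j⟩)] else []))
    (List.finRange _)

/-- The query of `v` in annulus `i`: beginning with the cell that intersects the angular coordinate of
`v`, visit the cells outward in both angular directions until a cell lies outside the angular range
`[θ - δ, θ + δ]` of possible neighbors (or all cells have been visited). -/
noncomputable def queryAnnulus (ω : Outcome P) (v : Vertex ω.1.1) (i : Fin (numAnnuli P)) :
    Timed (List (Vertex ω.1.1 × Vertex ω.1.1)) := do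
  let θ := (ω.2 v).2
  let δ := angularDeviation P.R (ω.2 v).1 (radialBound P i)
  let w := cellWidth P i
  let s := ⌊θ / w⌋₊
  let x ← scanCell ω v (cyclicCell i s)
  let y ← Timed.walk (fun t => ((s : ℝ) + t) * w ≤ θ + δ)
    (fun t => scanCell ω v (cyclicCell i (s + t))) (numCells P i - 1) 1
  let z ← Timed.walk (fun t => θ - δ ≤ ((s : ℝ) - t + 1) * w)
    (fun t => scanCell ω v (cyclicCell i (s + (numCells P i - t)))) (numCells P i - 1 - y.2) 1
  pure (x ++ y.1 ++ z.1)

/-- The neighborhood query of `v`, in its own annulus and all outer ones. -/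
noncomputable def query (ω : Outcome P) (v : Vertex ω.1.1) :
    Timed (List (Vertex ω.1.1 × Vertex ω.1.1)) :=
  Timed.collect (queryAnnulus ω v) ((List.finRange (numAnnuli P)).filter (fun i => v.1.1 ≤ i))

/-- The query phase: loop over the annuli from the innermost outwards, over the cells of the annulus,
and over the vertices of the cell, and perform the neighborhood query of each vertex. -/
noncomputable def queryAll (ω : Outcome P) : Timed (List (Vertex ω.1.1 × Vertex ω.1.1)) :=
  Timed.collect
    (fun i : Fin (numAnnuli P) => Timed.collect
      (fun j : Fin (numCells P i) => Timed.collect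
        (fun l : Fin (ω.1.1 i j) => query ω ⟨⟨i, j⟩, l⟩)
        (List.finRange _))
      (List.finRange _))
    (List.finRange _)

/-- The running time of the generator: the trials of the binomial variates (at least one for every
annulus and every cell), one step for the placement of each vertex, and the query phase. -/
noncomputable def runningTime (ω : Outcome P) : ℕ :=
  ω.1.2 + Fintype.card (Vertex ω.1.1) + (queryAll ω).steps

end RHG

namespace RHG

open Real MeasureTheory ProbabilityTheory
open scoped ENNReal

/-! ## Expectations under discrete laws -/

/-! Why it holds. For a vertex of annulus i and annulus j, the search angle is governed by the scale
Δ = min(1, exp((R - ℓ_i - ℓ_j)/2)): it is at most `outerConst` · Δ (`angularDeviation_le`), while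
any two points of the two annuli whose angles differ by at most `innerConst` · Δ are adjacent
(`hypDist_lt_of_angle`). Cut the visited cells into blocks of `blockLen` cells, of angular length at
most `innerConst` · Δ, or single cells if already one cell is wider (not `Narrow`). A constant
number `numBlocks` of blocks covers a query. In the narrow case, the block that starts at the cell
of the query vertex contains only its neighbors and possibly itself, so these first blocks, summed
over all queries, hold at most n + 2m vertices (`sum_windowLoad_le`).

It remains to compare blocks at other offsets with the first one, summed over the vertices of
annulus i (`pair_le`). For i ≠ j, fix the counts outside annulus i and the total n_i: the angles in
annulus i are then independent and uniform, so with τ-cell blocks and M cells in annulus j the sum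
has mean n_i n_j τ / M at every offset, and it stays within constant factors of this mean up to an
error of the heaviest block times l. For i = j the vertices and the loads are the same data; there a
deterministic inequality for cyclic sequences bounds the correlation with a far window by four times
the correlation with the near one (`sum_mul_windowSum_shift_le`). Two cases fall outside this
comparison. Sparse annuli hold O(l) vertices and cost O(l²) per pair of annuli, and there are only
O(log² n) pairs. Wide cells hold O(1) vertices on average and cost O(n_i + l²), for i = j through a
second-moment bound on the cell loads; since annulus probabilities grow geometrically outwards, the
sum of n_i over i ≤ j is O(n) up to such errors.

This gives T = O(n + m), and n = O(m) is left (`vertices_le`). The outermost annulus and the one s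
annuli further in each hold Ω(n) vertices, and a constant s depending on C₀ makes the outermost
cells narrow for this pair; the same tail bounds then yield Ω(n) edges.

The tail bounds on counts and loads are exponential Markov inequalities, mostly with base 2, failing
with probability at most 2^(-l) each (`law_prod_le` and its consequences); polynomially many of them
enter a union bound. With l = (log n)² the total is below every n^(-c), while the polylogarithmic
errors stay below n. Therefore c influences only n₀ and not K. -/

/-- The expectation of a nonnegative function under a discrete law. -/
noncomputable def expect {β : Type} (p : PMF β) (f : β → ℝ≥0∞) : ℝ≥0∞ := ∑' b, p b * f b

lemma expect_pure {β : Type} (b : β) (f : β → ℝ≥0∞) : expect (pure b : PMF β) f = f b := by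
  classical
  unfold expect
  rw [tsum_eq_single b]
  · change (PMF.pure b) b * f b = f b
    simp
  · intro c hc
    change (PMF.pure b) c * f c = 0
    simp [PMF.pure_apply, hc]

lemma expect_bind {β δ : Type} (p : PMF β) (g : β → PMF δ) (f : δ → ℝ≥0∞) :
    expect (p >>= g) f = expect p (fun b => expect (g b) f) := by
  unfold expect
  change ∑' d, (PMF.bind p g) d * f d = _
  simp_rw [PMF.bind_apply, ← ENNReal.tsum_mul_right, ← ENNReal.tsum_mul_left]
  rw [ENNReal.tsum_comm]
  simp_rw [mul_assoc]

lemma expect_mono_support {β : Type} {p : PMF β} {f g : β → ℝ≥0∞}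
    (h : ∀ b ∈ p.support, f b ≤ g b) : expect p f ≤ expect p g := by
  refine ENNReal.tsum_le_tsum fun b => ?_
  by_cases hb : p b = 0
  · simp [hb]
  · exact mul_le_mul_right (h b hb) _

lemma expect_congr_support {β : Type} {p : PMF β} {f g : β → ℝ≥0∞}
    (h : ∀ b ∈ p.support, f b = g b) : expect p f = expect p g :=
  le_antisymm (expect_mono_support fun b hb => (h b hb).le)
    (expect_mono_support fun b hb => (h b hb).ge)

lemma expect_const {β : Type} (p : PMF β) (a : ℝ≥0∞) : expect p (fun _ => a) = a := by
  unfold expect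
  rw [ENNReal.tsum_mul_right, p.tsum_coe, one_mul]

lemma expect_le_of_support {β : Type} {p : PMF β} {f : β → ℝ≥0∞} {a : ℝ≥0∞}
    (h : ∀ b ∈ p.support, f b ≤ a) : expect p f ≤ a :=
  (expect_mono_support h).trans_eq (expect_const p a)

lemma expect_const_mul {β : Type} (p : PMF β) (a : ℝ≥0∞) (f : β → ℝ≥0∞) :
    expect p (fun b => a * f b) = a * expect p f := by
  unfold expect
  rw [← ENNReal.tsum_mul_left]
  exact tsum_congr fun b => by ring

lemma expect_mul_const {β : Type} (p : PMF β) (a : ℝ≥0∞) (f : β → ℝ≥0∞) :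
    expect p (fun b => f b * a) = expect p f * a := by
  simp_rw [mul_comm _ a]
  exact expect_const_mul p a f

lemma expect_comm {β δ : Type} (p : PMF β) (r : PMF δ) (f : β → δ → ℝ≥0∞) :
    expect p (fun b => expect r (f b)) = expect r (fun d => expect p (fun b => f b d)) := by
  unfold expect
  simp_rw [← ENNReal.tsum_mul_left]
  rw [ENNReal.tsum_comm]
  exact tsum_congr fun d => tsum_congr fun b => by ring

lemma expect_sum {β ι : Type} (p : PMF β) (s : Finset ι) (f : ι → β → ℝ≥0∞) :
    expect p (fun b => ∑ i ∈ s, f i b) = ∑ i ∈ s, expect p (f i) := by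
  unfold expect
  simp_rw [Finset.mul_sum]
  exact Summable.tsum_finsetSum fun i _ => ENNReal.summable

/-! ## Binomial variates -/

/-- The binomial theorem. The second variable `y` marks the vertices left over for later outcomes,
which is the form the recursion for multinomial variates consumes. -/
lemma expect_binomial (n : ℕ) (p : unitInterval) {y z : ℝ} (hy : 0 ≤ y) (hz : 0 ≤ z) :
    expect (binomial n p).toPMF (fun x => ENNReal.ofReal (z ^ x * y ^ (n - x))) =
      ENNReal.ofReal ((p * z + (1 - p) * y) ^ n) := by
  have hp0 : (0 : ℝ) ≤ p := p.2.1
  have hp1 : (0 : ℝ) ≤ 1 - p := sub_nonneg.2 p.2.2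
  unfold expect
  rw [tsum_eq_sum (s := Finset.range (n + 1)), add_pow, ENNReal.ofReal_sum_of_nonneg]
  · refine Finset.sum_congr rfl fun x _ => ?_
    rw [Measure.toPMF_apply, binomial_singleton, ← ENNReal.ofReal_mul (by positivity)]
    congr 1
    rw [mul_pow, mul_pow]
    ring
  · intro x _
    positivity
  · intro x hx
    rw [Measure.toPMF_apply, binomial_singleton,
      Nat.choose_eq_zero_of_lt (by simpa using hx)]
    simp

lemma le_of_mem_support_binomial {n : ℕ} {p : unitInterval} {x : ℕ}
    (hx : x ∈ (binomial n p).toPMF.support) : x ≤ n := by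
  by_contra h
  apply hx
  rw [Measure.toPMF_apply, binomial_singleton, Nat.choose_eq_zero_of_lt (by omega)]
  simp

lemma eq_of_mem_support_binomial_one {n : ℕ} {x : ℕ}
    (hx : x ∈ (binomial n 1).toPMF.support) : x = n := by
  by_contra h
  have hle := le_of_mem_support_binomial hx
  apply hx
  rw [Measure.toPMF_apply, binomial_singleton]
  have : n - x ≠ 0 := by omega
  simp [this]

/-- The base 2/(2 - q) exceeds 1 and is tuned so that the moment equals 2 for every q in (0, 1];
moments of total trial counts then become powers of two. -/
lemma expect_geometric {q : unitInterval} (hq : q ≠ 0) :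
    expect (geometricMeasure q).toPMF
      (fun x => ENNReal.ofReal ((2 / (2 - (q : ℝ))) ^ (x + 1))) = 2 := by
  have hq0 : (0 : ℝ) < q := lt_of_le_of_ne q.2.1 fun h => hq (Subtype.ext h.symm)
  have hq1 : (q : ℝ) ≤ 1 := q.2.2
  have h2 : (0 : ℝ) < 2 - q := by linarith
  unfold expect
  have hterm : ∀ x : ℕ, (geometricMeasure q).toPMF x *
      ENNReal.ofReal ((2 / (2 - (q : ℝ))) ^ (x + 1)) =
      ENNReal.ofReal (((1 - q) * (2 / (2 - (q : ℝ)))) ^ x * (q * (2 / (2 - (q : ℝ))))) := by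
    intro x
    rw [Measure.toPMF_apply, geometricMeasure_singleton hq,
      ← ENNReal.ofReal_mul (geometricMeasure_nonneg q x)]
    congr 1
    rw [mul_pow]
    ring
  have hr0 : 0 ≤ (1 - (q : ℝ)) * (2 / (2 - (q : ℝ))) :=
    mul_nonneg (by linarith) (by positivity)
  have hr1 : (1 - (q : ℝ)) * (2 / (2 - (q : ℝ))) < 1 := by
    rw [← mul_div_assoc, div_lt_one h2]
    linarith
  simp_rw [hterm]
  rw [← ENNReal.ofReal_tsum_of_nonneg (fun x => by positivity)
    ((summable_geometric_of_lt_one hr0 hr1).mul_right _), tsum_mul_right,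
    tsum_geometric_of_lt_one hr0 hr1]
  have : (1 - (1 - (q : ℝ)) * (2 / (2 - (q : ℝ))))⁻¹ * (q * (2 / (2 - (q : ℝ)))) = 2 := by
    have : 1 - (1 - (q : ℝ)) * (2 / (2 - (q : ℝ))) = q / (2 - q) := by field_simp; ring
    rw [this]
    field_simp
  rw [this]
  simp

lemma expect_binomialVariate (q : unitInterval) (n : ℕ) (p : ℝ) (f : ℕ × ℕ → ℝ≥0∞) :
    expect (binomialVariate q n p) f =
      expect (geometricMeasure q).toPMF (fun t =>
        expect (binomial n (Set.projIcc 0 1 zero_le_one p)).toPMF (fun x => f (x, t + 1))) := by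
  unfold binomialVariate
  simp only [expect_bind, expect_pure]

/-! ## Multinomial variates -/

lemma expect_multinomialVariate_succ (q : unitInterval) (k : ℕ) (w : Fin (k + 1) → ℝ) (n : ℕ)
    (f : (Fin (k + 1) → ℕ) × ℕ → ℝ≥0∞) :
    expect (multinomialVariate q (k + 1) w n) f =
      expect (geometricMeasure q).toPMF (fun t =>
        expect (binomial n (Set.projIcc 0 1 zero_le_one (w 0 / ∑ j, w j))).toPMF (fun x =>
          expect (multinomialVariate q k (fun j => w j.succ) (n - x)) (fun y =>
            f (Fin.cons x y.1, t + 1 + y.2)))) := by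
  rw [multinomialVariate]
  simp only [expect_bind, expect_pure, expect_binomialVariate]

/-- The probability generating function of a multinomial variate. -/
lemma expect_multinomialVariate (q : unitInterval) (k : ℕ) (w : Fin (k + 1) → ℝ)
    (hw : ∀ j, 0 < w j) (n : ℕ) (z : Fin (k + 1) → ℝ) (hz : ∀ j, 0 ≤ z j) :
    expect (multinomialVariate q (k + 1) w n) (fun y => ENNReal.ofReal (∏ j, z j ^ y.1 j)) =
      ENNReal.ofReal (((∑ j, w j * z j) / ∑ j, w j) ^ n) := by
  induction k generalizing n with
  | zero =>
    rw [expect_multinomialVariate_succ]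
    have h1 : w 0 / ∑ j, w j = 1 := by simp [(hw 0).ne']
    simp only [multinomialVariate, expect_pure, h1, Set.projIcc_right]
    have : ∀ x, ENNReal.ofReal (∏ j : Fin 1, z j ^ (Fin.cons x Fin.elim0 : Fin 1 → ℕ) j) =
        ENNReal.ofReal (z 0 ^ x * 1 ^ (n - x)) := by intro x; simp
    simp only [this]
    erw [expect_binomial n 1 zero_le_one (hz 0)]
    rw [expect_const]
    have := (hw 0).ne'
    simp [this]
  | succ k ih =>
    rw [expect_multinomialVariate_succ]
    have hS : 0 < ∑ j, w j := Finset.sum_pos (fun j _ => hw j) ⟨0, Finset.mem_univ _⟩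
    have hS' : 0 < ∑ j : Fin (k + 1), w j.succ :=
      Finset.sum_pos (fun j _ => hw _) ⟨0, Finset.mem_univ _⟩
    have hsum : ∑ j, w j = w 0 + ∑ j : Fin (k + 1), w j.succ := Fin.sum_univ_succ _
    have hp : w 0 / ∑ j, w j ∈ Set.Icc (0 : ℝ) 1 :=
      ⟨div_nonneg (hw 0).le hS.le, (div_le_one hS).2 (by rw [hsum]; linarith)⟩
    have hin : ∀ t x : ℕ, expect (multinomialVariate q (k + 1) (fun j => w j.succ) (n - x))
        (fun y => ENNReal.ofReal (∏ j, z j ^ (Fin.cons x y.1 : Fin (k + 2) → ℕ) j)) =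
        ENNReal.ofReal (z 0 ^ x *
          ((∑ j : Fin (k + 1), w j.succ * z j.succ) / ∑ j : Fin (k + 1), w j.succ) ^ (n - x)) := by
      intro t x
      rw [ENNReal.ofReal_mul (pow_nonneg (hz 0) _), ← ih _ (fun j => hw _) _ _ (fun j => hz _),
        ← expect_const_mul]
      refine congrArg _ (funext fun y => ?_)
      rw [Fin.prod_univ_succ, ENNReal.ofReal_mul (by simpa using pow_nonneg (hz 0) _)]
      simp
    simp only [hin 0]
    rw [expect_const, expect_binomial _ _ (div_nonneg (Finset.sum_nonneg fun j _ =>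
      mul_nonneg (hw _).le (hz _)) hS'.le) (hz 0), Set.projIcc_of_mem _ hp]
    congr 2
    rw [Fin.sum_univ_succ (fun j => w j * z j)]
    have : 1 - w 0 / ∑ j, w j = (∑ j : Fin (k + 1), w j.succ) / ∑ j, w j := by
      rw [eq_div_iff hS.ne', sub_mul, div_mul_cancel₀ _ hS.ne', hsum]
      ring
    simp only [this]
    field_simp

/-- The last conditional probability is w / w = 1, so the final variate takes all remaining
vertices. Positive weights are needed to exclude 0 / 0 = 0. -/
lemma sum_of_mem_support_multinomialVariate {q : unitInterval} {k : ℕ} {w : Fin (k + 1) → ℝ}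
    (hw : ∀ j, 0 < w j) {n : ℕ} {y : (Fin (k + 1) → ℕ) × ℕ}
    (hy : y ∈ (multinomialVariate q (k + 1) w n).support) : ∑ j, y.1 j = n := by
  induction k generalizing n with
  | zero =>
    rw [multinomialVariate] at hy
    have h1 : w 0 / ∑ j, w j = 1 := by simp [(hw 0).ne']
    erw [PMF.mem_support_bind_iff] at hy
    obtain ⟨x, hx, hy⟩ := hy
    erw [PMF.mem_support_bind_iff] at hy
    obtain ⟨x', hx', hy⟩ := hy
    rw [multinomialVariate] at hx'
    erw [PMF.mem_support_pure_iff] at hx' hy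
    rw [h1] at hx
    erw [PMF.mem_support_bind_iff] at hx
    obtain ⟨t, -, hx⟩ := hx
    erw [PMF.mem_support_bind_iff] at hx
    obtain ⟨v, hv, hx⟩ := hx
    erw [PMF.mem_support_pure_iff] at hx
    subst hx
    simp only [Set.projIcc_right] at hv
    have := eq_of_mem_support_binomial_one hv
    subst hy
    simpa using this
  | succ k ih =>
    rw [multinomialVariate] at hy
    erw [PMF.mem_support_bind_iff] at hy
    obtain ⟨x, hx, hy⟩ := hy
    erw [PMF.mem_support_bind_iff] at hy
    obtain ⟨x', hx', hy⟩ := hy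
    erw [PMF.mem_support_pure_iff] at hy
    erw [PMF.mem_support_bind_iff] at hx
    obtain ⟨t, -, hx⟩ := hx
    erw [PMF.mem_support_bind_iff] at hx
    obtain ⟨v, hv, hx⟩ := hx
    erw [PMF.mem_support_pure_iff] at hx
    have hle := le_of_mem_support_binomial hv
    have h := ih (fun j => hw _) hx'
    subst hy hx
    rw [Fin.sum_univ_succ]
    simp only [Fin.cons_zero, Fin.cons_succ]
    rw [h]
    simp only
    omega

/-- The number of trials of a variate does not depend on its value or its parameters, so each
outcome contributes one factor 2. -/
lemma expect_trials_multinomialVariate {q : unitInterval} (hq : q ≠ 0) (k : ℕ) (w : Fin k → ℝ)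
    (n : ℕ) :
    expect (multinomialVariate q k w n)
      (fun y => ENNReal.ofReal ((2 / (2 - (q : ℝ))) ^ y.2)) = 2 ^ k := by
  have h0 : 0 ≤ 2 / (2 - (q : ℝ)) := div_nonneg zero_le_two (by have := q.2.2; linarith)
  induction k generalizing n with
  | zero => simp [multinomialVariate, expect_pure]
  | succ k ih =>
    rw [expect_multinomialVariate_succ]
    simp_rw [pow_add _ (_ + 1), ENNReal.ofReal_mul (pow_nonneg h0 _), expect_const_mul, ih,
      expect_const, expect_mul_const]
    rw [expect_geometric hq, pow_succ']

/-! ## Independent samplers -/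

lemma expect_sampleAll_succ (k : ℕ) {β : Fin (k + 1) → Type} (f : ∀ i, PMF (β i × ℕ))
    (F : (∀ i, β i) × ℕ → ℝ≥0∞) :
    expect (sampleAll (k + 1) f) F = expect (f 0) (fun x =>
      expect (sampleAll k (fun i => f i.succ)) (fun y => F (Fin.cons x.1 y.1, x.2 + y.2))) := by
  rw [sampleAll]
  simp only [expect_bind, expect_pure]

/-- Integrating out one of the independent samplers. -/
lemma expect_sampleAll_le (k : ℕ) {β : Fin k → Type} (f : ∀ i, PMF (β i × ℕ))
    (F : (∀ i, β i) → ℝ≥0∞) (i : Fin k) (B : ℝ≥0∞)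
    (h : ∀ y, expect (f i) (fun x => F (Function.update y i x.1)) ≤ B) :
    expect (sampleAll k f) (fun y => F y.1) ≤ B := by
  induction k with
  | zero => exact i.elim0
  | succ k ih =>
    rw [expect_sampleAll_succ]
    rcases Fin.eq_zero_or_eq_succ i with rfl | ⟨i, rfl⟩
    · rw [expect_comm]
      refine expect_le_of_support fun y _ => ?_
      -- Coordinate `0` is overwritten by `Function.update`, so any value can stand in for it.
      obtain ⟨x0, -⟩ := (f 0).support_nonempty
      refine le_of_eq_of_le (congrArg _ (funext fun x => ?_)) (h (Fin.cons x0.1 y.1))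
      rw [Fin.update_cons_zero]
    · refine expect_le_of_support fun x _ => ?_
      refine ih (fun j => f j.succ) (fun y => F (Fin.cons x.1 y)) i fun y => ?_
      refine le_of_eq_of_le (congrArg _ (funext fun x' => ?_)) (h (Fin.cons x.1 y))
      rw [Fin.cons_update]

lemma mem_support_sampleAll {k : ℕ} {β : Fin k → Type} {f : ∀ i, PMF (β i × ℕ)}
    {y : (∀ i, β i) × ℕ} (hy : y ∈ (sampleAll k f).support) (i : Fin k) :
    ∃ t, (y.1 i, t) ∈ (f i).support := by
  induction k with
  | zero => exact i.elim0
  | succ k ih =>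
    rw [sampleAll] at hy
    erw [PMF.mem_support_bind_iff] at hy
    obtain ⟨x, hx, hy⟩ := hy
    erw [PMF.mem_support_bind_iff] at hy
    obtain ⟨x', hx', hy⟩ := hy
    erw [PMF.mem_support_pure_iff] at hy
    subst hy
    rcases Fin.eq_zero_or_eq_succ i with rfl | ⟨i, rfl⟩
    · exact ⟨x.2, hx⟩
    · exact ih hx' i

lemma expect_trials_sampleAll (k : ℕ) {β : Fin k → Type} (f : ∀ i, PMF (β i × ℕ)) {z : ℝ}
    (hz : 0 ≤ z) (d : Fin k → ℕ)
    (h : ∀ i, expect (f i) (fun x => ENNReal.ofReal (z ^ x.2)) = 2 ^ d i) :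
    expect (sampleAll k f) (fun y => ENNReal.ofReal (z ^ y.2)) = 2 ^ ∑ i, d i := by
  induction k with
  | zero => simp [sampleAll, expect_pure]
  | succ k ih =>
    rw [expect_sampleAll_succ]
    simp_rw [pow_add z, ENNReal.ofReal_mul (pow_nonneg hz _), expect_const_mul,
      ih (fun i => f i.succ) (fun i => d i.succ) (fun i => h _), expect_mul_const]
    rw [h, Fin.sum_univ_succ, pow_add]

end RHG

namespace RHG

open Real MeasureTheory ProbabilityTheory
open scoped ENNReal

/-! ## The grid -/

/-- The standing assumptions on the parameters. -/
structure Params.Valid (P : Params) : Prop where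
  half_le : 1 / 2 ≤ P.α
  log_two_le : log 2 ≤ P.α * P.R
  κ_pos : 0 < P.κ
  q_ne : P.q ≠ 0

/-- The radial width of the annuli. -/
noncomputable def radialWidth (P : Params) : ℝ := P.R / numAnnuli P

section Grid

variable {P : Params}

lemma radialBound_eq (i : ℕ) : radialBound P i = i * radialWidth P := rfl

lemma radialBound_succ (i : ℕ) : radialBound P (i + 1) = radialBound P i + radialWidth P := by
  simp only [radialBound_eq]
  push_cast
  ring

variable (hP : P.Valid)
include hP

lemma Params.Valid.α_pos : 0 < P.α := by linarith [hP.half_le]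

lemma Params.Valid.R_pos : 0 < P.R := by
  have h := hP.log_two_le
  have h2 : 0 < log 2 := log_pos one_lt_two
  by_contra hR
  have := mul_nonpos_of_nonneg_of_nonpos hP.α_pos.le (not_lt.1 hR)
  linarith

lemma Params.Valid.numAnnuli_pos : 0 < numAnnuli P :=
  Nat.floor_pos.2 ((one_le_div (log_pos one_lt_two)).2 hP.log_two_le)

lemma Params.Valid.numAnnuli_mul_le : numAnnuli P * log 2 ≤ P.α * P.R := by
  have h2 : 0 < log 2 := log_pos one_lt_two
  have h := Nat.floor_le (div_nonneg (mul_nonneg hP.α_pos.le hP.R_pos.le) h2.le)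
  rwa [le_div_iff₀ h2] at h

lemma Params.Valid.lt_numAnnuli_mul : P.α * P.R < numAnnuli P * (2 * log 2) := by
  have h2 : 0 < log 2 := log_pos one_lt_two
  have h := Nat.lt_floor_add_one (P.α * P.R / log 2)
  rw [div_lt_iff₀ h2] at h
  change _ < ((numAnnuli P : ℝ) + 1) * _ at h
  have h1 : (1 : ℝ) ≤ numAnnuli P := by exact_mod_cast hP.numAnnuli_pos
  nlinarith

lemma Params.Valid.numAnnuli_mul_radialWidth : numAnnuli P * radialWidth P = P.R := by
  have h : (0 : ℝ) < numAnnuli P := by exact_mod_cast hP.numAnnuli_pos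
  unfold radialWidth
  field_simp

lemma Params.Valid.radialBound_numAnnuli : radialBound P (numAnnuli P) = P.R :=
  hP.numAnnuli_mul_radialWidth

lemma Params.Valid.log_two_le_mul_radialWidth : log 2 ≤ P.α * radialWidth P := by
  have h : (0 : ℝ) < numAnnuli P := by exact_mod_cast hP.numAnnuli_pos
  have h1 := hP.numAnnuli_mul_le
  rw [← hP.numAnnuli_mul_radialWidth] at h1
  nlinarith

lemma Params.Valid.mul_radialWidth_lt : P.α * radialWidth P < 2 * log 2 := by
  have h : (0 : ℝ) < numAnnuli P := by exact_mod_cast hP.numAnnuli_pos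
  have h1 := hP.lt_numAnnuli_mul
  rw [← hP.numAnnuli_mul_radialWidth] at h1
  nlinarith

lemma Params.Valid.radialWidth_pos : 0 < radialWidth P :=
  div_pos hP.R_pos (by exact_mod_cast hP.numAnnuli_pos)

lemma Params.Valid.radialBound_nonneg (i : ℕ) : 0 ≤ radialBound P i :=
  mul_nonneg (Nat.cast_nonneg _) hP.radialWidth_pos.le

lemma Params.Valid.radialBound_mono : Monotone (radialBound P) := fun i j hij =>
  mul_le_mul_of_nonneg_right (by exact_mod_cast hij) hP.radialWidth_pos.le

lemma Params.Valid.radialBound_le {i : ℕ} (hi : i ≤ numAnnuli P) : radialBound P i ≤ P.R :=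
  (hP.radialBound_mono hi).trans_eq hP.radialBound_numAnnuli

lemma Params.Valid.cosh_sub_one_pos : 0 < cosh (P.α * P.R) - 1 :=
  sub_pos.2 (one_lt_cosh.2 (mul_pos hP.α_pos hP.R_pos).ne')

omit hP in
lemma integral_radialDensity (a b : ℝ) :
    ∫ r in a..b, radialDensity P r =
      (cosh (P.α * b) - cosh (P.α * a)) / (cosh (P.α * P.R) - 1) := by
  have hderiv : ∀ r, HasDerivAt (fun r => cosh (P.α * r) / (cosh (P.α * P.R) - 1))
      (radialDensity P r) r := by
    intro r
    have h := ((hasDerivAt_cosh (P.α * r)).comp r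
      ((hasDerivAt_id r).const_mul P.α)).div_const (cosh (P.α * P.R) - 1)
    have he : radialDensity P r = sinh (P.α * r) * (P.α * 1) / (cosh (P.α * P.R) - 1) := by
      unfold radialDensity
      ring
    rw [he]
    exact h
  rw [intervalIntegral.integral_eq_sub_of_hasDerivAt (fun r _ => hderiv r)]
  · ring
  · apply Continuous.intervalIntegrable
    unfold radialDensity
    fun_prop

omit hP in
lemma annulusProb_eq (i : Fin (numAnnuli P)) :
    annulusProb P i = (cosh (P.α * radialBound P (i + 1)) - cosh (P.α * radialBound P i)) /
      (cosh (P.α * P.R) - 1) :=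
  integral_radialDensity _ _

lemma Params.Valid.sum_annulusProb : ∑ i, annulusProb P i = 1 := by
  simp_rw [annulusProb_eq]
  rw [← Finset.sum_div, Fin.sum_univ_eq_sum_range
    (fun i => cosh (P.α * radialBound P (i + 1)) - cosh (P.α * radialBound P i)),
    Finset.sum_range_sub (fun i => cosh (P.α * radialBound P i)), hP.radialBound_numAnnuli]
  have : radialBound P 0 = 0 := by simp [radialBound]
  rw [this, mul_zero, cosh_zero, div_self hP.cosh_sub_one_pos.ne']

/-- By the choice of k, crossing one annulus increases α r by some y in [ln 2, 2 ln 2). Hence exp(α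
r) grows by a factor between 2 and 4 per annulus, and the annulus probabilities decay geometrically
inwards at these two rates; the factor 4 gives the lower bound here, the factor 2 the upper bound in
`annulusProb_upper`. -/
lemma Params.Valid.annulusProb_lower (i : Fin (numAnnuli P)) :
    1 / 8 * (1 / 4 : ℝ) ^ (numAnnuli P - i) ≤ annulusProb P i := by
  rw [annulusProb_eq, le_div_iff₀ hP.cosh_sub_one_pos, radialBound_succ, mul_add]
  set x := P.α * radialBound P i with hx
  have hx0 : 0 ≤ x := mul_nonneg hP.α_pos.le (hP.radialBound_nonneg _)
  set y := P.α * radialWidth P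
  have hy1 : log 2 ≤ y := hP.log_two_le_mul_radialWidth
  have hy2 : y < 2 * log 2 := hP.mul_radialWidth_lt
  have hl : 0 < log 2 := log_pos one_lt_two
  have hk : P.α * P.R = x + (numAnnuli P - i : ℕ) * y := by
    rw [← hP.numAnnuli_mul_radialWidth, hx, radialBound_eq, Nat.cast_sub i.2.le]
    ring
  have hR : cosh (P.α * P.R) - 1 ≤ exp x * 4 ^ (numAnnuli P - i : ℕ) := by
    have h1 : cosh (P.α * P.R) ≤ exp (P.α * P.R) := by
      rw [cosh_eq]
      have : exp (-(P.α * P.R)) ≤ exp (P.α * P.R) := exp_le_exp.2 (by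
        have := mul_pos hP.α_pos hP.R_pos; linarith)
      linarith
    have h2 : exp (P.α * P.R) ≤ exp x * 4 ^ (numAnnuli P - i : ℕ) := by
      have h4 : (4 : ℝ) = exp (2 * log 2) := by
        rw [mul_comm, exp_mul, exp_log two_pos]; norm_num
      rw [h4, ← exp_nat_mul, ← exp_add, hk]
      gcongr
    linarith
  -- cosh(ln 2) = 5/4, so the increment of cosh over the annulus is at least cosh x / 4 ≥ exp x / 8.
  have hc : 5 / 4 ≤ cosh y := by
    have h5 : cosh (log 2) = 5 / 4 := by rw [cosh_log two_pos]; norm_num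
    rw [← h5, cosh_le_cosh, abs_of_pos hl, abs_of_pos (hl.trans_le hy1)]
    exact hy1
  have hcx : exp x / 2 ≤ cosh x := by
    rw [cosh_eq]; have := exp_pos (-x); linarith
  have hss : 0 ≤ sinh x * sinh y :=
    mul_nonneg (sinh_nonneg_iff.2 hx0) (sinh_nonneg_iff.2 (hl.le.trans hy1))
  rw [cosh_add]
  calc 1 / 8 * (1 / 4 : ℝ) ^ (numAnnuli P - i : ℕ) * (cosh (P.α * P.R) - 1)
      ≤ 1 / 8 * (1 / 4 : ℝ) ^ (numAnnuli P - i : ℕ) * (exp x * 4 ^ (numAnnuli P - i : ℕ)) := by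
        gcongr
    _ = exp x / 8 * ((1 / 4 : ℝ) * 4) ^ (numAnnuli P - i : ℕ) := by rw [mul_pow]; ring
    _ = exp x / 8 := by norm_num
    _ ≤ cosh x * cosh y + sinh x * sinh y - cosh x := by nlinarith [exp_pos x]

lemma Params.Valid.annulusProb_pos (i : Fin (numAnnuli P)) : 0 < annulusProb P i :=
  lt_of_lt_of_le (by positivity) (hP.annulusProb_lower i)

lemma Params.Valid.annulusProb_upper (i : Fin (numAnnuli P)) :
    annulusProb P i ≤ 16 * (1 / 2 : ℝ) ^ (numAnnuli P - i) := by
  rw [annulusProb_eq, div_le_iff₀ hP.cosh_sub_one_pos]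
  set x := P.α * radialBound P i with hx
  have hx0 : 0 ≤ x := mul_nonneg hP.α_pos.le (hP.radialBound_nonneg _)
  set y := P.α * radialWidth P with hy
  have hy1 : log 2 ≤ y := hP.log_two_le_mul_radialWidth
  have hl : 0 < log 2 := log_pos one_lt_two
  set z := P.α * radialBound P (i + 1) with hz
  have hz0 : 0 ≤ z := mul_nonneg hP.α_pos.le (hP.radialBound_nonneg _)
  have hk : P.α * P.R = z + (numAnnuli P - (i + 1) : ℕ) * y := by
    rw [← hP.numAnnuli_mul_radialWidth, hz, radialBound_eq, Nat.cast_sub i.2]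
    push_cast
    ring
  have hcz : cosh z ≤ exp z := by
    rw [cosh_eq]
    have : exp (-z) ≤ exp z := exp_le_exp.2 (by linarith)
    linarith
  have h1 : exp z * 2 ^ (numAnnuli P - (i + 1) : ℕ) ≤ exp (P.α * P.R) := by
    have h4 : (2 : ℝ) = exp (log 2) := by rw [exp_log two_pos]
    rw [h4, ← exp_nat_mul, ← exp_add, hk]
    gcongr
  -- Equality holds at α R = ln 2, the smallest value compatible with k ≥ 1.
  have h2 : exp (P.α * P.R) ≤ 8 * (cosh (P.α * P.R) - 1) := by
    have he : 2 ≤ exp (P.α * P.R) := by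
      rw [← exp_log two_pos, ← exp_log two_pos]
      simpa using exp_le_exp.2 hP.log_two_le
    have hi : exp (P.α * P.R) * exp (-(P.α * P.R)) = 1 := by rw [← exp_add]; simp
    rw [cosh_eq]
    nlinarith [exp_pos (-(P.α * P.R))]
  have hpow : (1 / 2 : ℝ) ^ (numAnnuli P - i : ℕ) = 1 / 2 * (1 / 2) ^ (numAnnuli P - (i + 1) : ℕ) := by
    rw [← pow_succ']
    congr 1
    have := i.2
    omega
  have h3 : (1 / 2 : ℝ) ^ (numAnnuli P - (i + 1) : ℕ) * 2 ^ (numAnnuli P - (i + 1) : ℕ) = 1 := by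
    rw [← mul_pow]; norm_num
  have h5 : exp z ≤ (1 / 2 : ℝ) ^ (numAnnuli P - (i + 1) : ℕ) * exp (P.α * P.R) := by
    calc exp z = (1 / 2 : ℝ) ^ (numAnnuli P - (i + 1) : ℕ) *
          (exp z * 2 ^ (numAnnuli P - (i + 1) : ℕ)) := by linear_combination -exp z * h3
      _ ≤ _ := by gcongr
  have hc := cosh_pos x
  rw [hpow]
  calc cosh z - cosh x ≤ (1 / 2 : ℝ) ^ (numAnnuli P - (i + 1) : ℕ) * exp (P.α * P.R) := by linarith
    _ ≤ (1 / 2 : ℝ) ^ (numAnnuli P - (i + 1) : ℕ) * (8 * (cosh (P.α * P.R) - 1)) := by gcongr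
    _ = _ := by ring

/-- Equal radial widths and an increasing density. It transfers sparseness of an annulus to all
inner ones in `pair_sparse`. -/
lemma Params.Valid.annulusProb_mono {i j : Fin (numAnnuli P)} (hij : i ≤ j) :
    annulusProb P i ≤ annulusProb P j := by
  simp_rw [annulusProb_eq]
  refine div_le_div_of_nonneg_right ?_ hP.cosh_sub_one_pos.le
  rw [radialBound_succ, radialBound_succ, mul_add, mul_add]
  set y := P.α * radialWidth P
  have hy : 0 ≤ y := mul_nonneg hP.α_pos.le hP.radialWidth_pos.le
  have hxx : P.α * radialBound P i ≤ P.α * radialBound P j :=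
    mul_le_mul_of_nonneg_left (hP.radialBound_mono hij) hP.α_pos.le
  have hx0 : 0 ≤ P.α * radialBound P i := mul_nonneg hP.α_pos.le (hP.radialBound_nonneg _)
  rw [cosh_add, cosh_add]
  have h1 : cosh (P.α * radialBound P i) ≤ cosh (P.α * radialBound P j) := by
    rw [cosh_le_cosh, abs_of_nonneg hx0, abs_of_nonneg (hx0.trans hxx)]
    exact hxx
  have h2 : sinh (P.α * radialBound P i) ≤ sinh (P.α * radialBound P j) := sinh_le_sinh.2 hxx
  have h3 : 1 ≤ cosh y := one_le_cosh y
  have h4 : 0 ≤ sinh y := sinh_nonneg_iff.2 hy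
  nlinarith

lemma Params.Valid.annulusProb_le_one (i : Fin (numAnnuli P)) : annulusProb P i ≤ 1 := by
  rw [← hP.sum_annulusProb]
  exact Finset.single_le_sum (fun j _ => (hP.annulusProb_pos j).le) (Finset.mem_univ i)

omit hP in
lemma numCells_pos (i : Fin (numAnnuli P)) : 0 < numCells P i := Nat.succ_pos _

omit hP in
lemma cellWidth_pos (i : Fin (numAnnuli P)) : 0 < cellWidth P i :=
  div_pos two_pi_pos (by exact_mod_cast numCells_pos i)

omit hP in
lemma numCells_mul_cellWidth (i : Fin (numAnnuli P)) : numCells P i * cellWidth P i = 2 * π := by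
  have : (0 : ℝ) < numCells P i := by exact_mod_cast numCells_pos i
  unfold cellWidth
  field_simp

lemma Params.Valid.numCells_le (i : Fin (numAnnuli P)) :
    (numCells P i : ℝ) ≤ P.n * annulusProb P i / P.κ + 1 := by
  unfold numCells
  push_cast
  gcongr
  exact Nat.floor_le (div_nonneg (mul_nonneg (Nat.cast_nonneg _) (hP.annulusProb_pos i).le)
    hP.κ_pos.le)

omit hP in
lemma lt_numCells (i : Fin (numAnnuli P)) :
    P.n * annulusProb P i / P.κ < numCells P i := by
  unfold numCells
  push_cast
  exact Nat.lt_floor_add_one _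

lemma Params.Valid.sum_numCells_le :
    (∑ i, (numCells P i : ℝ)) ≤ P.n / P.κ + numAnnuli P := by
  refine (Finset.sum_le_sum fun i _ => hP.numCells_le i).trans_eq ?_
  rw [Finset.sum_add_distrib, ← Finset.sum_div, ← Finset.mul_sum, hP.sum_annulusProb]
  simp

end Grid

end RHG

namespace RHG

open Real MeasureTheory ProbabilityTheory
open scoped ENNReal

/-! ## The law of the outcome -/

section Law

variable {P : Params}

/-- The cell of annulus `i` that contains the angle of a point. -/
noncomputable def angularIndex (i : Fin (numAnnuli P)) (x : ℝ × ℝ) : ℕ := ⌊x.2 / cellWidth P i⌋₊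

lemma measurable_angularIndex (i : Fin (numAnnuli P)) : Measurable (angularIndex i) :=
  Nat.measurable_floor.comp (measurable_snd.div_const _)

lemma measurable_outcome {β : Type} [MeasurableSpace β] {F : Outcome P → β}
    (hF : ∀ s, Measurable fun x => F ⟨s, x⟩) : Measurable F := fun _ ht =>
  MeasurableSpace.measurableSet_iInf.2 fun s => hF s ht

lemma measurable_outcome_mk (s : Counts P × ℕ) :
    Measurable (fun x : Vertex s.1 → ℝ × ℝ => (⟨s, x⟩ : Outcome P)) := fun _ ht =>
  MeasurableSpace.measurableSet_iInf.1 ht s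

lemma lintegral_law {F : Outcome P → ℝ≥0∞} (hF : ∀ s, Measurable fun x => F ⟨s, x⟩) :
    ∫⁻ ω, F ω ∂law P = expect (sampleCounts P) fun s =>
      ∫⁻ x, F ⟨s, x⟩ ∂Measure.pi fun v : Vertex s.1 => pointLaw P v.1 := by
  unfold law
  rw [lintegral_sum_measure]
  refine tsum_congr fun s => ?_
  rw [lintegral_smul_measure, lintegral_map (measurable_outcome hF) (measurable_outcome_mk s)]
  rfl

lemma lintegral_Ico_mul {w : ℝ} (hw : 0 ≤ w) (f : ℝ → ℝ≥0∞) (M : ℕ) :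
    ∫⁻ θ in Set.Ico 0 (M * w), f θ =
      ∑ a ∈ Finset.range M, ∫⁻ θ in Set.Ico (a * w) (((a : ℝ) + 1) * w), f θ := by
  induction M with
  | zero => simp
  | succ M ih =>
    rw [Finset.sum_range_succ, ← ih, ← lintegral_union measurableSet_Ico]
    · congr 2
      push_cast
      rw [Set.Ico_union_Ico_eq_Ico (by positivity)]
      exact mul_le_mul_of_nonneg_right (by linarith) hw
    · exact Set.disjoint_left.2 fun x hx hx' => absurd hx.2 (not_lt.2 hx'.1)

lemma lintegral_comp_floor {w : ℝ} (hw : 0 < w) (F : ℕ → ℝ≥0∞) (s : ℕ) :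
    ∫⁻ θ in Set.Ico (s * w) (((s : ℝ) + 1) * w), F ⌊θ / w⌋₊ = F s * ENNReal.ofReal w := by
  rw [setLIntegral_congr_fun (g := fun _ => F s) measurableSet_Ico]
  · rw [setLIntegral_const, Real.volume_Ico]
    congr 2
    ring
  · intro θ hθ
    simp only
    congr 1
    rw [Nat.floor_eq_iff (div_nonneg ((by positivity : (0 : ℝ) ≤ s * w).trans hθ.1) hw.le),
      le_div_iff₀ hw, div_lt_iff₀ hw]
    exact hθ

variable (hP : P.Valid)
include hP

lemma Params.Valid.radialLaw_Ico (i : Fin (numAnnuli P)) :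
    radialLaw P (Set.Ico (radialBound P i) (radialBound P (i + 1))) =
      ENNReal.ofReal (annulusProb P i) := by
  have hle : radialBound P i ≤ radialBound P (i + 1) := hP.radialBound_mono (Nat.le_succ _)
  have hnn : ∀ r, 0 ≤ r → 0 ≤ radialDensity P r := fun r hr =>
    mul_nonneg hP.α_pos.le (div_nonneg
      (sinh_nonneg_iff.2 (mul_nonneg hP.α_pos.le hr)) hP.cosh_sub_one_pos.le)
  have hcont : Continuous (radialDensity P) := by
    have : radialDensity P = fun r => P.α * (sinh (P.α * r) / (cosh (P.α * P.R) - 1)) := rfl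
    rw [this]
    fun_prop
  unfold radialLaw annulusProb
  rw [withDensity_apply _ measurableSet_Ico, Measure.restrict_restrict measurableSet_Ico,
    Set.inter_eq_left.2 (Set.Ico_subset_Ico (hP.radialBound_nonneg _) (hP.radialBound_le i.2)),
    intervalIntegral.integral_of_le hle, ← ofReal_integral_eq_lintegral_ofReal]
  · rw [integral_Ico_eq_integral_Ioc]
  · exact hcont.integrableOn_Icc.mono_set Set.Ico_subset_Icc_self
  · filter_upwards [ae_restrict_mem measurableSet_Ico] with r hr
    exact hnn r ((hP.radialBound_nonneg _).trans hr.1)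

lemma Params.Valid.isProbabilityMeasure_radialCond (i : Fin (numAnnuli P)) :
    IsProbabilityMeasure
      (cond (radialLaw P) (Set.Ico (radialBound P i) (radialBound P (i + 1)))) := by
  refine cond_isProbabilityMeasure_of_finite ?_ ?_
  · rw [hP.radialLaw_Ico, Ne, ENNReal.ofReal_eq_zero, not_le]
    exact hP.annulusProb_pos i
  · rw [hP.radialLaw_Ico]
    exact ENNReal.ofReal_ne_top

omit hP in
lemma volume_cell (i : Fin (numAnnuli P)) (a : ℕ) :
    volume (Set.Ico ((a : ℝ) * cellWidth P i) (((a : ℝ) + 1) * cellWidth P i)) =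
      ENNReal.ofReal (cellWidth P i) := by
  rw [Real.volume_Ico]
  congr 1
  ring

omit hP in
lemma isProbabilityMeasure_angularCond (i : Fin (numAnnuli P)) (a : ℕ) :
    IsProbabilityMeasure (cond (volume : Measure ℝ)
      (Set.Ico ((a : ℝ) * cellWidth P i) (((a : ℝ) + 1) * cellWidth P i))) := by
  refine cond_isProbabilityMeasure_of_finite ?_ ?_
  · rw [volume_cell, Ne, ENNReal.ofReal_eq_zero, not_le]
    exact cellWidth_pos i
  · rw [volume_cell]
    exact ENNReal.ofReal_ne_top

lemma Params.Valid.isProbabilityMeasure_pointLaw (c : Cell P) :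
    IsProbabilityMeasure (pointLaw P c) := by
  have := hP.isProbabilityMeasure_radialCond c.1
  have := isProbabilityMeasure_angularCond c.1 c.2
  unfold pointLaw
  infer_instance

lemma Params.Valid.ae_pointLaw (c : Cell P) : ∀ᵐ x ∂pointLaw P c,
    x.1 ∈ Set.Ico (radialBound P c.1) (radialBound P (c.1 + 1)) ∧
    x.2 ∈ Set.Ico ((c.2 : ℝ) * cellWidth P c.1) (((c.2 : ℝ) + 1) * cellWidth P c.1) := by
  have := hP.isProbabilityMeasure_radialCond c.1
  have := isProbabilityMeasure_angularCond c.1 c.2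
  have h1 := (Measure.quasiMeasurePreserving_fst
    (μ := cond (radialLaw P) (Set.Ico (radialBound P c.1) (radialBound P (c.1 + 1))))
    (ν := cond volume (Set.Ico ((c.2 : ℝ) * cellWidth P c.1)
      (((c.2 : ℝ) + 1) * cellWidth P c.1)))).ae (ae_cond_mem measurableSet_Ico)
  have h2 := (Measure.quasiMeasurePreserving_snd
    (μ := cond (radialLaw P) (Set.Ico (radialBound P c.1) (radialBound P (c.1 + 1))))
    (ν := cond volume (Set.Ico ((c.2 : ℝ) * cellWidth P c.1)
      (((c.2 : ℝ) + 1) * cellWidth P c.1)))).ae (ae_cond_mem measurableSet_Ico)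
  filter_upwards [h1, h2] with x hx1 hx2 using ⟨hx1, hx2⟩

lemma Params.Valid.lintegral_pointLaw (c : Cell P) {f : ℝ → ℝ≥0∞} (hf : Measurable f) :
    ∫⁻ x, f x.2 ∂pointLaw P c = (ENNReal.ofReal (cellWidth P c.1))⁻¹ *
      ∫⁻ θ in Set.Ico ((c.2 : ℝ) * cellWidth P c.1) (((c.2 : ℝ) + 1) * cellWidth P c.1), f θ := by
  have := hP.isProbabilityMeasure_radialCond c.1
  have := isProbabilityMeasure_angularCond c.1 c.2
  unfold pointLaw
  rw [lintegral_prod (fun x : ℝ × ℝ => f x.2) (hf.comp measurable_snd).aemeasurable]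
  simp only [lintegral_const, measure_univ, mul_one]
  unfold ProbabilityTheory.cond
  rw [lintegral_smul_measure, volume_cell]
  rfl

/-- A uniformly random cell of annulus `i` and a random point in it make a uniformly random cell of
annulus `j`. -/
lemma Params.Valid.sum_lintegral_pointLaw (i j : Fin (numAnnuli P)) (F : ℕ → ℝ≥0∞) :
    ∑ a : Fin (numCells P i), ∫⁻ x, F (angularIndex j x) ∂pointLaw P ⟨i, a⟩ =
      ENNReal.ofReal (numCells P i / numCells P j) * ∑ s ∈ Finset.range (numCells P j), F s := by
  have hf : Measurable fun θ : ℝ => F ⌊θ / cellWidth P j⌋₊ :=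
    (measurable_from_nat (f := F)).comp (Nat.measurable_floor.comp (measurable_id.div_const _))
  have h1 : ∀ a : Fin (numCells P i), ∫⁻ x, F (angularIndex j x) ∂pointLaw P ⟨i, a⟩ =
      (ENNReal.ofReal (cellWidth P i))⁻¹ * ∫⁻ θ in Set.Ico ((a : ℕ) * cellWidth P i)
        ((((a : ℕ) : ℝ) + 1) * cellWidth P i), F ⌊θ / cellWidth P j⌋₊ := fun a =>
    hP.lintegral_pointLaw ⟨i, a⟩ hf
  have hwi := cellWidth_pos i
  have hwj := cellWidth_pos j
  simp_rw [h1]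
  -- The cells of either annulus tile [0, 2π): glue the integrals over the cells of annulus i and
  -- cut again along those of annulus j.
  rw [← Finset.mul_sum, Fin.sum_univ_eq_sum_range (fun a => ∫⁻ θ in Set.Ico ((a : ℕ) * cellWidth P i)
    ((((a : ℕ) : ℝ) + 1) * cellWidth P i), F ⌊θ / cellWidth P j⌋₊), ← lintegral_Ico_mul hwi.le,
    numCells_mul_cellWidth, ← numCells_mul_cellWidth j, lintegral_Ico_mul hwj.le]
  simp_rw [lintegral_comp_floor hwj]
  rw [← Finset.sum_mul, mul_comm (∑ s ∈ _, F s), ← mul_assoc]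
  congr 1
  rw [← ENNReal.ofReal_inv_of_pos hwi, ← ENNReal.ofReal_mul (inv_nonneg.2 hwi.le)]
  congr 1
  have hMi : (0 : ℝ) < numCells P i := by exact_mod_cast numCells_pos i
  have hMj : (0 : ℝ) < numCells P j := by exact_mod_cast numCells_pos j
  unfold cellWidth
  have := pi_pos
  field_simp

lemma Params.Valid.lintegral_pi_prod {N : Counts P} {f : Vertex N → ℝ × ℝ → ℝ≥0∞}
    (hf : ∀ v, Measurable (f v)) :
    ∫⁻ x, ∏ v, f v (x v) ∂Measure.pi (fun v : Vertex N => pointLaw P v.1) =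
      ∏ v, ∫⁻ x, f v x ∂pointLaw P v.1 := by
  have := fun v : Vertex N => hP.isProbabilityMeasure_pointLaw v.1
  rw [lintegral_prod_eq_prod_lintegral_of_indepFun Finset.univ
    (fun (v : Vertex N) (x : Vertex N → ℝ × ℝ) => f v (x v))
    (iIndepFun_pi (X := f) fun v => (hf v).aemeasurable)
    (fun v => (hf v).comp (measurable_pi_apply v))]
  refine Finset.prod_congr rfl fun v _ => ?_
  exact (measurePreserving_eval (fun v : Vertex N => pointLaw P v.1) v).lintegral_comp (hf v)

lemma Params.Valid.law_univ : law P Set.univ = 1 := by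
  have := fun c => hP.isProbabilityMeasure_pointLaw c
  rw [← lintegral_one, lintegral_law fun s => measurable_const]
  simp [expect_const]

lemma Params.Valid.isProbabilityMeasure_law : IsProbabilityMeasure (law P) := ⟨hP.law_univ⟩

omit hP in
/-- All vertices lie in their cells. -/
def InCells (ω : Outcome P) : Prop := ∀ v : Vertex ω.1.1,
  (ω.2 v).1 ∈ Set.Ico (radialBound P v.1.1) (radialBound P (v.1.1 + 1)) ∧
  (ω.2 v).2 ∈ Set.Ico ((v.1.2 : ℝ) * cellWidth P v.1.1) (((v.1.2 : ℝ) + 1) * cellWidth P v.1.1)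

omit hP in
lemma measurableSet_outcome {S : Set (Outcome P)}
    (h : ∀ s, MeasurableSet {x : Vertex s.1 → ℝ × ℝ | (⟨s, x⟩ : Outcome P) ∈ S}) :
    MeasurableSet S :=
  MeasurableSpace.measurableSet_iInf.2 h

lemma Params.Valid.ae_inCells : ∀ᵐ ω ∂law P, InCells ω ∧ ω.1 ∈ (sampleCounts P).support := by
  have := fun c => hP.isProbabilityMeasure_pointLaw c
  have hmeas : MeasurableSet {ω : Outcome P | InCells ω ∧ ω.1 ∈ (sampleCounts P).support} := by
    refine measurableSet_outcome fun s => ?_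
    refine MeasurableSet.inter ?_ (MeasurableSet.const (s ∈ (sampleCounts P).support))
    change MeasurableSet {x : Vertex s.1 → ℝ × ℝ | ∀ v : Vertex s.1,
      (x v).1 ∈ Set.Ico (radialBound P v.1.1) (radialBound P (v.1.1 + 1)) ∧
      (x v).2 ∈ Set.Ico ((v.1.2 : ℝ) * cellWidth P v.1.1)
        (((v.1.2 : ℝ) + 1) * cellWidth P v.1.1)}
    rw [Set.ofPred_forall]
    refine MeasurableSet.iInter fun v => ?_
    exact ((measurable_fst.comp (measurable_pi_apply v)) measurableSet_Ico).inter
      ((measurable_snd.comp (measurable_pi_apply v)) measurableSet_Ico)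
  unfold law
  rw [Measure.ae_sum_iff' hmeas]
  intro s
  by_cases hs : sampleCounts P s = 0
  · rw [hs, zero_smul]
    simp
  · refine Measure.ae_smul_measure ?_ _
    rw [ae_map_iff (measurable_outcome_mk s).aemeasurable hmeas]
    have : ∀ᵐ x ∂Measure.pi (fun v : Vertex s.1 => pointLaw P v.1), ∀ v : Vertex s.1,
        (x v).1 ∈ Set.Ico (radialBound P v.1.1) (radialBound P (v.1.1 + 1)) ∧
        (x v).2 ∈ Set.Ico ((v.1.2 : ℝ) * cellWidth P v.1.1)
          (((v.1.2 : ℝ) + 1) * cellWidth P v.1.1) := by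
      rw [eventually_countable_forall]
      intro v
      exact (Measure.quasiMeasurePreserving_eval (fun v : Vertex s.1 => pointLaw P v.1) v).ae
        (hP.ae_pointLaw v.1)
    filter_upwards [this] with x hx using ⟨hx, hs⟩

end Law

end RHG

namespace RHG

open Real MeasureTheory ProbabilityTheory
open scoped ENNReal

/-! ## Exponential moments of the sample -/

lemma expect_multinomialVariate_of_pos (q : unitInterval) {k : ℕ} (hk : 0 < k) (w : Fin k → ℝ)
    (hw : ∀ j, 0 < w j) (n : ℕ) (z : Fin k → ℝ) (hz : ∀ j, 0 ≤ z j) :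
    expect (multinomialVariate q k w n) (fun y => ENNReal.ofReal (∏ j, z j ^ y.1 j)) =
      ENNReal.ofReal (((∑ j, w j * z j) / ∑ j, w j) ^ n) := by
  obtain ⟨k, rfl⟩ := Nat.exists_eq_succ_of_ne_zero hk.ne'
  exact expect_multinomialVariate q k w hw n z hz

lemma sum_of_mem_support_multinomialVariate_of_pos {q : unitInterval} {k : ℕ} (hk : 0 < k)
    {w : Fin k → ℝ} (hw : ∀ j, 0 < w j) {n : ℕ} {y : (Fin k → ℕ) × ℕ}
    (hy : y ∈ (multinomialVariate q k w n).support) : ∑ j, y.1 j = n := by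
  obtain ⟨k, rfl⟩ := Nat.exists_eq_succ_of_ne_zero hk.ne'
  exact sum_of_mem_support_multinomialVariate hw hy

section Moments

variable {P : Params}

/-- The number of vertices in annulus `i`. -/
noncomputable def annulusCount (N : Counts P) (i : Fin (numAnnuli P)) : ℕ := ∑ a, N i a

/-- The mean of a function over the cells of annulus `j`. -/
noncomputable def cellMean (j : Fin (numAnnuli P)) (f : ℕ → ℝ) : ℝ :=
  (∑ s ∈ Finset.range (numCells P j), f s) / numCells P j

lemma expect_sampleCounts (F : Counts P × ℕ → ℝ≥0∞) :
    expect (sampleCounts P) F =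
      expect (multinomialVariate P.q (numAnnuli P) (annulusProb P) P.n) fun x =>
        expect (sampleAll (numAnnuli P) fun i =>
          multinomialVariate P.q (numCells P i) (fun _ => 1) (x.1 i)) fun y =>
            F (y.1, x.2 + y.2) := by
  unfold sampleCounts
  simp only [expect_bind, expect_pure]

lemma mem_support_sampleCounts {s : Counts P × ℕ} (hs : s ∈ (sampleCounts P).support) :
    ∃ x ∈ (multinomialVariate P.q (numAnnuli P) (annulusProb P) P.n).support,
      ∀ i, annulusCount s.1 i = x.1 i := by
  unfold sampleCounts at hs
  erw [PMF.mem_support_bind_iff] at hs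
  obtain ⟨x, hx, hs⟩ := hs
  erw [PMF.mem_support_bind_iff] at hs
  obtain ⟨y, hy, hs⟩ := hs
  erw [PMF.mem_support_pure_iff] at hs
  subst hs
  refine ⟨x, hx, fun i => ?_⟩
  obtain ⟨t, ht⟩ := mem_support_sampleAll hy i
  exact sum_of_mem_support_multinomialVariate_of_pos (numCells_pos i) (fun _ => one_pos) ht

/-- Vertices of one cell have the same law, so a product over vertices collapses to powers indexed
by cells, as in the generating function of a multinomial variate. -/
lemma prod_annulus {N : Counts P} (i : Fin (numAnnuli P)) (m : Fin (numCells P i) → ℝ≥0∞) :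
    ∏ v : Vertex N, (if h : v.1.1 = i then m (h ▸ v.1.2) else 1) = ∏ a, m a ^ N i a := by
  rw [Fintype.prod_sigma, Fintype.prod_sigma, Finset.prod_eq_single i]
  · simp
  · intro b _ hb
    simp [hb]
  · simp

lemma measure_le_lintegral_of_one_le {β : Type} [MeasurableSpace β] (μ : Measure β)
    {F : β → ℝ≥0∞} (hF : Measurable F) {S : Set β} (hS : ∀ x ∈ S, 1 ≤ F x) :
    μ S ≤ ∫⁻ x, F x ∂μ := by
  have h := mul_meas_ge_le_lintegral (μ := μ) hF 1
  rw [one_mul] at h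
  exact (measure_mono hS).trans h

/-- Given the annulus totals, the annuli are filled independently; a bound that is uniform in the
frozen counts `y` of the other annuli and in the total `n` survives averaging. -/
lemma expect_sampleCounts_le {F : Counts P → ℝ≥0∞} {B : ℝ≥0∞}
    (i : Fin (numAnnuli P))
    (h : ∀ (y : Counts P) (n : ℕ), expect (multinomialVariate P.q (numCells P i) (fun _ => 1) n)
      (fun t => F (Function.update y i t.1)) ≤ B) :
    expect (sampleCounts P) (fun s => F s.1) ≤ B := by
  rw [expect_sampleCounts]
  exact expect_le_of_support fun x _ => expect_sampleAll_le _ _ F i B fun y => h y _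

variable (hP : P.Valid)
include hP

/-- A product of functions of the angles of the vertices in an annulus is unlikely to be much
larger than its conditional expectation given the other annuli. -/
lemma Params.Valid.law_prod_le (i j : Fin (numAnnuli P)) (f : Counts P → ℕ → ℝ)
    (hf0 : ∀ N s, 0 < f N s) (hfi : ∀ N y, f (Function.update N i y) = f N) (ε : ℝ) :
    law P {ω | cellMean j (f ω.1.1) ^ annulusCount ω.1.1 i ≤
      ε * ∏ v : Vertex ω.1.1, if v.1.1 = i then f ω.1.1 (angularIndex j (ω.2 v)) else 1} ≤
      ENNReal.ofReal ε := by
  rcases lt_or_ge ε 0 with hε | hε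
  -- For negative ε the event is empty, its left side being nonnegative and the product positive.
  · refine le_of_eq_of_le ?_ zero_le
    convert measure_empty (μ := law P)
    refine Set.eq_empty_of_forall_notMem fun ω hω => ?_
    have h1 : 0 ≤ cellMean j (f ω.1.1) ^ annulusCount ω.1.1 i :=
      pow_nonneg (div_nonneg (Finset.sum_nonneg fun s _ => (hf0 _ s).le) (Nat.cast_nonneg _)) _
    have h2 : 0 < ∏ v : Vertex ω.1.1,
        if v.1.1 = i then f ω.1.1 (angularIndex j (ω.2 v)) else 1 := by
      refine Finset.prod_pos fun v _ => ?_
      split_ifs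
      exacts [hf0 _ _, one_pos]
    have h3 : cellMean j (f ω.1.1) ^ annulusCount ω.1.1 i ≤ ε * _ := hω
    nlinarith
  have hmean : ∀ N, 0 < cellMean j (f N) := fun N =>
    div_pos (Finset.sum_pos (fun s _ => hf0 N s)
      (Finset.nonempty_range_iff.2 (numCells_pos j).ne')) (by exact_mod_cast numCells_pos j)
  -- The conditional mean of the factor contributed by a vertex in cell `a`.
  set m : Counts P → Fin (numCells P i) → ℝ≥0∞ := fun N a =>
    ∫⁻ x, ENNReal.ofReal (f N (angularIndex j x)) ∂pointLaw P ⟨i, a⟩ with hm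
  have hmsum : ∀ N, ∑ a, m N a =
      ENNReal.ofReal (numCells P i * cellMean j (f N)) := by
    intro N
    rw [hm]
    simp only
    rw [hP.sum_lintegral_pointLaw i j (fun s => ENNReal.ofReal (f N s)),
      ← ENNReal.ofReal_sum_of_nonneg fun s _ => (hf0 N s).le, ← ENNReal.ofReal_mul (by positivity)]
    congr 1
    unfold cellMean
    ring
  have hmtop : ∀ N a, m N a ≠ ∞ := by
    intro N a h
    have : ∑ a, m N a = ∞ := ENNReal.sum_eq_top.2 ⟨a, Finset.mem_univ _, h⟩
    rw [hmsum] at this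
    exact ENNReal.ofReal_ne_top this
  have hmi : ∀ N y, m (Function.update N i y) = m N := by
    intro N y
    rw [hm]
    simp only [hfi]
  -- The product normalized by its conditional expectation: it is at least 1 on the event and has
  -- expectation ε.
  set F : Outcome P → ℝ≥0∞ := fun ω =>
    ENNReal.ofReal (ε * (cellMean j (f ω.1.1) ^ annulusCount ω.1.1 i)⁻¹) *
      ∏ v : Vertex ω.1.1,
        ENNReal.ofReal (if v.1.1 = i then f ω.1.1 (angularIndex j (ω.2 v)) else 1) with hF
  have hmeas : ∀ N : Counts P, ∀ v : Vertex N, Measurable fun x : ℝ × ℝ =>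
      ENNReal.ofReal (if v.1.1 = i then f N (angularIndex j x) else 1) := by
    intro N v
    refine ENNReal.measurable_ofReal.comp ?_
    split_ifs
    · exact (measurable_from_nat (f := f N)).comp (measurable_angularIndex j)
    · exact measurable_const
  have hprod : ∀ N : Counts P, Measurable fun x : Vertex N → ℝ × ℝ =>
      ∏ v : Vertex N, ENNReal.ofReal (if v.1.1 = i then f N (angularIndex j (x v)) else 1) :=
    fun N => Finset.measurable_prod _ fun v _ => (hmeas N v).comp (measurable_pi_apply v)
  have hFm : ∀ s, Measurable fun x => F ⟨s, x⟩ := fun s =>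
    Measurable.const_mul (hprod s.1)
      (ENNReal.ofReal (ε * (cellMean j (f s.1) ^ annulusCount s.1 i)⁻¹))
  refine (measure_le_lintegral_of_one_le _ (measurable_outcome hFm) fun ω hω => ?_).trans ?_
  · have hω' : cellMean j (f ω.1.1) ^ annulusCount ω.1.1 i ≤ ε * _ := hω
    have hc := pow_pos (hmean ω.1.1) (annulusCount ω.1.1 i)
    rw [hF]
    simp only
    rw [← ENNReal.ofReal_prod_of_nonneg, ← ENNReal.ofReal_mul (by positivity),
      ENNReal.one_le_ofReal]
    · calc (1 : ℝ) = (cellMean j (f ω.1.1) ^ annulusCount ω.1.1 i)⁻¹ *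
            cellMean j (f ω.1.1) ^ annulusCount ω.1.1 i := (inv_mul_cancel₀ hc.ne').symm
        _ ≤ (cellMean j (f ω.1.1) ^ annulusCount ω.1.1 i)⁻¹ * (ε * _) := by gcongr
        _ = _ := by ring
    · intro v _
      split_ifs
      exacts [(hf0 _ _).le, zero_le_one]
  · rw [lintegral_law hFm]
    have hint : ∀ s : Counts P × ℕ,
        ∫⁻ x, F ⟨s, x⟩ ∂Measure.pi (fun v : Vertex s.1 => pointLaw P v.1) =
        ENNReal.ofReal (ε * (cellMean j (f s.1) ^ annulusCount s.1 i)⁻¹) *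
          ∏ a, m s.1 a ^ s.1 i a := by
      intro s
      rw [hF]
      simp only
      rw [lintegral_const_mul _ (hprod s.1), hP.lintegral_pi_prod (hmeas s.1),
        ← prod_annulus]
      congr 1
      refine Finset.prod_congr rfl fun v _ => ?_
      obtain ⟨⟨i', a⟩, l⟩ := v
      by_cases h : i' = i
      · subst h
        simp [hm]
      · have := hP.isProbabilityMeasure_pointLaw ⟨i', a⟩
        simp [h]
    simp_rw [hint]
    refine expect_sampleCounts_le (F := fun N =>
      ENNReal.ofReal (ε * (cellMean j (f N) ^ annulusCount N i)⁻¹) * ∏ a, m N a ^ N i a) i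
      fun y n => ?_
    -- On the support the annulus total equals `n`, so the normalization is constant and the
    -- generating function cancels it exactly.
    rw [expect_congr_support (g := fun t =>
      ENNReal.ofReal (ε * (cellMean j (f y) ^ n)⁻¹) *
        ENNReal.ofReal (∏ a, (m y a).toReal ^ t.1 a))]
    · rw [expect_const_mul, expect_multinomialVariate_of_pos _ (numCells_pos i) _
        (fun _ => one_pos) _ _ (fun _ => ENNReal.toReal_nonneg),
        ← ENNReal.ofReal_mul (mul_nonneg hε (inv_nonneg.2 (pow_nonneg (hmean y).le _)))]
      refine ENNReal.ofReal_le_ofReal (le_of_eq ?_)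
      have h1 : ∑ a, (m y a).toReal = numCells P i * cellMean j (f y) := by
        rw [← ENNReal.toReal_sum fun a _ => hmtop y a, hmsum, ENNReal.toReal_ofReal]
        exact mul_nonneg (Nat.cast_nonneg _) (hmean y).le
      have hMi : (numCells P i : ℝ) ≠ 0 := by exact_mod_cast (numCells_pos i).ne'
      have hc := (pow_pos (hmean y) n).ne'
      simp only [one_mul, Finset.sum_const, Finset.card_univ, Fintype.card_fin, nsmul_eq_mul,
        mul_one]
      rw [h1, mul_div_cancel_left₀ _ hMi, mul_assoc, inv_mul_cancel₀ hc, mul_one]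
    · intro t ht
      have hn : annulusCount (Function.update y i t.1) i = n := by
        unfold annulusCount
        simp only [Function.update_self]
        exact sum_of_mem_support_multinomialVariate_of_pos (numCells_pos i) (fun _ => one_pos) ht
      simp only [hfi, hmi, hn, Function.update_self]
      rw [ENNReal.ofReal_prod_of_nonneg fun a _ => pow_nonneg ENNReal.toReal_nonneg _]
      simp_rw [ENNReal.ofReal_pow ENNReal.toReal_nonneg, ENNReal.ofReal_toReal (hmtop y _)]

end Moments

end RHG

namespace RHG

open Real MeasureTheory ProbabilityTheory
open scoped ENNReal

/-! ## Concentration -/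

lemma exp_le_two_rpow {x : ℝ} (hx : 0 ≤ x) : exp x ≤ 2 ^ (2 * x) := by
  rw [rpow_def_of_pos two_pos]
  refine exp_le_exp.2 ?_
  nlinarith [log_two_gt_d9]

lemma exp_neg_le_two_rpow {x : ℝ} (hx : 0 ≤ x) : exp (-(x / 2)) ≤ 2 ^ (-(x / 4)) := by
  rw [rpow_def_of_pos two_pos]
  refine exp_le_exp.2 ?_
  nlinarith [log_two_lt_d9]

/-- Bernoulli's inequality for exponents in [0, 1], applied to the base 1/2; `two_rpow_le` is the
same with base 2. They linearize the exponential tilts of the two tail bounds. -/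
lemma two_rpow_neg_le {x : ℝ} (h0 : 0 ≤ x) (h1 : x ≤ 1) : (2 : ℝ) ^ (-x) ≤ 1 - x / 2 := by
  have h := rpow_one_add_le_one_add_mul_self (s := -(1 / 2 : ℝ)) (by norm_num) h0 h1
  rw [rpow_neg zero_le_two, ← inv_rpow zero_le_two]
  refine le_of_eq_of_le (by norm_num) (h.trans_eq (by ring))

lemma two_rpow_le {x : ℝ} (h0 : 0 ≤ x) (h1 : x ≤ 1) : (2 : ℝ) ^ x ≤ 1 + x := by
  have h := rpow_one_add_le_one_add_mul_self (s := (1 : ℝ)) (by norm_num) h0 h1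
  refine le_of_eq_of_le (by norm_num) (h.trans_eq (by ring))

/-- Replaces the exponential of a square, which has no usable moment, by 2^N, whose moments the
multinomial generating function provides. With x = N²/(32 l), the truncation N ≤ l gives x ≤ N/32,
so exp x - 1 ≤ x exp x ≤ N² (32/31)^N / (32 l), and N² (32/31)^N ≤ 32 · 2^N. -/
lemma exp_sq_le {N : ℕ} {l : ℝ} (hN : (N : ℝ) ≤ l) (hl : 0 < l) :
    exp ((N : ℝ) ^ 2 / (32 * l)) ≤ 1 + 2 ^ N / l := by
  set x := (N : ℝ) ^ 2 / (32 * l) with hx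
  have hN0 : (0 : ℝ) ≤ N := Nat.cast_nonneg _
  have hx0 : 0 ≤ x := by positivity
  have hxN : x ≤ N * (1 / 32) := by
    rw [hx, div_le_iff₀ (by positivity)]
    nlinarith
  have h1 : exp x ≤ 1 + x * exp x := by
    have h := add_one_le_exp (-x)
    have h2 : exp (-x) * exp x = 1 := by rw [← exp_add]; simp
    nlinarith [exp_pos x]
  have h2 : exp x ≤ (32 / 31) ^ N := by
    refine (exp_le_exp.2 hxN).trans ?_
    rw [exp_nat_mul]
    have h := add_one_le_exp (-(1 / 32) : ℝ)
    have h3 : exp (-(1 / 32) : ℝ) * exp (1 / 32) = 1 := by rw [← exp_add]; simp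
    have h4 : exp (1 / 32) ≤ (32 / 31 : ℝ) := by nlinarith [exp_pos (1 / 32 : ℝ)]
    gcongr
  have h3 : (N : ℝ) ^ 2 ≤ 9 * (16 / 9) ^ N := by
    have h := one_add_mul_le_pow (a := (1 / 3 : ℝ)) (by norm_num) N
    have h4 : ((1 : ℝ) + 1 / 3) ^ N * (1 + 1 / 3) ^ N = (16 / 9) ^ N := by
      rw [← mul_pow]; norm_num
    rw [← h4]
    nlinarith
  have h5 : (16 / 9 : ℝ) ^ N * (32 / 31) ^ N ≤ 2 ^ N := by
    rw [← mul_pow]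
    gcongr
    norm_num
  have h6 : x * exp x ≤ 2 ^ N / l := by
    rw [hx, le_div_iff₀ hl]
    calc (N : ℝ) ^ 2 / (32 * l) * exp x * l = (N : ℝ) ^ 2 * exp x / 32 := by field_simp
      _ ≤ 9 * (16 / 9) ^ N * (32 / 31) ^ N / 32 := by gcongr
      _ = 9 / 32 * ((16 / 9) ^ N * (32 / 31) ^ N) := by ring
      _ ≤ 9 / 32 * 2 ^ N := by gcongr
      _ ≤ 2 ^ N := by
        have : (0 : ℝ) < 2 ^ N := by positivity
        linarith
  linarith

section Concentration

variable {P : Params}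

/-- The sum of a function of the angular index with respect to annulus `j` over the vertices of
annulus `i`. -/
noncomputable def annulusSum (ω : Outcome P) (i j : Fin (numAnnuli P)) (g : ℕ → ℝ) : ℝ :=
  ∑ v : Vertex ω.1.1, if v.1.1 = i then g (angularIndex j (ω.2 v)) else 0

lemma prod_rpow_annulus (ω : Outcome P) (i j : Fin (numAnnuli P)) (g : ℕ → ℝ) (c : ℝ) :
    ∏ v : Vertex ω.1.1, (if v.1.1 = i then (2 : ℝ) ^ (g (angularIndex j (ω.2 v)) / c) else 1) =
      2 ^ (annulusSum ω i j g / c) := by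
  unfold annulusSum
  rw [Finset.sum_div, rpow_sum_of_pos two_pos]
  refine Finset.prod_congr rfl fun v _ => ?_
  split_ifs <;> simp

lemma cellMean_mono (j : Fin (numAnnuli P)) {f g : ℕ → ℝ} (h : ∀ s, f s ≤ g s) :
    cellMean j f ≤ cellMean j g :=
  div_le_div_of_nonneg_right (Finset.sum_le_sum fun s _ => h s) (Nat.cast_nonneg _)

lemma cellMean_one_add (j : Fin (numAnnuli P)) (g : ℕ → ℝ) (c : ℝ) :
    cellMean j (fun s => 1 + g s * c) = 1 + cellMean j g * c := by
  have hM : (numCells P j : ℝ) ≠ 0 := by exact_mod_cast (numCells_pos j).ne'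
  unfold cellMean
  rw [Finset.sum_add_distrib, ← Finset.sum_mul]
  simp only [Finset.sum_const, Finset.card_range, nsmul_eq_mul, mul_one]
  field_simp

lemma cellMean_nonneg (j : Fin (numAnnuli P)) {g : ℕ → ℝ} (h : ∀ s, 0 ≤ g s) :
    0 ≤ cellMean j g :=
  div_nonneg (Finset.sum_nonneg fun s _ => h s) (Nat.cast_nonneg _)

lemma annulusSum_zero {ω : Outcome P} {i j : Fin (numAnnuli P)} {g : ℕ → ℝ} (h : ∀ s, g s = 0) :
    annulusSum ω i j g = 0 := by
  simp [annulusSum, h]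

lemma one_add_pow_le_exp {x : ℝ} (hx : -1 ≤ x) (n : ℕ) : (1 + x) ^ n ≤ exp (n * x) := by
  rw [exp_nat_mul]
  exact pow_le_pow_left₀ (by linarith) (by linarith [add_one_le_exp x]) n

variable (hP : P.Valid)
include hP

/-- Chernoff bound with tilt 2^(g/G): the mean of a factor is at most 1 + μ/G, and (1 + μ/G)^n ≤
exp(n μ/G) ≤ 2^(2 n μ/G), whence the factor 2. Both `g` and its bound `G` may be random as long as
they ignore the cell counts of annulus i. -/
lemma Params.Valid.law_lt_annulusSum (i j : Fin (numAnnuli P)) (g : Counts P → ℕ → ℝ)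
    (G : Counts P → ℝ) (hg0 : ∀ N s, 0 ≤ g N s) (hgG : ∀ N s, g N s ≤ G N)
    (hgi : ∀ N y, g (Function.update N i y) = g N) (hGi : ∀ N y, G (Function.update N i y) = G N)
    (l : ℝ) :
    law P {ω | 2 * (annulusCount ω.1.1 i * cellMean j (g ω.1.1)) + G ω.1.1 * l <
      annulusSum ω i j (g ω.1.1)} ≤ ENNReal.ofReal (2 ^ (-l)) := by
  refine (measure_mono fun ω hω => ?_).trans (hP.law_prod_le i j (fun N s => 2 ^ (g N s / G N))
    (fun N s => rpow_pos_of_pos two_pos _) (fun N y => by simp only [hgi, hGi]) (2 ^ (-l)))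
  have hω' : 2 * (annulusCount ω.1.1 i * cellMean j (g ω.1.1)) + G ω.1.1 * l <
    annulusSum ω i j (g ω.1.1) := hω
  change (_ : ℝ) ≤ (2 : ℝ) ^ (-l) * _
  rw [prod_rpow_annulus, ← rpow_add two_pos]
  have hG0 : 0 ≤ G ω.1.1 := (hg0 _ 0).trans (hgG _ 0)
  rcases hG0.eq_or_lt with hG | hG
  -- Here G = 0, where the quotient g/G is meaningless; the event itself is impossible.
  · have hz : ∀ s, g ω.1.1 s = 0 := fun s => le_antisymm (hG ▸ hgG _ s) (hg0 _ s)
    rw [annulusSum_zero hz, ← hG] at hω'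
    have := mul_nonneg (Nat.cast_nonneg (α := ℝ) (annulusCount ω.1.1 i))
      (cellMean_nonneg j (hg0 ω.1.1))
    linarith
  · have hμ := cellMean_nonneg j (hg0 ω.1.1)
    have h1 : cellMean j (fun s => 2 ^ (g ω.1.1 s / G ω.1.1)) ≤
        1 + cellMean j (g ω.1.1) * (G ω.1.1)⁻¹ := by
      rw [← cellMean_one_add]
      refine cellMean_mono j fun s => ?_
      rw [← div_eq_mul_inv]
      exact two_rpow_le (div_nonneg (hg0 _ s) hG0) ((div_le_one hG).2 (hgG _ s))
    have hx : 0 ≤ cellMean j (g ω.1.1) * (G ω.1.1)⁻¹ := mul_nonneg hμ (inv_nonneg.2 hG0)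
    refine (pow_le_pow_left₀ (cellMean_nonneg j fun s => rpow_nonneg zero_le_two _) h1 _).trans ?_
    refine (one_add_pow_le_exp (by linarith) _).trans ?_
    refine (exp_le_two_rpow (mul_nonneg (Nat.cast_nonneg _) hx)).trans ?_
    refine rpow_le_rpow_of_exponent_le one_le_two ?_
    rw [← div_eq_mul_inv]
    have h2 : (2 * (annulusCount ω.1.1 i * cellMean j (g ω.1.1)) + G ω.1.1 * l) / G ω.1.1 ≤
      annulusSum ω i j (g ω.1.1) / G ω.1.1 := div_le_div_of_nonneg_right hω'.le hG0
    rw [add_div, mul_div_cancel_left₀ _ hG.ne'] at h2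
    calc _ = 2 * (annulusCount ω.1.1 i * cellMean j (g ω.1.1)) / G ω.1.1 := by ring
      _ ≤ _ := by linarith

/-- The lower tail with tilt 2^(-g/G): one factor has mean at most 1 - μ/(2G), and exp(-n μ/(2G)) ≤
2^(-n μ/(4G)) produces the factor 1/4. -/
lemma Params.Valid.law_annulusSum_lt (i j : Fin (numAnnuli P)) (g : Counts P → ℕ → ℝ)
    (G : Counts P → ℝ) (hg0 : ∀ N s, 0 ≤ g N s) (hgG : ∀ N s, g N s ≤ G N)
    (hgi : ∀ N y, g (Function.update N i y) = g N) (hGi : ∀ N y, G (Function.update N i y) = G N)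
    (l : ℝ) :
    law P {ω | annulusSum ω i j (g ω.1.1) <
      annulusCount ω.1.1 i * cellMean j (g ω.1.1) / 4 - G ω.1.1 * l} ≤
      ENNReal.ofReal (2 ^ (-l)) := by
  refine (measure_mono fun ω hω => ?_).trans (hP.law_prod_le i j
    (fun N s => 2 ^ (g N s / -G N)) (fun N s => rpow_pos_of_pos two_pos _)
    (fun N y => by simp only [hgi, hGi]) (2 ^ (-l)))
  have hω' : annulusSum ω i j (g ω.1.1) <
      annulusCount ω.1.1 i * cellMean j (g ω.1.1) / 4 - G ω.1.1 * l := hω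
  change (_ : ℝ) ≤ (2 : ℝ) ^ (-l) * _
  rw [prod_rpow_annulus, ← rpow_add two_pos]
  have hG0 : 0 ≤ G ω.1.1 := (hg0 _ 0).trans (hgG _ 0)
  rcases hG0.eq_or_lt with hG | hG
  · have hz : ∀ s, g ω.1.1 s = 0 := fun s => le_antisymm (hG ▸ hgG _ s) (hg0 _ s)
    have hz' : cellMean j (g ω.1.1) = 0 := by simp [cellMean, hz]
    rw [annulusSum_zero hz, ← hG, hz'] at hω'
    linarith
  · have hμ := cellMean_nonneg j (hg0 ω.1.1)
    have h1 : cellMean j (fun s => 2 ^ (g ω.1.1 s / -G ω.1.1)) ≤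
        1 + cellMean j (g ω.1.1) * -(2 * G ω.1.1)⁻¹ := by
      rw [← cellMean_one_add]
      refine cellMean_mono j fun s => ?_
      rw [div_neg]
      refine (two_rpow_neg_le (div_nonneg (hg0 _ s) hG0)
        ((div_le_one hG).2 (hgG _ s))).trans_eq ?_
      rw [mul_inv]
      ring
    have hmG : cellMean j (g ω.1.1) ≤ G ω.1.1 := by
      have hM : (0 : ℝ) < numCells P j := by exact_mod_cast numCells_pos j
      unfold cellMean
      rw [div_le_iff₀ hM]
      refine (Finset.sum_le_sum fun s _ => hgG ω.1.1 s).trans_eq ?_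
      simp [mul_comm]
    have hx0 : 0 ≤ cellMean j (g ω.1.1) * (G ω.1.1)⁻¹ := mul_nonneg hμ (inv_nonneg.2 hG0)
    have hx1 : cellMean j (g ω.1.1) * (G ω.1.1)⁻¹ ≤ 1 := by
      rw [← div_eq_mul_inv]
      exact (div_le_one hG).2 hmG
    have hx : cellMean j (g ω.1.1) * -(2 * G ω.1.1)⁻¹ =
        -(cellMean j (g ω.1.1) * (G ω.1.1)⁻¹ / 2) := by
      rw [mul_inv]
      ring
    rw [hx] at h1
    refine (pow_le_pow_left₀ (cellMean_nonneg j fun s => rpow_nonneg zero_le_two _) h1 _).trans ?_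
    refine (one_add_pow_le_exp (by linarith) _).trans ?_
    have h3 := exp_neg_le_two_rpow (mul_nonneg (Nat.cast_nonneg (α := ℝ) (annulusCount ω.1.1 i)) hx0)
    refine le_of_eq_of_le (by congr 1; ring) (h3.trans ?_)
    refine rpow_le_rpow_of_exponent_le one_le_two ?_
    have h2 : annulusSum ω i j (g ω.1.1) / G ω.1.1 ≤
        (annulusCount ω.1.1 i * cellMean j (g ω.1.1) / 4 - G ω.1.1 * l) / G ω.1.1 :=
      div_le_div_of_nonneg_right hω'.le hG0
    rw [sub_div, mul_div_cancel_left₀ _ hG.ne'] at h2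
    rw [div_neg]
    calc _ ≤ -l - (annulusCount ω.1.1 i * cellMean j (g ω.1.1) / 4 / G ω.1.1 - l) := by
          apply le_of_eq
          rw [← div_eq_mul_inv]
          ring
      _ ≤ _ := by linarith

lemma Params.Valid.law_counts_le {Q : Counts P × ℕ → Prop} {F : Counts P × ℕ → ℝ≥0∞}
    (h : ∀ s, Q s → 1 ≤ F s) : law P {ω | Q ω.1} ≤ expect (sampleCounts P) F := by
  have := fun c => hP.isProbabilityMeasure_pointLaw c
  refine (measure_le_lintegral_of_one_le _ (F := fun ω : Outcome P => F ω.1)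
    (measurable_outcome fun s =>
      (measurable_const : Measurable fun _ : Vertex s.1 → ℝ × ℝ => F s)) fun ω hω => h _ hω).trans ?_
  rw [lintegral_law fun s =>
    (measurable_const : Measurable fun _ : Vertex s.1 → ℝ × ℝ => F s)]
  simp

lemma Params.Valid.expect_annulusCount (z : Fin (numAnnuli P) → ℝ) (hz : ∀ i, 0 ≤ z i) :
    expect (sampleCounts P) (fun s => ENNReal.ofReal (∏ i, z i ^ annulusCount s.1 i)) =
      ENNReal.ofReal ((∑ i, annulusProb P i * z i) ^ P.n) := by
  rw [expect_sampleCounts]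
  have h := expect_multinomialVariate_of_pos P.q hP.numAnnuli_pos (annulusProb P)
    hP.annulusProb_pos P.n z hz
  rw [hP.sum_annulusProb, div_one] at h
  rw [← h]
  refine congrArg _ (funext fun x => ?_)
  rw [← expect_const (sampleAll (numAnnuli P) fun i =>
          multinomialVariate P.q (numCells P i) (fun _ => 1) (x.1 i))
    (ENNReal.ofReal (∏ i, z i ^ x.1 i))]
  refine expect_congr_support fun y hy => ?_
  congr 1
  refine Finset.prod_congr rfl fun i _ => ?_
  congr 1
  obtain ⟨t, ht⟩ := mem_support_sampleAll hy i
  exact sum_of_mem_support_multinomialVariate_of_pos (numCells_pos i) (fun _ => one_pos) ht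

lemma Params.Valid.expect_rpow_annulusCount (i : Fin (numAnnuli P)) {z : ℝ} (hz : 0 ≤ z) :
    expect (sampleCounts P) (fun s => ENNReal.ofReal (z ^ annulusCount s.1 i)) ≤
      ENNReal.ofReal (exp (P.n * (annulusProb P i * (z - 1)))) := by
  have h := hP.expect_annulusCount (fun i' => if i' = i then z else 1)
    (fun i' => by split_ifs; exacts [hz, zero_le_one])
  have h1 : ∀ s : Counts P × ℕ,
      ∏ i', (if i' = i then z else 1) ^ annulusCount s.1 i' = z ^ annulusCount s.1 i := by
    intro s
    rw [Finset.prod_eq_single i] <;> simp +contextual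
  simp_rw [h1] at h
  rw [h]
  have h2 : ∑ i', annulusProb P i' * (if i' = i then z else 1) =
      1 + annulusProb P i * (z - 1) := by
    have : ∀ i', annulusProb P i' * (if i' = i then z else 1) =
        annulusProb P i' + if i' = i then annulusProb P i * (z - 1) else 0 := by
      intro i'
      split_ifs with h
      · subst h; ring
      · ring
    simp_rw [this]
    rw [Finset.sum_add_distrib, hP.sum_annulusProb]
    simp
  rw [h2]
  refine ENNReal.ofReal_le_ofReal (one_add_pow_le_exp ?_ _)
  nlinarith [hP.annulusProb_pos i, hP.annulusProb_le_one i]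

lemma Params.Valid.law_lt_annulusCount (i : Fin (numAnnuli P)) (l : ℝ) :
    law P {ω | 2 * (P.n * annulusProb P i) + l < annulusCount ω.1.1 i} ≤
      ENNReal.ofReal (2 ^ (-l)) := by
  set μ := P.n * annulusProb P i with hμ
  have hμ0 : 0 ≤ μ := mul_nonneg (Nat.cast_nonneg _) (hP.annulusProb_pos i).le
  refine (hP.law_counts_le (Q := fun s => 2 * μ + l < annulusCount s.1 i)
    (F := fun s => ENNReal.ofReal (2 ^ (-(2 * μ + l))) *
      ENNReal.ofReal (2 ^ annulusCount s.1 i)) fun s hs => ?_).trans ?_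
  · rw [← ENNReal.ofReal_mul (by positivity), ENNReal.one_le_ofReal, ← rpow_natCast,
      ← rpow_add two_pos]
    exact one_le_rpow one_le_two (by linarith)
  · rw [expect_const_mul]
    refine (mul_le_mul_right (hP.expect_rpow_annulusCount i zero_le_two) _).trans ?_
    rw [← ENNReal.ofReal_mul (by positivity)]
    refine ENNReal.ofReal_le_ofReal ?_
    have h := exp_le_two_rpow hμ0
    calc (2 : ℝ) ^ (-(2 * μ + l)) * exp (P.n * (annulusProb P i * (2 - 1)))
        = 2 ^ (-(2 * μ + l)) * exp μ := by rw [hμ]; congr 2; ring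
      _ ≤ 2 ^ (-(2 * μ + l)) * 2 ^ (2 * μ) := by gcongr
      _ = 2 ^ (-l) := by rw [← rpow_add two_pos]; congr 1; ring

lemma Params.Valid.law_annulusCount_lt (i : Fin (numAnnuli P)) (l : ℝ) :
    law P {ω | annulusCount ω.1.1 i < P.n * annulusProb P i / 4 - l} ≤
      ENNReal.ofReal (2 ^ (-l)) := by
  set μ := P.n * annulusProb P i with hμ
  have hμ0 : 0 ≤ μ := mul_nonneg (Nat.cast_nonneg _) (hP.annulusProb_pos i).le
  refine (hP.law_counts_le (Q := fun s => annulusCount s.1 i < μ / 4 - l)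
    (F := fun s => ENNReal.ofReal (2 ^ (μ / 4 - l)) *
      ENNReal.ofReal ((1 / 2) ^ annulusCount s.1 i)) fun s hs => ?_).trans ?_
  · rw [← ENNReal.ofReal_mul (by positivity), ENNReal.one_le_ofReal, one_div, inv_pow,
      ← rpow_natCast, ← rpow_neg zero_le_two, ← rpow_add two_pos]
    exact one_le_rpow one_le_two (by linarith)
  · rw [expect_const_mul]
    refine (mul_le_mul_right (hP.expect_rpow_annulusCount i (by norm_num)) _).trans ?_
    rw [← ENNReal.ofReal_mul (by positivity)]
    refine ENNReal.ofReal_le_ofReal ?_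
    have h := exp_neg_le_two_rpow hμ0
    calc (2 : ℝ) ^ (μ / 4 - l) * exp (P.n * (annulusProb P i * (1 / 2 - 1)))
        = 2 ^ (μ / 4 - l) * exp (-(μ / 2)) := by rw [hμ]; congr 2; ring
      _ ≤ 2 ^ (μ / 4 - l) * 2 ^ (-(μ / 4)) := by gcongr
      _ = 2 ^ (-l) := by rw [← rpow_add two_pos]; congr 1; ring

omit hP in
-- The loads of different cells are dependent, but expanding over subsets S of cells leaves terms
-- E[2^(load of S)] = (1 + |S|/M)^n ≤ exp(n/M)^|S|, as if the cells were independent; the terms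
-- recombine to (1 + η exp(n/M))^M.
lemma expect_prod_one_add (i : Fin (numAnnuli P)) {η : ℝ} (hη : 0 ≤ η) (n : ℕ) :
    expect (multinomialVariate P.q (numCells P i) (fun _ => 1) n)
      (fun y => ENNReal.ofReal (∏ a, (1 + η * 2 ^ y.1 a))) ≤
      ENNReal.ofReal (exp (numCells P i * (η * exp (n / numCells P i)))) := by
  have hM : (0 : ℝ) < numCells P i := by exact_mod_cast numCells_pos i
  have hexp : ∀ y : Fin (numCells P i) → ℕ, ∏ a, (1 + η * 2 ^ y a) =
      ∑ S ∈ Finset.univ.powerset, η ^ S.card * ∏ a, (if a ∈ S then (2 : ℝ) else 1) ^ y a := by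
    intro y
    rw [Finset.prod_one_add]
    refine Finset.sum_congr rfl fun S _ => ?_
    rw [Finset.prod_mul_distrib, Finset.prod_const]
    congr 1
    simp_rw [ite_pow, one_pow]
    rw [Finset.prod_ite_mem, Finset.univ_inter]
  have hnn : ∀ (S : Finset (Fin (numCells P i))) (y : Fin (numCells P i) → ℕ),
      0 ≤ ∏ a, (if a ∈ S then (2 : ℝ) else 1) ^ y a := fun S y =>
    Finset.prod_nonneg fun a _ => pow_nonneg (by split_ifs <;> norm_num) _
  simp_rw [hexp]
  simp_rw [ENNReal.ofReal_sum_of_nonneg fun S _ => mul_nonneg (pow_nonneg hη _) (hnn S _),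
    ENNReal.ofReal_mul (pow_nonneg hη _)]
  rw [expect_sum]
  simp_rw [expect_const_mul]
  have hS : ∀ S : Finset (Fin (numCells P i)),
      expect (multinomialVariate P.q (numCells P i) (fun _ => 1) n)
        (fun y => ENNReal.ofReal (∏ a, (if a ∈ S then (2 : ℝ) else 1) ^ y.1 a)) ≤
      ENNReal.ofReal (exp (n / numCells P i) ^ S.card) := by
    intro S
    rw [expect_multinomialVariate_of_pos _ (numCells_pos i) _ (fun _ => one_pos) _ _
      (fun a => by split_ifs <;> norm_num)]
    refine ENNReal.ofReal_le_ofReal ?_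
    have h1 : ∑ a : Fin (numCells P i), (1 : ℝ) * (if a ∈ S then 2 else 1) =
        numCells P i + S.card := by
      have : ∀ a : Fin (numCells P i), (1 : ℝ) * (if a ∈ S then 2 else 1) =
          1 + if a ∈ S then 1 else 0 := by
        intro a
        split_ifs <;> norm_num
      simp_rw [this, Finset.sum_add_distrib]
      simp
    rw [h1]
    simp only [Finset.sum_const, Finset.card_univ, Fintype.card_fin, nsmul_eq_mul, mul_one]
    rw [add_div, div_self hM.ne']
    refine (one_add_pow_le_exp (x := S.card / numCells P i)
      (le_trans (b := 0) (by norm_num) (by positivity)) n).trans_eq ?_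
    rw [← exp_nat_mul]
    congr 1
    ring
  calc _ ≤ ∑ S ∈ (Finset.univ : Finset (Fin (numCells P i))).powerset,
        ENNReal.ofReal (η ^ S.card) * ENNReal.ofReal (exp (n / numCells P i) ^ S.card) :=
        Finset.sum_le_sum fun S _ => mul_le_mul_right (hS S) _
    _ = ENNReal.ofReal (∏ a : Fin (numCells P i), (1 + η * exp (n / numCells P i))) := by
        rw [Finset.prod_one_add, ENNReal.ofReal_sum_of_nonneg fun S _ => by positivity]
        refine Finset.sum_congr rfl fun S _ => ?_
        rw [← ENNReal.ofReal_mul (pow_nonneg hη _), Finset.prod_const, mul_pow]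
    _ ≤ _ := by
        refine ENNReal.ofReal_le_ofReal ?_
        rw [Finset.prod_const, Finset.card_univ, Fintype.card_fin]
        exact one_add_pow_le_exp (x := η * exp (n / numCells P i))
          (le_trans (b := 0) (by norm_num) (by positivity)) _

/-- Markov's inequality for ∏ (1 + 2^N_a / l), which by `exp_sq_le` dominates exp(∑ N_a² / (32 l))
once all loads are at most l. This is where the expected second moment is linear in the number of
cells. -/
lemma Params.Valid.law_lt_sum_sq (i : Fin (numAnnuli P)) {l : ℝ} (hl : 0 < l) :
    law P {ω | (∀ a, (ω.1.1 i a : ℝ) ≤ l) ∧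
      32 * (numCells P i * exp (annulusCount ω.1.1 i / numCells P i) + l ^ 2) <
        ∑ a, (ω.1.1 i a : ℝ) ^ 2} ≤ ENNReal.ofReal (2 ^ (-l)) := by
  have hl' : (0 : ℝ) ≤ 1 / l := by positivity
  refine (hP.law_counts_le (Q := fun s => (∀ a, (s.1 i a : ℝ) ≤ l) ∧
      32 * (numCells P i * exp (annulusCount s.1 i / numCells P i) + l ^ 2) <
        ∑ a, (s.1 i a : ℝ) ^ 2)
    (F := fun s => ENNReal.ofReal (2 ^ (-l) *
        (exp (numCells P i * (1 / l * exp (annulusCount s.1 i / numCells P i))))⁻¹) *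
      ENNReal.ofReal (∏ a, (1 + 1 / l * 2 ^ s.1 i a))) fun s hs => ?_).trans ?_
  · obtain ⟨hs1, hs2⟩ := hs
    rw [← ENNReal.ofReal_mul (by positivity), ENNReal.one_le_ofReal]
    have h1 : exp ((∑ a, (s.1 i a : ℝ) ^ 2) / (32 * l)) ≤ ∏ a, (1 + 1 / l * 2 ^ s.1 i a) := by
      rw [Finset.sum_div, exp_sum]
      refine Finset.prod_le_prod (fun a _ => (exp_pos _).le) fun a _ => ?_
      refine (exp_sq_le (hs1 a) hl).trans_eq ?_
      ring
    have h2 : numCells P i * (1 / l * exp (annulusCount s.1 i / numCells P i)) + l ≤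
        (∑ a, (s.1 i a : ℝ) ^ 2) / (32 * l) := by
      rw [le_div_iff₀ (by positivity)]
      refine le_trans (le_of_eq ?_) hs2.le
      field_simp
    have h3 : exp (-l) ≤ (2 : ℝ) ^ (-l) := by
      rw [rpow_def_of_pos two_pos]
      refine exp_le_exp.2 ?_
      nlinarith [log_two_lt_d9]
    rw [← exp_neg]
    calc (1 : ℝ) = exp (-l) * exp (-(numCells P i *
          (1 / l * exp (annulusCount s.1 i / numCells P i)))) *
          exp (numCells P i * (1 / l * exp (annulusCount s.1 i / numCells P i)) + l) := by
          rw [← exp_add, ← exp_add]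
          symm
          rw [exp_eq_one_iff]
          ring
      _ ≤ 2 ^ (-l) * exp (-(numCells P i *
          (1 / l * exp (annulusCount s.1 i / numCells P i)))) *
          ∏ a, (1 + 1 / l * 2 ^ s.1 i a) := by
          refine mul_le_mul ?_ ((exp_le_exp.2 h2).trans h1) (exp_pos _).le (by positivity)
          gcongr
  · refine expect_sampleCounts_le (F := fun N => ENNReal.ofReal (2 ^ (-l) *
        (exp (numCells P i * (1 / l * exp (annulusCount N i / numCells P i))))⁻¹) *
      ENNReal.ofReal (∏ a, (1 + 1 / l * 2 ^ N i a))) i fun y n => ?_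
    rw [expect_congr_support (g := fun t => ENNReal.ofReal (2 ^ (-l) *
        (exp (numCells P i * (1 / l * exp (n / numCells P i))))⁻¹) *
      ENNReal.ofReal (∏ a, (1 + 1 / l * 2 ^ t.1 a)))]
    · rw [expect_const_mul]
      refine (mul_le_mul_right (expect_prod_one_add i hl' n) _).trans_eq ?_
      rw [← ENNReal.ofReal_mul (by positivity), mul_assoc, inv_mul_cancel₀ (exp_pos _).ne', mul_one]
    · intro t ht
      have hn : annulusCount (Function.update y i t.1) i = n := by
        unfold annulusCount
        simp only [Function.update_self]
        exact sum_of_mem_support_multinomialVariate_of_pos (numCells_pos i) (fun _ => one_pos) ht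
      simp only [hn, Function.update_self]

/-- There are k variates for the annuli and one for each cell, and each multiplies the exponential
moment of the number of trials by 2. -/
lemma Params.Valid.law_lt_trials (b : ℝ) :
    law P {ω | b < ω.1.2} ≤ ENNReal.ofReal
      (2 ^ (numAnnuli P + ∑ i, numCells P i) * (2 / (2 - (P.q : ℝ))) ^ (-b)) := by
  have hq0 : (0 : ℝ) ≤ P.q := P.q.2.1
  have hq1 : (P.q : ℝ) ≤ 1 := P.q.2.2
  set z := 2 / (2 - (P.q : ℝ)) with hz
  have hz1 : 1 ≤ z := by rw [hz, le_div_iff₀ (by linarith)]; linarith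
  have hz0 : 0 < z := by linarith
  refine (hP.law_counts_le (Q := fun s => b < s.2)
    (F := fun s => ENNReal.ofReal (z ^ (-b)) * ENNReal.ofReal (z ^ s.2)) fun s hs => ?_).trans ?_
  · rw [← ENNReal.ofReal_mul (by positivity), ENNReal.one_le_ofReal, ← rpow_natCast,
      ← rpow_add hz0]
    exact one_le_rpow hz1 (by linarith)
  · rw [expect_const_mul, expect_sampleCounts]
    simp_rw [pow_add z, ENNReal.ofReal_mul (pow_nonneg hz0.le _), expect_const_mul]
    have hin : ∀ x : (Fin (numAnnuli P) → ℕ) × ℕ,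
        expect (sampleAll (numAnnuli P) fun i =>
          multinomialVariate P.q (numCells P i) (fun _ => 1) (x.1 i))
          (fun y => ENNReal.ofReal (z ^ y.2)) = 2 ^ ∑ i, numCells P i := fun x =>
      expect_trials_sampleAll _ _ hz0.le _ fun i =>
        expect_trials_multinomialVariate hP.q_ne _ _ _
    simp_rw [hin]
    rw [expect_mul_const, expect_trials_multinomialVariate hP.q_ne, ← pow_add, mul_comm,
      ENNReal.ofReal_mul (by positivity), ENNReal.ofReal_pow zero_le_two]
    simp

end Concentration

end RHG

namespace RHG

open Real MeasureTheory ProbabilityTheory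

/-! ## Hyperbolic geometry -/

/-- The hyperbolic cosine of the distance of two points with radii `r`, `b` and angular
difference `φ`. -/
noncomputable def coshDist (r b φ : ℝ) : ℝ := cosh r * cosh b - sinh r * sinh b * cos φ

lemma coshDist_comm (r b φ : ℝ) : coshDist r b φ = coshDist b r φ := by
  unfold coshDist
  ring

lemma sinh_add_sinh_le {x y : ℝ} (hx : 0 ≤ x) (hy : 0 ≤ y) : sinh x + sinh y ≤ sinh (x + y) := by
  rw [sinh_add]
  nlinarith [one_le_cosh x, one_le_cosh y, sinh_nonneg_iff.2 hx, sinh_nonneg_iff.2 hy]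

/-- As a function of the radius, `coshDist` is a combination of cosh and sinh; this interpolates it
between radius 0, where it is cosh b, and radius r'. -/
lemma sinh_mul_coshDist (r r' b φ : ℝ) :
    sinh r' * coshDist r b φ = sinh (r' - r) * cosh b + sinh r * coshDist r' b φ := by
  unfold coshDist
  rw [sinh_sub]
  ring

/-- A hyperbolic disc that contains the origin and a point contains the segment between them. The
interpolation weights sinh(r' - r) and sinh r sum to at most sinh r'. -/
lemma coshDist_le {r r' b φ c : ℝ} (h0 : 0 ≤ r) (h1 : r < r') (hb : cosh b ≤ c)
    (h : coshDist r' b φ ≤ c) : coshDist r b φ ≤ c := by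
  have hs : 0 < sinh r' := sinh_pos_iff.2 (h0.trans_lt h1)
  have h2 : 0 ≤ sinh (r' - r) := sinh_nonneg_iff.2 (sub_nonneg.2 h1.le)
  have h3 : 0 ≤ sinh r := sinh_nonneg_iff.2 h0
  have h4 := sinh_add_sinh_le (sub_nonneg.2 h1.le) h0
  rw [sub_add_cancel] at h4
  have hc : 0 ≤ c := (cosh_pos b).le.trans hb
  refine le_of_mul_le_mul_left ?_ hs
  rw [sinh_mul_coshDist]
  nlinarith

lemma coshDist_lt {r r' b φ c : ℝ} (h0 : 0 ≤ r) (h1 : r < r') (hb : cosh b < c)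
    (h : coshDist r' b φ ≤ c) : coshDist r b φ < c := by
  have hs : 0 < sinh r' := sinh_pos_iff.2 (h0.trans_lt h1)
  have h2 : 0 < sinh (r' - r) := sinh_pos_iff.2 (sub_pos.2 h1)
  have h3 : 0 ≤ sinh r := sinh_nonneg_iff.2 h0
  have h4 := sinh_add_sinh_le (sub_nonneg.2 h1.le) h0
  rw [sub_add_cancel] at h4
  have hc : 0 ≤ c := (cosh_pos b).le.trans hb.le
  refine lt_of_mul_lt_mul_left ?_ hs.le
  rw [sinh_mul_coshDist]
  nlinarith

lemma coshDist_le_add {r b φ : ℝ} (hr : 0 ≤ r) (hb : 0 ≤ b) :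
    coshDist r b φ ≤ cosh (r - b) + sinh r * sinh b * (φ ^ 2 / 2) := by
  have h := one_sub_sq_div_two_le_cos (x := φ)
  have hs := mul_nonneg (sinh_nonneg_iff.2 hr) (sinh_nonneg_iff.2 hb)
  rw [cosh_sub]
  unfold coshDist
  nlinarith

lemma one_le_coshDist {r b φ : ℝ} (hr : 0 ≤ r) (hb : 0 ≤ b) : 1 ≤ coshDist r b φ := by
  have h := cos_le_one φ
  have hs := mul_nonneg (sinh_nonneg_iff.2 hr) (sinh_nonneg_iff.2 hb)
  have h1 := one_le_cosh (r - b)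
  rw [cosh_sub] at h1
  unfold coshDist
  nlinarith

lemma hypDist_lt {x y : ℝ × ℝ} {R φ : ℝ} (hx : 0 ≤ x.1) (hy : 0 ≤ y.1) (hR : 0 ≤ R)
    (hφ : cos (x.2 - y.2) = cos φ) (h : coshDist x.1 y.1 φ < cosh R) : hypDist x y < R := by
  have h1 := one_le_coshDist (φ := φ) hx hy
  unfold hypDist
  rw [hφ]
  rw [← arcosh_cosh hR]
  exact (arcosh_lt_arcosh (by unfold coshDist at h1; linarith) (cosh_pos R)).2 h

lemma cosh_le_exp {x : ℝ} (hx : 0 ≤ x) : cosh x ≤ exp x := by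
  rw [cosh_eq]
  have : exp (-x) ≤ exp x := exp_le_exp.2 (by linarith)
  linarith

lemma sinh_le_exp_div (x : ℝ) : sinh x ≤ exp x / 2 := by
  rw [sinh_eq]
  have := exp_pos (-x)
  linarith

lemma mul_exp_le_sinh {x y : ℝ} (h : y ≤ x) : (1 - exp (-(2 * y))) / 2 * exp x ≤ sinh x := by
  rw [sinh_eq]
  have h1 : exp (-x) ≤ exp (-(2 * y)) * exp x := by
    rw [← exp_add]
    exact exp_le_exp.2 (by linarith)
  linarith

/-! ### Constants of the angular estimates -/

section Constants

/-- A lower bound for the width of the annuli. -/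
noncomputable def minWidth (α : ℝ) : ℝ := log 2 / α

/-- The constant in the upper bound for the angular deviation. -/
noncomputable def outerConst (α : ℝ) : ℝ := π / ((1 - exp (-(2 * minWidth α))) / 2)

/-- The constant in the lower bound for the angular deviation. -/
noncomputable def innerConst (α : ℝ) : ℝ := √(1 - (cosh (minWidth α))⁻¹) / 8

lemma minWidth_pos {α : ℝ} (hα : 0 < α) : 0 < minWidth α := div_pos (log_pos one_lt_two) hα

lemma outerConst_denom_pos {α : ℝ} (hα : 0 < α) : 0 < (1 - exp (-(2 * minWidth α))) / 2 := by
  have h := minWidth_pos hα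
  have : exp (-(2 * minWidth α)) < 1 := exp_lt_one_iff.2 (by linarith)
  linarith

lemma pi_le_outerConst {α : ℝ} (hα : 0 < α) : π ≤ outerConst α := by
  have h := outerConst_denom_pos hα
  have h2 := exp_pos (-(2 * minWidth α))
  unfold outerConst
  rw [le_div_iff₀ h]
  nlinarith [pi_pos]

lemma innerConst_arg_pos {α : ℝ} (hα : 0 < α) : 0 < 1 - (cosh (minWidth α))⁻¹ :=
  sub_pos.2 (inv_lt_one_of_one_lt₀ (one_lt_cosh.2 (minWidth_pos hα).ne'))

lemma innerConst_pos {α : ℝ} (hα : 0 < α) : 0 < innerConst α :=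
  div_pos (sqrt_pos.2 (innerConst_arg_pos hα)) (by norm_num)

lemma innerConst_le_one {α : ℝ} : innerConst α ≤ 1 := by
  unfold innerConst
  have : √(1 - (cosh (minWidth α))⁻¹) ≤ 1 := by
    rw [Real.sqrt_le_one]
    have := inv_nonneg.2 (cosh_pos (minWidth α)).le
    linarith
  linarith

lemma innerConst_sq {α : ℝ} (hα : 0 < α) :
    innerConst α ^ 2 = (1 - (cosh (minWidth α))⁻¹) / 64 := by
  unfold innerConst
  rw [div_pow, sq_sqrt (innerConst_arg_pos hα).le]
  norm_num

end Constants

/-! ### The angular scale of a pair of annuli -/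

section Annuli

variable {P : Params}

/-- The order of magnitude of the angular deviation between annuli `i` and `j`. -/
noncomputable def angleScale (i j : Fin (numAnnuli P)) : ℝ :=
  min 1 (exp ((P.R - radialBound P i - radialBound P j) / 2))

lemma angleScale_pos (i j : Fin (numAnnuli P)) : 0 < angleScale i j :=
  lt_min one_pos (exp_pos _)

lemma angleScale_le_one (i j : Fin (numAnnuli P)) : angleScale i j ≤ 1 := min_le_left _ _

variable (hP : P.Valid)
include hP

lemma Params.Valid.minWidth_le : minWidth P.α ≤ radialWidth P := by
  unfold minWidth
  rw [div_le_iff₀ hP.α_pos, mul_comm]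
  exact hP.log_two_le_mul_radialWidth

lemma Params.Valid.exp_two_mul_radialWidth_le : exp (2 * radialWidth P) ≤ 256 := by
  have h : radialWidth P ≤ 4 * log 2 := by
    have h1 := hP.mul_radialWidth_lt
    have h2 := hP.half_le
    have h3 := hP.radialWidth_pos
    nlinarith
  calc exp (2 * radialWidth P) ≤ exp ((8 : ℕ) * log 2) := exp_le_exp.2 (by push_cast; linarith)
    _ = 256 := by rw [exp_nat_mul, exp_log two_pos]; norm_num

lemma Params.Valid.radialWidth_le_radialBound {i : ℕ} (hi : 0 < i) :
    radialWidth P ≤ radialBound P i := by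
  have h := hP.radialBound_mono hi
  rwa [radialBound_eq, Nat.cast_one, one_mul] at h

lemma Params.Valid.radialBound_add_le {i : ℕ} (hi : i < numAnnuli P) :
    radialBound P i + radialWidth P ≤ P.R := by
  rw [← radialBound_succ]
  exact hP.radialBound_le hi

/-- If the scale is 1, π is good enough. Otherwise 1 - cos δ is at most a constant times exp(R - r -
ℓ_j), and 1 - cos δ ≥ 2δ²/π². Replacing sinh by a multiple of exp requires both radii to be at least
`minWidth`, which holds because r + ℓ_j ≥ R. -/
lemma Params.Valid.angularDeviation_le {i j : Fin (numAnnuli P)} {r : ℝ}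
    (hr1 : radialBound P i ≤ r) (hr2 : r < radialBound P (i + 1)) :
    angularDeviation P.R r (radialBound P j) ≤ outerConst P.α * angleScale i j := by
  have hA := pi_le_outerConst hP.α_pos
  have hA0 : 0 < outerConst P.α := pi_pos.trans_le hA
  have hπ : angularDeviation P.R r (radialBound P j) ≤ π := by
    unfold angularDeviation
    split_ifs
    exacts [le_rfl, arccos_le_pi _]
  unfold angleScale
  rcases le_total 1 (exp ((P.R - radialBound P i - radialBound P j) / 2)) with h1 | h1
  · rw [min_eq_left h1, mul_one]
    exact hπ.trans hA
  rw [min_eq_right h1]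
  rw [exp_le_one_iff] at h1
  have hsum : ¬ r + radialBound P j < P.R := by linarith
  unfold angularDeviation
  rw [if_neg hsum]
  set b := radialBound P j with hb
  have hrR : r < P.R := hr2.trans_le (hP.radialBound_le i.2)
  have hbh := hP.radialBound_add_le j.2
  have hj : 0 < (j : ℕ) := by
    by_contra h
    have : b = 0 := by
      rw [hb, Nat.eq_zero_of_not_pos h]
      simp [radialBound]
    linarith
  have hmw := hP.minWidth_le
  have hb1 : minWidth P.α ≤ b := hmw.trans (hP.radialWidth_le_radialBound hj)
  have hr3 : minWidth P.α ≤ r := by linarith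
  have hm0 := minWidth_pos hP.α_pos
  have hsr : 0 < sinh r := sinh_pos_iff.2 (hm0.trans_le hr3)
  have hsb : 0 < sinh b := sinh_pos_iff.2 (hm0.trans_le hb1)
  set c := (1 - exp (-(2 * minWidth P.α))) / 2 with hc
  have hc0 : 0 < c := outerConst_denom_pos hP.α_pos
  set x := (cosh r * cosh b - cosh P.R) / (sinh r * sinh b) with hx
  rcases le_total 1 x with hx1 | hx1
  · rw [arccos_of_one_le hx1]
    positivity
  have hxm : -1 ≤ x := by
    rw [hx, le_div_iff₀ (mul_pos hsr hsb)]
    have h2 : cosh P.R ≤ cosh (r + b) := by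
      rw [cosh_le_cosh, abs_of_pos hP.R_pos, abs_of_nonneg (by linarith)]
      linarith
    rw [cosh_add] at h2
    linarith
  have hcos := cos_le_one_sub_mul_cos_sq (x := arccos x)
    (by rw [abs_of_nonneg (arccos_nonneg x)]; exact arccos_le_pi x)
  rw [cos_arccos hxm hx1] at hcos
  have h3 : 1 - x ≤ exp P.R / (c * exp r * (c * exp b)) := by
    have h4 : 1 - x = (cosh P.R - cosh (r - b)) / (sinh r * sinh b) := by
      rw [hx, cosh_sub]
      field_simp
      ring
    rw [h4]
    have h5 := one_le_cosh (r - b)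
    have h6 := cosh_le_exp hP.R_pos.le
    have h7 := mul_exp_le_sinh hr3
    have h8 := mul_exp_le_sinh hb1
    gcongr
    linarith
  have h9 : exp P.R / (c * exp r * (c * exp b)) ≤
      (exp ((P.R - radialBound P i - b) / 2) / c) ^ 2 := by
    rw [div_pow, ← exp_nat_mul, div_le_div_iff₀ (by positivity) (by positivity)]
    have : exp P.R ≤ exp ((2 : ℕ) * ((P.R - radialBound P i - b) / 2)) * (exp r * exp b) := by
      rw [← exp_add, ← exp_add]
      exact exp_le_exp.2 (by push_cast; linarith)
    calc exp P.R * c ^ 2 ≤ _ * c ^ 2 := mul_le_mul_of_nonneg_right this (by positivity)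
      _ = _ := by ring
  have h10 : arccos x ^ 2 ≤ (outerConst P.α * exp ((P.R - radialBound P i - b) / 2)) ^ 2 := by
    have h11 : outerConst P.α * exp ((P.R - radialBound P i - b) / 2) =
        π * (exp ((P.R - radialBound P i - b) / 2) / c) := by
      unfold outerConst
      rw [← hc]
      ring
    rw [h11, mul_pow]
    have h12 : 2 / π ^ 2 * arccos x ^ 2 ≤ (exp ((P.R - radialBound P i - b) / 2) / c) ^ 2 := by
      linarith
    have h13 := pi_pos
    calc arccos x ^ 2 = π ^ 2 * (2 / π ^ 2 * arccos x ^ 2) / 2 := by field_simp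
      _ ≤ π ^ 2 * (2 / π ^ 2 * arccos x ^ 2) := half_le_self (by positivity)
      _ ≤ _ := by gcongr
  exact le_of_sq_le_sq h10 (by positivity)

/-- By star-shapedness of discs around a center within distance R of the origin, it suffices to
treat the outer radii of both annuli. These lie in [`minWidth`, R], so their difference costs at
most cosh R / cosh(`minWidth`); `innerConst` is chosen so that the angular term fits into the
remainder of cosh R. -/
lemma Params.Valid.hypDist_lt_of_angle {i j : Fin (numAnnuli P)} {x y : ℝ × ℝ} {φ : ℝ}
    (hx : x.1 ∈ Set.Ico (radialBound P i) (radialBound P (i + 1)))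
    (hy : y.1 ∈ Set.Ico (radialBound P j) (radialBound P (j + 1)))
    (hφ : cos (x.2 - y.2) = cos φ) (h : |φ| ≤ innerConst P.α * angleScale i j) :
    hypDist x y < P.R := by
  have hx0 := (hP.radialBound_nonneg i).trans hx.1
  have hy0 := (hP.radialBound_nonneg j).trans hy.1
  refine hypDist_lt hx0 hy0 hP.R_pos.le hφ ?_
  set r := radialBound P (i + 1) with hr
  set b := radialBound P (j + 1) with hb
  have hrR : r ≤ P.R := hP.radialBound_le i.2
  have hbR : b ≤ P.R := hP.radialBound_le j.2
  have hmw := hP.minWidth_le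
  have hm0 := minWidth_pos hP.α_pos
  have hr1 : minWidth P.α ≤ r := hmw.trans (hP.radialWidth_le_radialBound (Nat.succ_pos _))
  have hb1 : minWidth P.α ≤ b := hmw.trans (hP.radialWidth_le_radialBound (Nat.succ_pos _))
  have hR0 := hP.R_pos
  have hyR : cosh y.1 < cosh P.R := by
    rw [cosh_lt_cosh, abs_of_nonneg hy0, abs_of_pos hR0]
    exact hy.2.trans_le hbR
  refine coshDist_lt hx0 hx.2 hyR ?_
  rw [coshDist_comm]
  refine coshDist_le hy0 hy.2 ?_ ?_
  · rw [cosh_le_cosh, abs_of_nonneg (hm0.le.trans hr1), abs_of_pos hR0]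
    exact hrR
  rw [coshDist_comm]
  refine (coshDist_le_add (hm0.le.trans hr1) (hm0.le.trans hb1)).trans ?_
  have hdiff : cosh (r - b) ≤ cosh P.R * (cosh (minWidth P.α))⁻¹ := by
    rw [← div_eq_mul_inv, le_div_iff₀ (cosh_pos _)]
    have h1 : cosh (r - b) ≤ cosh (P.R - minWidth P.α) := by
      rw [cosh_le_cosh, abs_of_nonneg (a := P.R - minWidth P.α) (by linarith), abs_le]
      constructor <;> linarith
    have h2 := cosh_add (P.R - minWidth P.α) (minWidth P.α)
    rw [sub_add_cancel] at h2
    have h3 : 0 ≤ sinh (P.R - minWidth P.α) * sinh (minWidth P.α) :=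
      mul_nonneg (sinh_nonneg_iff.2 (by linarith)) (sinh_nonneg_iff.2 hm0.le)
    calc cosh (r - b) * cosh (minWidth P.α) ≤ cosh (P.R - minWidth P.α) * cosh (minWidth P.α) :=
          mul_le_mul_of_nonneg_right h1 (cosh_pos _).le
      _ ≤ cosh P.R := by linarith
  have hφ2 : φ ^ 2 ≤ innerConst P.α ^ 2 * exp (P.R - radialBound P i - radialBound P j) := by
    have h1 : |φ| ≤ innerConst P.α * exp ((P.R - radialBound P i - radialBound P j) / 2) :=
      h.trans (mul_le_mul_of_nonneg_left (min_le_right _ _) (innerConst_pos hP.α_pos).le)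
    have h2 := pow_le_pow_left₀ (abs_nonneg φ) h1 2
    rw [sq_abs, mul_pow, ← exp_nat_mul] at h2
    refine h2.trans_eq ?_
    congr 2
    push_cast
    ring
  have hsinh : sinh r * sinh b ≤ exp r / 2 * (exp b / 2) :=
    mul_le_mul (sinh_le_exp_div r) (sinh_le_exp_div b) (sinh_nonneg_iff.2 (hm0.le.trans hb1))
      (by positivity)
  -- The outer radii exceed the inner ones by a width below 4 ln 2 each, because α ≥ 1/2; this is
  -- the factor 256.
  have hexp : exp r * exp b * exp (P.R - radialBound P i - radialBound P j) ≤ 256 * exp P.R := by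
    have h1 : exp r * exp b * exp (P.R - radialBound P i - radialBound P j) =
        exp (2 * radialWidth P) * exp P.R := by
      rw [← exp_add, ← exp_add, ← exp_add, hr, hb, radialBound_succ, radialBound_succ]
      congr 1
      ring
    rw [h1]
    exact mul_le_mul_of_nonneg_right hP.exp_two_mul_radialWidth_le (exp_pos _).le
  have hcR : exp P.R / 2 ≤ cosh P.R := by
    rw [cosh_eq]
    have := exp_pos (-P.R)
    linarith
  have ha := innerConst_arg_pos hP.α_pos
  have hmain : sinh r * sinh b * (φ ^ 2 / 2) ≤
      cosh P.R * (1 - (cosh (minWidth P.α))⁻¹) := by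
    calc sinh r * sinh b * (φ ^ 2 / 2)
        ≤ exp r / 2 * (exp b / 2) *
          (innerConst P.α ^ 2 * exp (P.R - radialBound P i - radialBound P j) / 2) := by gcongr
      _ = innerConst P.α ^ 2 / 8 *
          (exp r * exp b * exp (P.R - radialBound P i - radialBound P j)) := by ring
      _ ≤ innerConst P.α ^ 2 / 8 * (256 * exp P.R) := by gcongr
      _ = exp P.R / 2 * (1 - (cosh (minWidth P.α))⁻¹) := by
          rw [innerConst_sq hP.α_pos]; ring
      _ ≤ _ := by gcongr
  linarith

end Annuli

end RHG

/-! ## Step counts -/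

namespace Timed

lemma steps_pure {β : Type} (b : β) : (pure b : Timed β).steps = 0 := rfl

lemma steps_bind {β δ : Type} (x : Timed β) (f : β → Timed δ) :
    (x >>= f).steps = x.steps + (f x.val).steps := rfl

lemma steps_tick : tick.steps = 1 := rfl

lemma steps_collect {ι β : Type} (body : ι → Timed (List β)) (l : List ι) :
    (collect body l).steps = (l.map fun a => 1 + (body a).steps).sum := by
  induction l with
  | nil => rfl
  | cons a l ih =>
    rw [collect]
    simp only [steps_bind, steps_pure, steps_tick, ih, List.map_cons, List.sum_cons]
    omega

lemma steps_collect_finRange {β : Type} {k : ℕ} (body : Fin k → Timed (List β)) :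
    (collect body (List.finRange k)).steps = ∑ i, (1 + (body i).steps) := by
  rw [steps_collect, Fin.sum_univ_def]

/-- Only tests before `b` can succeed; the leading 1 pays for the failing test. -/
lemma steps_walk_le {β : Type} (inside : ℕ → Prop) (visit : ℕ → Timed (List β)) (b : ℕ)
    (fuel t : ℕ) (h : ∀ u, t ≤ u → u < t + fuel → inside u → u < b) :
    (walk inside visit fuel t).steps ≤ 1 + ∑ u ∈ Finset.Ico t b, (1 + (visit u).steps) := by
  induction fuel generalizing t with
  | zero => rw [walk, steps_pure]; omega
  | succ fuel ih =>
    rw [walk]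
    by_cases ht : inside t
    · have hb := h t le_rfl (by omega) ht
      have := ih (t + 1) fun u hu1 hu2 => h u (by omega) (by omega)
      rw [Finset.sum_eq_sum_Ico_succ_bot hb]
      simp only [steps_bind, steps_tick, if_pos ht, steps_pure]
      omega
    · simp only [steps_bind, steps_tick, if_neg ht, steps_pure]
      omega

end Timed

namespace RHG

open Real MeasureTheory ProbabilityTheory

/-! ### The cost of a query in terms of loads of blocks -/

section Steps

variable {P : Params}

/-- The number of vertices in the `s`-th cell of annulus `j`, with `s` taken cyclically. -/
noncomputable def cellLoad (N : Counts P) (j : Fin (numAnnuli P)) (s : ℕ) : ℕ :=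
  N j ⟨s % numCells P j, Nat.mod_lt _ (numCells_pos j)⟩

/-- The number of vertices in `τ` consecutive cells of annulus `j`, beginning with the `s`-th. -/
noncomputable def windowLoad (N : Counts P) (j : Fin (numAnnuli P)) (τ s : ℕ) : ℕ :=
  ∑ t ∈ Finset.range τ, cellLoad N j (s + t)

lemma cellLoad_add_numCells (N : Counts P) (j : Fin (numAnnuli P)) (s : ℕ) :
    cellLoad N j (s + numCells P j) = cellLoad N j s := by
  unfold cellLoad
  simp

/-- A bound for the number of cells of annulus `j` that a vertex of annulus `i` visits in each
direction. -/
noncomputable def walkBound (i j : Fin (numAnnuli P)) : ℕ :=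
  min (numCells P j - 1) ⌊outerConst P.α * angleScale i j / cellWidth P j + 1⌋₊

/-- The cells of annulus `j` are narrow compared to the angular deviation from annulus `i`. -/
def Narrow (i j : Fin (numAnnuli P)) : Prop :=
  cellWidth P j ≤ innerConst P.α * angleScale i j

/-- The number of consecutive cells of annulus `j` that certainly contain only neighbors of a vertex
of annulus `i`, but at least one. -/
noncomputable def blockLen (i j : Fin (numAnnuli P)) : ℕ :=
  max 1 ⌊innerConst P.α * angleScale i j / cellWidth P j⌋₊

/-- The number of blocks that cover all visited cells. -/
noncomputable def numBlocks (α : ℝ) : ℕ := ⌈4 * (outerConst α / innerConst α) + 3⌉₊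

lemma steps_scanCell (ω : Outcome P) (v : Vertex ω.1.1) (c : Cell P) :
    (scanCell ω v c).steps = ω.1.1 c.1 c.2 := by
  unfold scanCell
  rw [Timed.steps_collect_finRange]
  simp [Timed.steps_pure]

lemma steps_scanCell_cyclicCell (ω : Outcome P) (v : Vertex ω.1.1) (j : Fin (numAnnuli P)) (s : ℕ) :
    (scanCell ω v (cyclicCell j s)).steps = cellLoad ω.1.1 j s := steps_scanCell ω v _

lemma steps_query (ω : Outcome P) (v : Vertex ω.1.1) :
    (query ω v).steps = ∑ j with v.1.1 ≤ j, (1 + (queryAnnulus ω v j).steps) := by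
  unfold query
  rw [Timed.steps_collect, ← List.sum_toFinset _ ((List.nodup_finRange _).filter _)]
  refine Finset.sum_congr ?_ fun _ _ => rfl
  ext j
  simp

lemma steps_queryAll (ω : Outcome P) :
    (queryAll ω).steps = numAnnuli P + ∑ i, numCells P i + Fintype.card (Vertex ω.1.1) +
      ∑ v, (query ω v).steps := by
  have hcard : Fintype.card (Vertex ω.1.1) = ∑ i, ∑ j, ω.1.1 i j := by
    rw [Fintype.card_sigma, Fintype.sum_sigma]
    simp
  unfold queryAll
  rw [Timed.steps_collect_finRange, hcard, Fintype.sum_sigma, Fintype.sum_sigma]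
  simp_rw [Timed.steps_collect_finRange, Finset.sum_add_distrib]
  simp only [Finset.sum_const, Finset.card_univ, Fintype.card_fin, smul_eq_mul, mul_one]
  ring

lemma sum_range_mul_block (f : ℕ → ℕ) (τ K : ℕ) :
    ∑ t ∈ Finset.range (K * τ), f t =
      ∑ l ∈ Finset.range K, ∑ t ∈ Finset.range τ, f (l * τ + t) := by
  induction K with
  | zero => simp
  | succ K ih => rw [Finset.sum_range_succ, ← ih, add_mul, one_mul, Finset.sum_range_add]

lemma one_le_blockLen (i j : Fin (numAnnuli P)) : 1 ≤ blockLen i j := le_max_left _ _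

lemma blockLen_of_not_narrow {i j : Fin (numAnnuli P)} (h : ¬ Narrow i j) : blockLen i j = 1 := by
  refine max_eq_left ?_
  rw [Narrow, not_le] at h
  exact Nat.floor_le_of_le (by simpa using ((div_lt_one (cellWidth_pos j)).2 h).le)

lemma walkBound_lt (i j : Fin (numAnnuli P)) : walkBound i j < numCells P j := by
  have := numCells_pos j
  have : walkBound i j ≤ numCells P j - 1 := min_le_left _ _
  omega

variable (hP : P.Valid)
include hP

omit hP in
lemma blockLen_mul_cellWidth_le {i j : Fin (numAnnuli P)} (h : Narrow i j) :
    blockLen i j * cellWidth P j ≤ innerConst P.α * angleScale i j := by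
  have hw := cellWidth_pos j
  have h1 : (1 : ℝ) ≤ innerConst P.α * angleScale i j / cellWidth P j := (one_le_div hw).2 h
  have h2 : blockLen i j = ⌊innerConst P.α * angleScale i j / cellWidth P j⌋₊ :=
    max_eq_right (Nat.le_floor (by exact_mod_cast h1))
  rw [h2, ← le_div_iff₀ hw]
  exact Nat.floor_le (zero_le_one.trans h1)

omit hP in
lemma blockLen_le_numCells (i j : Fin (numAnnuli P)) : blockLen i j ≤ numCells P j := by
  by_cases h : Narrow i j
  · have h1 := blockLen_mul_cellWidth_le h
    have h2 : innerConst P.α * angleScale i j ≤ 1 :=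
      mul_le_one₀ innerConst_le_one (angleScale_pos i j).le (angleScale_le_one i j)
    have h3 := numCells_mul_cellWidth j
    have h4 := pi_gt_three
    have hw := cellWidth_pos j
    have : (blockLen i j : ℝ) ≤ numCells P j := by
      refine le_of_mul_le_mul_right ?_ hw
      linarith
    exact_mod_cast this
  · rw [blockLen_of_not_narrow h]
    exact numCells_pos j

/-- Search range and block length have the same scale, so their ratio is bounded by `outerConst` /
`innerConst`. Since a block has at least one cell, rounding down loses at most a factor 2. -/
lemma Params.Valid.two_mul_walkBound_add_one_le (i j : Fin (numAnnuli P)) :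
    2 * walkBound i j + 1 ≤ numBlocks P.α * blockLen i j := by
  have hw := cellWidth_pos j
  have ha := innerConst_pos hP.α_pos
  have hA : 0 < outerConst P.α := pi_pos.trans_le (pi_le_outerConst hP.α_pos)
  have hD := angleScale_pos i j
  have h1 : (walkBound i j : ℝ) ≤ outerConst P.α * angleScale i j / cellWidth P j + 1 := by
    refine le_trans ?_ (Nat.floor_le (by positivity))
    exact_mod_cast min_le_right _ _
  have h2 : innerConst P.α * angleScale i j / cellWidth P j ≤ 2 * blockLen i j := by
    have h3 := (Nat.lt_floor_add_one (innerConst P.α * angleScale i j / cellWidth P j)).le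
    have h4 : (⌊innerConst P.α * angleScale i j / cellWidth P j⌋₊ : ℝ) ≤ blockLen i j := by
      exact_mod_cast le_max_right _ _
    have h5 : (1 : ℝ) ≤ blockLen i j := by exact_mod_cast one_le_blockLen i j
    linarith
  have h5 : (1 : ℝ) ≤ blockLen i j := by exact_mod_cast one_le_blockLen i j
  have h6 : outerConst P.α * angleScale i j / cellWidth P j ≤
      outerConst P.α / innerConst P.α * (2 * blockLen i j) := by
    calc outerConst P.α * angleScale i j / cellWidth P j =
        outerConst P.α / innerConst P.α * (innerConst P.α * angleScale i j / cellWidth P j) := by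
          field_simp
      _ ≤ _ := by gcongr
  have h7 : 4 * (outerConst P.α / innerConst P.α) + 3 ≤ numBlocks P.α := Nat.le_ceil _
  have : ((2 * walkBound i j + 1 : ℕ) : ℝ) ≤ (numBlocks P.α * blockLen i j : ℕ) := by
    push_cast
    nlinarith
  exact_mod_cast this

/-- The visited cells lie among the s - T, …, s + T, where T is `walkBound`, and consecutive blocks
cover these. The first summand pays for tests and loop iterations, 2T + 2 in total. -/
lemma Params.Valid.steps_queryAnnulus_le {ω : Outcome P} (hω : InCells ω) (v : Vertex ω.1.1)
    (j : Fin (numAnnuli P)) :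
    (queryAnnulus ω v j).steps ≤ 2 * (numBlocks P.α * blockLen v.1.1 j) +
      ∑ l ∈ Finset.range (numBlocks P.α), windowLoad ω.1.1 j (blockLen v.1.1 j)
        (angularIndex j (ω.2 v) + (numCells P j - walkBound v.1.1 j + l * blockLen v.1.1 j)) := by
  have hw := cellWidth_pos j
  have hTM := walkBound_lt v.1.1 j
  set T := walkBound v.1.1 j with hT
  set M := numCells P j with hM
  set s := angularIndex j (ω.2 v) with hs
  set θ := (ω.2 v).2 with hθ
  have hθ0 : 0 ≤ θ := (mul_nonneg (Nat.cast_nonneg _) (cellWidth_pos _).le).trans (hω v).2.1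
  have hδ := hP.angularDeviation_le (j := j) (hω v).1.1 (hω v).1.2
  set δ := angularDeviation P.R (ω.2 v).1 (radialBound P j) with hδ'
  have hδw : δ / cellWidth P j ≤ outerConst P.α * angleScale v.1.1 j / cellWidth P j :=
    div_le_div_of_nonneg_right hδ hw.le
  have hs1 : (s : ℝ) * cellWidth P j ≤ θ := by
    rw [← le_div_iff₀ hw]
    exact Nat.floor_le (div_nonneg hθ0 hw.le)
  have hs2 : θ < ((s : ℝ) + 1) * cellWidth P j := by
    rw [← div_lt_iff₀ hw]
    exact Nat.lt_floor_add_one _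
  -- As θ lies in cell s, a successful test for the cell at distance u, in either direction, forces
  -- u - 1 ≤ δ/w.
  have hbound : ∀ u : ℕ, u < M → (u : ℝ) - 1 ≤ δ / cellWidth P j → u < T + 1 := by
    intro u hu1 hu2
    refine Nat.lt_succ_of_le (le_min (by omega) (Nat.le_floor ?_))
    linarith
  have hsteps : (queryAnnulus ω v j).steps ≤ cellLoad ω.1.1 j s +
      (1 + ∑ u ∈ Finset.Ico 1 (T + 1), (1 + cellLoad ω.1.1 j (s + u))) +
      (1 + ∑ u ∈ Finset.Ico 1 (T + 1), (1 + cellLoad ω.1.1 j (s + (M - u)))) := by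
    unfold queryAnnulus
    simp only [Timed.steps_bind, Timed.steps_pure, add_zero]
    rw [← add_assoc]
    refine add_le_add (add_le_add (steps_scanCell_cyclicCell _ _ _ _).le ?_) ?_
    · refine (Timed.steps_walk_le _ _ (T + 1) _ _ ?_).trans_eq ?_
      · intro u hu1 hu2 hu3
        refine hbound u (by omega) ?_
        rw [le_div_iff₀ hw]
        change ((s : ℝ) + u) * cellWidth P j ≤ θ + δ at hu3
        linarith
      · simp_rw [steps_scanCell_cyclicCell]
        rfl
    · refine (Timed.steps_walk_le _ _ (T + 1) _ _ ?_).trans_eq ?_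
      · intro u hu1 hu2 hu3
        refine hbound u (by omega) ?_
        rw [le_div_iff₀ hw]
        change θ - δ ≤ ((s : ℝ) - u + 1) * cellWidth P j at hu3
        linarith
      · simp_rw [steps_scanCell_cyclicCell]
        rfl
  -- The cells from s - T to s + T in cyclic order; M - T stands for -T to stay within the natural
  -- numbers.
  have hcover : cellLoad ω.1.1 j s + ∑ u ∈ Finset.Ico 1 (T + 1), cellLoad ω.1.1 j (s + u) +
      ∑ u ∈ Finset.Ico 1 (T + 1), cellLoad ω.1.1 j (s + (M - u)) =
      ∑ t ∈ Finset.range (2 * T + 1), cellLoad ω.1.1 j (s + (M - T + t)) := by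
    have h1 : 2 * T + 1 = T + (1 + T) := by ring
    rw [h1, Finset.sum_range_add, Finset.sum_range_add, Finset.sum_Ico_eq_sum_range,
      Finset.sum_Ico_eq_sum_range, add_comm]
    simp only [add_tsub_cancel_right, Finset.sum_range_one, add_zero]
    congr 1
    · rw [← Finset.sum_range_reflect]
      refine Finset.sum_congr rfl fun t ht => ?_
      have := Finset.mem_range.1 ht
      congr 2
      omega
    · congr 1
      · rw [← cellLoad_add_numCells]
        congr 1
        omega
      · refine Finset.sum_congr rfl fun t ht => ?_
        rw [← cellLoad_add_numCells]
        congr 1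
        omega
  have h2T := hP.two_mul_walkBound_add_one_le v.1.1 j
  have hblocks : ∑ t ∈ Finset.range (2 * T + 1), cellLoad ω.1.1 j (s + (M - T + t)) ≤
      ∑ l ∈ Finset.range (numBlocks P.α), windowLoad ω.1.1 j (blockLen v.1.1 j)
        (s + (M - T + l * blockLen v.1.1 j)) := by
    refine (Finset.sum_le_sum_of_subset (Finset.range_subset_range.2 h2T)).trans_eq ?_
    rw [sum_range_mul_block]
    refine Finset.sum_congr rfl fun l _ => Finset.sum_congr rfl fun t _ => ?_
    congr 1
    ring
  rw [← hcover] at hblocks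
  simp only [Finset.sum_add_distrib, Finset.sum_const, Nat.card_Ico, smul_eq_mul] at hsteps
  omega

end Steps

end RHG

namespace RHG

open Real MeasureTheory ProbabilityTheory

/-! ## Edges found in narrow cells -/

section Edges

variable {P : Params}

lemma cellLoad_eq_sum (N : Counts P) (j : Fin (numAnnuli P)) (s : ℕ) :
    cellLoad N j s = ∑ u : Vertex N, if u.1 = cyclicCell j s then 1 else 0 := by
  rw [Fintype.sum_sigma, Finset.sum_eq_single (cyclicCell j s)]
  · simp only [if_true, Finset.sum_const, smul_eq_mul, mul_one]
    exact (Finset.card_fin _).symm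
  · intro c _ hc
    simp [hc]
  · simp

lemma cyclicCell_injOn {j : Fin (numAnnuli P)} {s t t' : ℕ} (ht : t < numCells P j)
    (ht' : t' < numCells P j) (h : cyclicCell j (s + t) = cyclicCell j (s + t')) : t = t' := by
  unfold cyclicCell at h
  simp only [Sigma.mk.injEq, heq_eq_eq, true_and, Fin.mk.injEq] at h
  have h1 : s + t ≡ s + t' [MOD numCells P j] := h
  have h2 := Nat.ModEq.add_left_cancel' s h1
  exact Nat.ModEq.eq_of_lt_of_lt h2 ht ht'

variable (hP : P.Valid)
include hP

/-- After removing `d` full turns, the angles of a vertex in cell s and one in cell s + t differ by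
at most (t + 1) w, which is at most the block length and hence at most `innerConst` · Δ. -/
lemma Params.Valid.hypDist_lt_of_block {ω : Outcome P} (hω : InCells ω) {v u : Vertex ω.1.1}
    {t : ℕ} (hnar : Narrow v.1.1 u.1.1) (ht : t < blockLen v.1.1 u.1.1)
    (hu : u.1 = cyclicCell u.1.1 (angularIndex u.1.1 (ω.2 v) + t)) :
    hypDist (ω.2 v) (ω.2 u) < P.R := by
  set j := u.1.1 with hj
  set s := angularIndex j (ω.2 v) with hs
  have hw := cellWidth_pos j
  have hθ0 : 0 ≤ (ω.2 v).2 :=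
    (mul_nonneg (Nat.cast_nonneg _) (cellWidth_pos _).le).trans (hω v).2.1
  have hs1 : (s : ℝ) * cellWidth P j ≤ (ω.2 v).2 := by
    rw [← le_div_iff₀ hw]
    exact Nat.floor_le (div_nonneg hθ0 hw.le)
  have hs2 : (ω.2 v).2 < ((s : ℝ) + 1) * cellWidth P j := by
    rw [← div_lt_iff₀ hw]
    exact Nat.lt_floor_add_one _
  have hcell : (u.1.2 : ℕ) = (s + t) % numCells P j := by
    have h1 : ∀ c c' : Cell P, c = c' → (c.2 : ℕ) = c'.2 := fun c c' h => by rw [h]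
    exact h1 _ _ hu
  have hu1 := (hω u).2
  rw [hcell] at hu1
  set d := (s + t) / numCells P j with hd
  have hdiv : (((s + t) % numCells P j : ℕ) : ℝ) = s + t - numCells P j * d := by
    have := Nat.mod_add_div (s + t) (numCells P j)
    have h2 : (((s + t) % numCells P j + numCells P j * d : ℕ) : ℝ) = (s + t : ℕ) := by
      rw [this]
    push_cast at h2
    linarith
  rw [hdiv] at hu1
  have hM := numCells_mul_cellWidth j
  have hMd : (numCells P j : ℝ) * d * cellWidth P j = d * (2 * π) := by rw [← hM]; ring
  obtain ⟨hu1, hu2⟩ := hu1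
  refine hP.hypDist_lt_of_angle (φ := (ω.2 v).2 - (ω.2 u).2 - d * (2 * π)) (hω v).1 (hω u).1
    (cos_sub_nat_mul_two_pi _ _).symm ?_
  refine le_trans ?_ (blockLen_mul_cellWidth_le hnar)
  have ht1 : (t : ℝ) + 1 ≤ blockLen v.1.1 j := by exact_mod_cast ht
  have ht0 : (0 : ℝ) ≤ t := Nat.cast_nonneg _
  rw [← hMd, abs_le]
  constructor <;> nlinarith

open Classical in
-- No vertex u is counted twice: its annulus determines j, and its cell determines t because a block
-- does not wrap around the annulus.
lemma Params.Valid.sum_windowLoad_vertex_le {ω : Outcome P} (hω : InCells ω) (v : Vertex ω.1.1)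
    (J : Finset (Fin (numAnnuli P))) :
    ∑ j ∈ J with Narrow v.1.1 j,
      windowLoad ω.1.1 j (blockLen v.1.1 j) (angularIndex j (ω.2 v)) ≤
      ∑ u : Vertex ω.1.1, if (u = v ∨ (graph ω).Adj v u) ∧ u.1.1 ∈ J then 1 else 0 := by
  simp_rw [windowLoad, cellLoad_eq_sum]
  have hswap : ∑ j ∈ J with Narrow v.1.1 j, ∑ t ∈ Finset.range (blockLen v.1.1 j),
      ∑ u : Vertex ω.1.1, (if u.1 = cyclicCell j (angularIndex j (ω.2 v) + t) then 1 else 0) =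
      ∑ u : Vertex ω.1.1, ∑ j ∈ J with Narrow v.1.1 j, ∑ t ∈ Finset.range (blockLen v.1.1 j),
        (if u.1 = cyclicCell j (angularIndex j (ω.2 v) + t) then 1 else 0) := by
    rw [Finset.sum_comm]
    exact Finset.sum_congr rfl fun j _ => Finset.sum_comm
  rw [hswap]
  refine Finset.sum_le_sum fun u _ => ?_
  rw [Finset.sum_sigma', ← Finset.card_filter]
  by_cases hne : ∃ j, (j ∈ J ∧ Narrow v.1.1 j) ∧ ∃ t < blockLen v.1.1 j,
      u.1 = cyclicCell j (angularIndex j (ω.2 v) + t)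
  · have hgood : (u = v ∨ (graph ω).Adj v u) ∧ u.1.1 ∈ J := by
      obtain ⟨j, hj, t, ht, hu⟩ := hne
      have hju : j = u.1.1 := by rw [hu]; rfl
      subst hju
      refine ⟨?_, hj.1⟩
      by_cases huv : u = v
      · exact Or.inl huv
      · exact Or.inr ⟨Ne.symm huv, hP.hypDist_lt_of_block hω hj.2 ht hu⟩
    rw [if_pos hgood, Finset.card_le_one]
    rintro ⟨j, t⟩ h1 ⟨j', t'⟩ h2
    simp only [Finset.mem_filter, Finset.mem_sigma, Finset.mem_range] at h1 h2
    have hjj : j = j' := congrArg Sigma.fst (h1.2.symm.trans h2.2)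
    subst hjj
    have := cyclicCell_injOn (h1.1.2.trans_le (blockLen_le_numCells _ _))
      (h2.1.2.trans_le (blockLen_le_numCells _ _)) (h1.2.symm.trans h2.2)
    rw [this]
  · refine le_of_eq_of_le ?_ (Nat.zero_le _)
    rw [Finset.card_eq_zero, Finset.filter_eq_empty_iff]
    rintro ⟨j, t⟩ h1 hu
    simp only [Finset.mem_filter, Finset.mem_sigma, Finset.mem_range] at h1
    exact hne ⟨j, h1.1, t, h1.2, hu⟩

omit hP in
open Classical in
lemma sum_adj_eq (ω : Outcome P) :
    ∑ v, ∑ u, (if (graph ω).Adj v u then 1 else 0) = 2 * numEdges ω := by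
  have hedges : ∑ v, (graph ω).degree v = 2 * numEdges ω := by
    rw [SimpleGraph.sum_degrees_eq_twice_card_edges, numEdges, Set.ncard_eq_toFinset_card']
    rfl
  rw [← hedges]
  refine Finset.sum_congr rfl fun v _ => ?_
  rw [← Finset.card_filter, ← SimpleGraph.card_neighborFinset_eq_degree]
  congr 1
  ext u
  simp

open Classical in
lemma Params.Valid.sum_windowLoad_le {ω : Outcome P} (hω : InCells ω) :
    ∑ v : Vertex ω.1.1, ∑ j with Narrow v.1.1 j,
      windowLoad ω.1.1 j (blockLen v.1.1 j) (angularIndex j (ω.2 v)) ≤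
      Fintype.card (Vertex ω.1.1) + 2 * numEdges ω := by
  rw [← sum_adj_eq, ← Finset.card_univ, Finset.card_eq_sum_ones, ← Finset.sum_add_distrib]
  refine Finset.sum_le_sum fun v _ => (hP.sum_windowLoad_vertex_le hω v Finset.univ).trans ?_
  have h1 : ∑ u : Vertex ω.1.1, (if u = v then 1 else 0) = 1 := by simp
  rw [← h1, ← Finset.sum_add_distrib]
  refine Finset.sum_le_sum fun u _ => ?_
  split_ifs <;> simp_all

open Classical in
-- Between different annuli no vertex finds itself, so the term n disappears; only such a bound in m
-- alone can show n = O(m).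
lemma Params.Valid.sum_windowLoad_annulus_le {ω : Outcome P} (hω : InCells ω)
    {i j : Fin (numAnnuli P)} (hij : i ≠ j) (h : Narrow i j) :
    ∑ v : Vertex ω.1.1, (if v.1.1 = i then
      windowLoad ω.1.1 j (blockLen i j) (angularIndex j (ω.2 v)) else 0) ≤ 2 * numEdges ω := by
  rw [← sum_adj_eq]
  refine Finset.sum_le_sum fun v _ => ?_
  split_ifs with hv
  · have h1 := hP.sum_windowLoad_vertex_le hω v {j}
    rw [Finset.filter_singleton, if_pos (by rwa [hv]), Finset.sum_singleton, hv] at h1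
    refine h1.trans (Finset.sum_le_sum fun u _ => ?_)
    by_cases huv : u = v
    · have : u.1.1 ≠ j := by rw [huv, hv]; exact hij
      simp [this]
    · split_ifs <;> simp_all
  · exact Nat.zero_le _

end Edges

/-! ## Autocorrelation of the cell loads -/

section Autocorrelation

variable {P : Params}

lemma sum_range_add_of_periodic {M : ℕ} (f : ℕ → ℝ) (hf : ∀ s, f (s + M) = f s) (e : ℕ) :
    ∑ s ∈ Finset.range M, f (s + e) = ∑ s ∈ Finset.range M, f s := by
  induction e with
  | zero => simp
  | succ e ih =>
    rw [← ih]
    have h1 := Finset.sum_range_succ (fun s => f (s + e)) M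
    have h2 := Finset.sum_range_succ' (fun s => f (s + e)) M
    rw [h1] at h2
    have h3 : f (M + e) = f (0 + e) := by rw [zero_add, add_comm, hf]
    have h4 : ∀ s, f (s + 1 + e) = f (s + (e + 1)) := fun s => by congr 1; ring
    simp_rw [h4] at h2
    linarith

/-- The windows of a periodic function. -/
noncomputable def windowSum (f : ℕ → ℝ) (τ s : ℕ) : ℝ := ∑ t ∈ Finset.range τ, f (s + t)

lemma windowSum_periodic {M : ℕ} {f : ℕ → ℝ} (hf : ∀ s, f (s + M) = f s) (τ s : ℕ) :
    windowSum f τ (s + M) = windowSum f τ s := by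
  unfold windowSum
  refine Finset.sum_congr rfl fun t _ => ?_
  rw [show s + M + t = s + t + M by ring, hf]

lemma sum_windowSum {M : ℕ} {f : ℕ → ℝ} (hf : ∀ s, f (s + M) = f s) (τ : ℕ) :
    ∑ s ∈ Finset.range M, windowSum f τ s = τ * ∑ s ∈ Finset.range M, f s := by
  unfold windowSum
  rw [Finset.sum_comm]
  simp_rw [sum_range_add_of_periodic f hf]
  simp

lemma sum_mul_shift_le {M : ℕ} {f : ℕ → ℝ} (hf : ∀ s, f (s + M) = f s) (e : ℕ) :
    ∑ s ∈ Finset.range M, f s * f (s + e) ≤ ∑ s ∈ Finset.range M, f s ^ 2 := by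
  have h1 : ∑ s ∈ Finset.range M, f (s + e) ^ 2 = ∑ s ∈ Finset.range M, f s ^ 2 :=
    sum_range_add_of_periodic (fun s => f s ^ 2) (fun s => by rw [hf]) e
  have h2 : ∑ s ∈ Finset.range M, f s * f (s + e) ≤
      ∑ s ∈ Finset.range M, (f s ^ 2 + f (s + e) ^ 2) / 2 :=
    Finset.sum_le_sum fun s _ => by nlinarith [sq_nonneg (f s - f (s + e))]
  refine h2.trans_eq ?_
  rw [← Finset.sum_div, Finset.sum_add_distrib, h1]
  ring

/-- The mean square of the windows is controlled by the autocorrelation at short distances. -/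
lemma sum_windowSum_sq_le {M : ℕ} {f : ℕ → ℝ} (hf : ∀ s, f (s + M) = f s)
    (hf0 : ∀ s, 0 ≤ f s) (τ : ℕ) :
    ∑ s ∈ Finset.range M, windowSum f τ s ^ 2 ≤
      2 * τ * ∑ s ∈ Finset.range M, f s * windowSum f τ s := by
  have hpair : ∀ s, windowSum f τ s ^ 2 ≤
      2 * ∑ t ∈ Finset.range τ, f (s + t) * windowSum f τ (s + t) := by
    intro s
    have h1 : windowSum f τ s ^ 2 = ∑ t ∈ Finset.range τ, ∑ t' ∈ Finset.range τ,
        f (s + t) * f (s + t') := by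
      rw [sq, windowSum, Finset.sum_mul_sum]
    -- Charge each ordered pair of positions to the smaller one; the larger one then lies in the
    -- window that starts there.
    have h2 : ∑ t ∈ Finset.range τ, ∑ t' ∈ Finset.range τ, f (s + t) * f (s + t') ≤
        ∑ t ∈ Finset.range τ, ∑ t' ∈ Finset.range τ,
          ((if t ≤ t' then f (s + t) * f (s + t') else 0) +
            if t' ≤ t then f (s + t') * f (s + t) else 0) := by
      refine Finset.sum_le_sum fun t _ => Finset.sum_le_sum fun t' _ => ?_
      have h := mul_nonneg (hf0 (s + t)) (hf0 (s + t'))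
      rcases le_total t t' with h' | h'
      · rw [if_pos h']
        split_ifs <;> linarith
      · rw [if_pos h']
        split_ifs <;> linarith
    have h3 : ∑ t ∈ Finset.range τ, ∑ t' ∈ Finset.range τ,
          ((if t ≤ t' then f (s + t) * f (s + t') else 0) +
            if t' ≤ t then f (s + t') * f (s + t) else 0) =
        2 * ∑ t ∈ Finset.range τ, ∑ t' ∈ Finset.range τ,
          (if t ≤ t' then f (s + t) * f (s + t') else 0) := by
      simp_rw [Finset.sum_add_distrib]
      rw [Finset.sum_comm (f := fun t t' => if t' ≤ t then f (s + t') * f (s + t) else 0)]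
      ring
    rw [h1]
    refine h2.trans (h3.trans_le ?_)
    refine mul_le_mul_of_nonneg_left (Finset.sum_le_sum fun t ht => ?_) zero_le_two
    rw [windowSum, Finset.mul_sum, ← Finset.sum_filter]
    have h4 : ∀ t' ∈ (Finset.range τ).filter (t ≤ ·), f (s + t) * f (s + t') =
        f (s + t) * f (s + t + (t' - t)) := by
      intro t' ht'
      have := (Finset.mem_filter.1 ht').2
      congr 2
      omega
    rw [Finset.sum_congr rfl h4]
    rw [← Finset.sum_image (s := (Finset.range τ).filter (t ≤ ·)) (g := fun t' => t' - t)
      (f := fun x => f (s + t) * f (s + t + x))]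
    · refine Finset.sum_le_sum_of_subset_of_nonneg ?_ fun x _ _ => mul_nonneg (hf0 _) (hf0 _)
      intro x hx
      obtain ⟨t', ht', rfl⟩ := Finset.mem_image.1 hx
      have h5 := Finset.mem_filter.1 ht'
      have h6 := Finset.mem_range.1 h5.1
      exact Finset.mem_range.2 (by omega)
    · intro a ha b hb hab
      have h5 := (Finset.mem_filter.1 ha).2
      have h6 := (Finset.mem_filter.1 hb).2
      simp only at hab
      omega
  refine (Finset.sum_le_sum fun s _ => hpair s).trans_eq ?_
  rw [← Finset.mul_sum, Finset.sum_comm]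
  simp_rw [sum_range_add_of_periodic (fun s => f s * windowSum f τ s)
    (fun s => by rw [hf, windowSum_periodic hf])]
  simp
  ring

/-- The correlation with a far window is controlled by the autocorrelation at short distances. -/
lemma sum_mul_windowSum_shift_le {M : ℕ} {f : ℕ → ℝ} (hf : ∀ s, f (s + M) = f s)
    (hf0 : ∀ s, 0 ≤ f s) {τ : ℕ} (hτ : 0 < τ) (e : ℕ) :
    ∑ s ∈ Finset.range M, f s * windowSum f τ (s + e) ≤
      4 * ∑ s ∈ Finset.range M, f s * windowSum f τ s := by
  have hW := windowSum_periodic hf τ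
  have hW0 : ∀ s, 0 ≤ windowSum f τ s := fun s => Finset.sum_nonneg fun t _ => hf0 _
  have hτ' : (0 : ℝ) < τ := by exact_mod_cast hτ
  refine le_of_mul_le_mul_left ?_ hτ'
  have h1 : τ * ∑ s ∈ Finset.range M, f s * windowSum f τ (s + e) =
      ∑ s ∈ Finset.range M, ∑ t ∈ Finset.range τ, f (s + t) * windowSum f τ (s + t + e) := by
    rw [Finset.sum_comm]
    simp_rw [sum_range_add_of_periodic (fun s => f s * windowSum f τ (s + e))
      (fun s => by rw [hf, show s + M + e = s + e + M by ring, hW])]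
    simp
  -- Averaging over τ starting points, every shifted window lies in the union of two adjacent
  -- windows. This leaves two correlations of windows, each at most the sum of squares and so at
  -- most 2τ times the near correlation.
  have h2 : ∀ s, ∑ t ∈ Finset.range τ, f (s + t) * windowSum f τ (s + t + e) ≤
      windowSum f τ s * windowSum f τ (s + e) + windowSum f τ s * windowSum f τ (s + (e + τ)) := by
    intro s
    rw [← mul_add]
    have h3 : ∀ t ∈ Finset.range τ, windowSum f τ (s + t + e) ≤
        windowSum f τ (s + e) + windowSum f τ (s + (e + τ)) := by
      intro t ht
      have h4 : windowSum f τ (s + e) + windowSum f τ (s + (e + τ)) =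
          ∑ x ∈ Finset.range (τ + τ), f (s + e + x) := by
        rw [Finset.sum_range_add]
        unfold windowSum
        congr 1
        refine Finset.sum_congr rfl fun x _ => ?_
        congr 1
        ring
      have h5 : windowSum f τ (s + t + e) = ∑ x ∈ Finset.Ico t (t + τ), f (s + e + x) := by
        rw [Finset.sum_Ico_eq_sum_range, add_tsub_cancel_left]
        unfold windowSum
        refine Finset.sum_congr rfl fun x _ => ?_
        congr 1
        ring
      rw [h4, h5]
      refine Finset.sum_le_sum_of_subset_of_nonneg ?_ fun x _ _ => hf0 _
      intro x hx
      have h6 := Finset.mem_Ico.1 hx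
      have h7 := Finset.mem_range.1 ht
      exact Finset.mem_range.2 (by omega)
    calc ∑ t ∈ Finset.range τ, f (s + t) * windowSum f τ (s + t + e)
        ≤ ∑ t ∈ Finset.range τ,
          f (s + t) * (windowSum f τ (s + e) + windowSum f τ (s + (e + τ))) :=
          Finset.sum_le_sum fun t ht => mul_le_mul_of_nonneg_left (h3 t ht) (hf0 _)
      _ = _ := by rw [← Finset.sum_mul]; rfl
  rw [h1]
  have h8 := sum_mul_shift_le hW e
  have h9 := sum_mul_shift_le hW (e + τ)
  have h10 := sum_windowSum_sq_le hf hf0 τ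
  have h11 := Finset.sum_le_sum fun s (_ : s ∈ Finset.range M) => h2 s
  rw [Finset.sum_add_distrib] at h11
  linarith

/-- A lower bound for the autocorrelation at short distances. -/
lemma sq_sum_le_sum_mul_windowSum {M : ℕ} {f : ℕ → ℝ} (hf : ∀ s, f (s + M) = f s)
    (hf0 : ∀ s, 0 ≤ f s) {τ : ℕ} (hτ : 0 < τ) :
    τ * (∑ s ∈ Finset.range M, f s) ^ 2 ≤
      2 * M * ∑ s ∈ Finset.range M, f s * windowSum f τ s := by
  have hτ' : (0 : ℝ) < τ := by exact_mod_cast hτ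
  have h1 := sq_sum_le_card_mul_sum_sq (s := Finset.range M) (f := windowSum f τ)
  rw [sum_windowSum hf, Finset.card_range] at h1
  have h2 := mul_le_mul_of_nonneg_left (sum_windowSum_sq_le hf hf0 τ) (Nat.cast_nonneg (α := ℝ) M)
  refine le_of_mul_le_mul_left ?_ hτ'
  calc (τ : ℝ) * (τ * (∑ s ∈ Finset.range M, f s) ^ 2) =
      (τ * ∑ s ∈ Finset.range M, f s) ^ 2 := by ring
    _ ≤ _ := h1.trans h2
    _ = _ := by ring

end Autocorrelation

end RHG

namespace RHG

open Real MeasureTheory ProbabilityTheory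
open scoped ENNReal

/-! ## Typical outcomes -/

section Typical

variable {P : Params}

/-- The cell loads of annulus `j` as a periodic real function. -/
noncomputable def load (N : Counts P) (j : Fin (numAnnuli P)) (s : ℕ) : ℝ := cellLoad N j s

lemma load_periodic (N : Counts P) (j : Fin (numAnnuli P)) (s : ℕ) :
    load N j (s + numCells P j) = load N j s := by
  unfold load
  rw [cellLoad_add_numCells]

lemma load_nonneg (N : Counts P) (j : Fin (numAnnuli P)) (s : ℕ) : 0 ≤ load N j s :=
  Nat.cast_nonneg _

lemma load_fin (N : Counts P) (j : Fin (numAnnuli P)) (a : Fin (numCells P j)) :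
    load N j a = N j a := by
  unfold load cellLoad
  simp only [Nat.mod_eq_of_lt a.2]

lemma windowSum_load (N : Counts P) (j : Fin (numAnnuli P)) (τ s : ℕ) :
    windowSum (load N j) τ s = windowLoad N j τ s := by
  unfold windowSum windowLoad load
  push_cast
  rfl

lemma sum_load (N : Counts P) (j : Fin (numAnnuli P)) :
    ∑ s ∈ Finset.range (numCells P j), load N j s = annulusCount N j := by
  rw [← Fin.sum_univ_eq_sum_range (load N j)]
  unfold annulusCount
  push_cast
  exact Finset.sum_congr rfl fun a _ => load_fin N j a

lemma sum_load_sq (N : Counts P) (j : Fin (numAnnuli P)) :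
    ∑ s ∈ Finset.range (numCells P j), load N j s ^ 2 = ∑ a, (N j a : ℝ) ^ 2 := by
  rw [← Fin.sum_univ_eq_sum_range (fun s => load N j s ^ 2)]
  exact Finset.sum_congr rfl fun a _ => by rw [load_fin]

lemma load_update_of_ne {i j : Fin (numAnnuli P)} (h : j ≠ i) (N : Counts P)
    (y : Fin (numCells P i) → ℕ) : load (Function.update N i y) j = load N j := by
  funext s
  unfold load cellLoad
  rw [Function.update_of_ne h]

/-- The largest load of a window of `τ` cells of annulus `j`. -/
noncomputable def maxWindow (N : Counts P) (j : Fin (numAnnuli P)) (τ : ℕ) : ℝ :=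
  (Finset.range (numCells P j)).sup' (Finset.nonempty_range_iff.2 (numCells_pos j).ne')
    (windowSum (load N j) τ)

lemma windowSum_mod (N : Counts P) (j : Fin (numAnnuli P)) (τ s : ℕ) :
    windowSum (load N j) τ (s % numCells P j) = windowSum (load N j) τ s := by
  have h : Function.Periodic (windowSum (load N j) τ) (numCells P j) := fun s =>
    windowSum_periodic (load_periodic N j) τ s
  exact h.map_mod_nat s

lemma windowSum_le_maxWindow (N : Counts P) (j : Fin (numAnnuli P)) (τ s : ℕ) :
    windowSum (load N j) τ s ≤ maxWindow N j τ := by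
  rw [← windowSum_mod]
  exact Finset.le_sup' (windowSum (load N j) τ)
    (Finset.mem_range.2 (Nat.mod_lt _ (numCells_pos j)))

lemma maxWindow_le {N : Counts P} {j : Fin (numAnnuli P)} {τ : ℕ} {G : ℝ}
    (h : ∀ s, windowSum (load N j) τ s ≤ G) : maxWindow N j τ ≤ G :=
  Finset.sup'_le _ _ fun s _ => h s

lemma maxWindow_update_of_ne {i j : Fin (numAnnuli P)} (h : j ≠ i) (N : Counts P)
    (y : Fin (numCells P i) → ℕ) (τ : ℕ) :
    maxWindow (Function.update N i y) j τ = maxWindow N j τ := by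
  unfold maxWindow
  simp only [load_update_of_ne h]

lemma windowSum_load_nonneg (N : Counts P) (j : Fin (numAnnuli P)) (τ s : ℕ) :
    0 ≤ windowSum (load N j) τ s := Finset.sum_nonneg fun _ _ => load_nonneg N j _

lemma cellMean_windowSum (N : Counts P) (j : Fin (numAnnuli P)) (τ e : ℕ) :
    cellMean j (fun s => windowSum (load N j) τ (s + e)) =
      annulusCount N j * (τ / numCells P j) := by
  unfold cellMean
  rw [sum_range_add_of_periodic _ (windowSum_periodic (load_periodic N j) τ),
    sum_windowSum (load_periodic N j), sum_load]
  ring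

lemma angularIndex_self {ω : Outcome P} (hω : InCells ω) (v : Vertex ω.1.1) :
    angularIndex v.1.1 (ω.2 v) = v.1.2 := by
  have h := (hω v).2
  have hw := cellWidth_pos v.1.1
  unfold angularIndex
  rw [Nat.floor_eq_iff, le_div_iff₀ hw, div_lt_iff₀ hw]
  · exact h
  · exact div_nonneg ((mul_nonneg (Nat.cast_nonneg _) hw.le).trans h.1) hw.le

lemma annulusSum_self {ω : Outcome P} (hω : InCells ω) (j : Fin (numAnnuli P)) (g : ℕ → ℝ) :
    annulusSum ω j j g = ∑ s ∈ Finset.range (numCells P j), load ω.1.1 j s * g s := by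
  rw [← Fin.sum_univ_eq_sum_range (fun s => load ω.1.1 j s * g s)]
  have h1 : annulusSum ω j j g = ∑ v : Vertex ω.1.1, if v.1.1 = j then g v.1.2 else 0 := by
    refine Finset.sum_congr rfl fun v _ => ?_
    split_ifs with h
    · subst h
      rw [angularIndex_self hω]
    · rfl
  rw [h1, Fintype.sum_sigma, Fintype.sum_sigma, Finset.sum_eq_single j]
  · refine Finset.sum_congr rfl fun a _ => ?_
    rw [load_fin]
    simp
  · intro b _ hb
    simp [hb]
  · simp

/-- The multiplicity of a cell in a window of `τ` cells. -/
noncomputable def windowIndicator (M τ s s' : ℕ) : ℝ :=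
  ∑ t ∈ Finset.range τ, if s' = (s + t) % M then 1 else 0

lemma windowIndicator_nonneg (M τ s s' : ℕ) : 0 ≤ windowIndicator M τ s s' :=
  Finset.sum_nonneg fun t _ => by split_ifs <;> norm_num

lemma windowIndicator_le_one {M τ : ℕ} (h : τ ≤ M) (s s' : ℕ) : windowIndicator M τ s s' ≤ 1 := by
  unfold windowIndicator
  rw [← Finset.sum_filter]
  simp only [Finset.sum_const, nsmul_eq_mul, mul_one]
  have : (Finset.filter (fun t => s' = (s + t) % M) (Finset.range τ)).card ≤ 1 := by
    rw [Finset.card_le_one]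
    intro a ha b hb
    simp only [Finset.mem_filter, Finset.mem_range] at ha hb
    have h1 : s + a ≡ s + b [MOD M] := ha.2.symm.trans hb.2
    exact Nat.ModEq.eq_of_lt_of_lt (Nat.ModEq.add_left_cancel' s h1) (by omega) (by omega)
  exact_mod_cast this

lemma sum_mul_windowIndicator {M : ℕ} (hM : 0 < M) (f : ℕ → ℝ) (hf : ∀ s, f (s + M) = f s)
    (τ s : ℕ) : ∑ s' ∈ Finset.range M, f s' * windowIndicator M τ s s' = windowSum f τ s := by
  unfold windowIndicator windowSum
  simp_rw [Finset.mul_sum]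
  rw [Finset.sum_comm]
  refine Finset.sum_congr rfl fun t _ => ?_
  rw [Finset.sum_eq_single ((s + t) % M)]
  · have h : Function.Periodic f M := hf
    simp [h.map_mod_nat]
  · intro b _ hb
    simp [hb]
  · intro h
    exact absurd (Finset.mem_range.2 (Nat.mod_lt _ hM)) h

lemma cellMean_windowIndicator (j : Fin (numAnnuli P)) (τ s : ℕ) :
    cellMean j (windowIndicator (numCells P j) τ s) = τ / numCells P j := by
  have h := sum_mul_windowIndicator (numCells_pos j) (fun _ => 1) (fun _ => rfl) τ s
  simp only [one_mul] at h
  unfold cellMean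
  rw [h]
  simp [windowSum]

/-- Writes a window load as a sum of a fixed function of the angles, independent of the counts, so
that the tail bounds apply with i = j. -/
lemma annulusSum_windowIndicator {ω : Outcome P} (hω : InCells ω) (j : Fin (numAnnuli P))
    (τ s : ℕ) : annulusSum ω j j (windowIndicator (numCells P j) τ s) =
      windowSum (load ω.1.1 j) τ s := by
  rw [annulusSum_self hω, sum_mul_windowIndicator (numCells_pos j) _ (load_periodic _ j)]

/-- An outcome whose statistics are close to their expectations. -/
structure Typical (ω : Outcome P) (l b : ℝ) : Prop where
  inCells : InCells ω
  card_eq : Fintype.card (Vertex ω.1.1) = P.n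
  trials_le : (ω.1.2 : ℝ) ≤ b
  count_le : ∀ i, (annulusCount ω.1.1 i : ℝ) ≤ 2 * (P.n * annulusProb P i) + l
  le_count : ∀ i, P.n * annulusProb P i / 4 - l ≤ annulusCount ω.1.1 i
  window_le : ∀ j τ s, τ ≤ numCells P j → windowSum (load ω.1.1 j) τ s ≤
    2 * (annulusCount ω.1.1 j * (τ / numCells P j)) + l
  le_window : ∀ j τ s, τ ≤ numCells P j →
    annulusCount ω.1.1 j * (τ / numCells P j) / 4 - l ≤ windowSum (load ω.1.1 j) τ s
  cross_le : ∀ i j, i ≠ j → ∀ e,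
    annulusSum ω i j (fun s => windowSum (load ω.1.1 j) (blockLen i j) (s + e)) ≤
      2 * (annulusCount ω.1.1 i * (annulusCount ω.1.1 j * (blockLen i j / numCells P j))) +
        maxWindow ω.1.1 j (blockLen i j) * l
  le_cross : ∀ i j, i ≠ j →
    annulusCount ω.1.1 i * (annulusCount ω.1.1 j * (blockLen i j / numCells P j)) / 4 -
      maxWindow ω.1.1 j (blockLen i j) * l ≤
        annulusSum ω i j (windowSum (load ω.1.1 j) (blockLen i j))
  sum_sq_le : ∀ i, (∀ a, (ω.1.1 i a : ℝ) ≤ 2 * l) → ∑ a, (ω.1.1 i a : ℝ) ^ 2 ≤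
    32 * (numCells P i * exp (annulusCount ω.1.1 i / numCells P i) + (2 * l) ^ 2)

/-- The number of vertices of annulus `i` or the second moment of its cells is atypical. -/
def AtypicalAnnulus (ω : Outcome P) (l : ℝ) (i : Fin (numAnnuli P)) : Prop :=
  2 * (P.n * annulusProb P i) + l < annulusCount ω.1.1 i ∨
  annulusCount ω.1.1 i < P.n * annulusProb P i / 4 - l ∨
  ((∀ a, (ω.1.1 i a : ℝ) ≤ 2 * l) ∧
    32 * (numCells P i * exp (annulusCount ω.1.1 i / numCells P i) + (2 * l) ^ 2) <
      ∑ a, (ω.1.1 i a : ℝ) ^ 2)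

/-- The number of vertices in a window of `τ` cells is atypical. -/
def AtypicalWindow (ω : Outcome P) (l : ℝ) (j : Fin (numAnnuli P)) (τ s : ℕ) : Prop :=
  τ ≤ numCells P j ∧
    (2 * (annulusCount ω.1.1 j * (τ / numCells P j)) + l <
      annulusSum ω j j (windowIndicator (numCells P j) τ s) ∨
    annulusSum ω j j (windowIndicator (numCells P j) τ s) <
      annulusCount ω.1.1 j * (τ / numCells P j) / 4 - l)

/-- The number of vertices of annulus `j` close to the vertices of annulus `i` is atypical. -/
def AtypicalCross (ω : Outcome P) (l : ℝ) (i j : Fin (numAnnuli P)) (e : ℕ) : Prop :=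
  i ≠ j ∧
    (2 * (annulusCount ω.1.1 i * (annulusCount ω.1.1 j * (blockLen i j / numCells P j))) +
      maxWindow ω.1.1 j (blockLen i j) * l <
      annulusSum ω i j (fun s => windowSum (load ω.1.1 j) (blockLen i j) (s + e)) ∨
    annulusSum ω i j (fun s => windowSum (load ω.1.1 j) (blockLen i j) (s + e)) <
      annulusCount ω.1.1 i * (annulusCount ω.1.1 j * (blockLen i j / numCells P j)) / 4 -
      maxWindow ω.1.1 j (blockLen i j) * l)

/-- Periodicity reduces starting points and shifts to finitely many, as the union bound requires. -/
lemma typical_of_not_atypical {ω : Outcome P} {l b : ℝ} (h1 : InCells ω)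
    (h2 : Fintype.card (Vertex ω.1.1) = P.n) (h3 : (ω.1.2 : ℝ) ≤ b)
    (hA : ∀ i, ¬ AtypicalAnnulus ω l i)
    (hW : ∀ j τ s, τ ≤ numCells P j → s < numCells P j → ¬ AtypicalWindow ω l j τ s)
    (hC : ∀ i j e, e < numCells P j → ¬ AtypicalCross ω l i j e) : Typical ω l b := by
  have hW' : ∀ j τ s, τ ≤ numCells P j → ¬ AtypicalWindow ω l j τ (s % numCells P j) :=
    fun j τ s hτ => hW j τ _ hτ (Nat.mod_lt _ (numCells_pos j))
  simp only [AtypicalAnnulus, AtypicalWindow, AtypicalCross, not_or, not_and, not_lt] at hA hW' hC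
  refine ⟨h1, h2, h3, fun i => (hA i).1, fun i => (hA i).2.1, fun j τ s hτ => ?_, fun j τ s hτ => ?_,
    fun i j hij e => ?_, fun i j hij => ?_, fun i => (hA i).2.2⟩
  · have h := (hW' j τ s hτ hτ).1
    rwa [annulusSum_windowIndicator h1, windowSum_mod] at h
  · have h := (hW' j τ s hτ hτ).2
    rwa [annulusSum_windowIndicator h1, windowSum_mod] at h
  · have h := (hC i j (e % numCells P j) (Nat.mod_lt _ (numCells_pos j)) hij).1
    have he : ∀ s, windowSum (load ω.1.1 j) (blockLen i j) (s + e % numCells P j) =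
        windowSum (load ω.1.1 j) (blockLen i j) (s + e) := by
      intro s
      rw [← windowSum_mod, Nat.add_mod_mod, windowSum_mod]
    simpa only [he] using h
  · exact (hC i j 0 (numCells_pos j) hij).2

lemma measure_exists_le {β ι : Type} [MeasurableSpace β] (μ : Measure β) (F : Finset ι)
    (p : ι → β → Prop) {ε : ℝ≥0∞} (h : ∀ x ∈ F, μ {ω | p x ω} ≤ ε) :
    μ {ω | ∃ x ∈ F, p x ω} ≤ F.card * ε := by
  have : {ω | ∃ x ∈ F, p x ω} = ⋃ x ∈ F, {ω | p x ω} := by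
    ext ω
    simp
  rw [this]
  refine (measure_biUnion_finset_le F _).trans ((Finset.sum_le_sum h).trans_eq ?_)
  rw [Finset.sum_const, nsmul_eq_mul]

variable (hP : P.Valid)
include hP

lemma Params.Valid.card_of_mem_support {ω : Outcome P} (hω : ω.1 ∈ (sampleCounts P).support) :
    Fintype.card (Vertex ω.1.1) = P.n := by
  obtain ⟨x, hx, h⟩ := mem_support_sampleCounts hω
  rw [← sum_of_mem_support_multinomialVariate_of_pos hP.numAnnuli_pos hP.annulusProb_pos hx]
  simp_rw [← h]
  rw [Fintype.card_sigma, Fintype.sum_sigma]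
  simp [annulusCount]

lemma Params.Valid.law_windows_le (l : ℝ) (j : Fin (numAnnuli P)) (τ s : ℕ) :
    law P {ω | AtypicalWindow ω l j τ s} ≤ 2 * ENNReal.ofReal (2 ^ (-l)) := by
  by_cases hτ : τ ≤ numCells P j
  · have h1 := hP.law_lt_annulusSum j j (fun _ => windowIndicator (numCells P j) τ s) (fun _ => 1)
      (fun _ => windowIndicator_nonneg _ _ _) (fun _ => windowIndicator_le_one hτ s)
      (fun _ _ => rfl) (fun _ _ => rfl) l
    have h2 := hP.law_annulusSum_lt j j (fun _ => windowIndicator (numCells P j) τ s) (fun _ => 1)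
      (fun _ => windowIndicator_nonneg _ _ _) (fun _ => windowIndicator_le_one hτ s)
      (fun _ _ => rfl) (fun _ _ => rfl) l
    rw [two_mul]
    refine (measure_mono ?_).trans ((measure_union_le _ _).trans (add_le_add h1 h2))
    rintro ω ⟨-, hω⟩
    simp only [cellMean_windowIndicator, one_mul]
    exact hω
  · simp [AtypicalWindow, hτ]

/-- The window loads of annulus j and their maximum ignore the cells of annulus i ≠ j, so they are
admissible as random weight and random bound. -/
lemma Params.Valid.law_cross_le (l : ℝ) (i j : Fin (numAnnuli P)) (e : ℕ) :
    law P {ω | AtypicalCross ω l i j e} ≤ 2 * ENNReal.ofReal (2 ^ (-l)) := by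
  by_cases hij : i ≠ j
  · have h1 := hP.law_lt_annulusSum i j
      (fun N s => windowSum (load N j) (blockLen i j) (s + e)) (fun N => maxWindow N j (blockLen i j))
      (fun _ _ => windowSum_load_nonneg _ _ _ _) (fun _ _ => windowSum_le_maxWindow _ _ _ _)
      (fun N y => by simp only [load_update_of_ne hij.symm])
      (fun N y => maxWindow_update_of_ne hij.symm N y _) l
    have h2 := hP.law_annulusSum_lt i j
      (fun N s => windowSum (load N j) (blockLen i j) (s + e)) (fun N => maxWindow N j (blockLen i j))
      (fun _ _ => windowSum_load_nonneg _ _ _ _) (fun _ _ => windowSum_le_maxWindow _ _ _ _)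
      (fun N y => by simp only [load_update_of_ne hij.symm])
      (fun N y => maxWindow_update_of_ne hij.symm N y _) l
    rw [two_mul]
    refine (measure_mono ?_).trans ((measure_union_le _ _).trans (add_le_add h1 h2))
    rintro ω ⟨-, hω⟩
    simp only [cellMean_windowSum]
    exact hω
  · simp [AtypicalCross, hij]

lemma Params.Valid.law_annulus_le {l : ℝ} (hl : 0 < l) (i : Fin (numAnnuli P)) :
    law P {ω | AtypicalAnnulus ω l i} ≤ 3 * ENNReal.ofReal (2 ^ (-l)) := by
  have h1 := hP.law_lt_annulusCount i l
  have h2 := hP.law_annulusCount_lt i l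
  have h3 := (hP.law_lt_sum_sq i (l := 2 * l) (by linarith)).trans
    (ENNReal.ofReal_le_ofReal (rpow_le_rpow_of_exponent_le one_le_two (by linarith : -(2 * l) ≤ -l)))
  refine (measure_union_le _ _).trans
    ((add_le_add h1 ((measure_union_le _ _).trans (add_le_add h2 h3))).trans_eq ?_)
  ring

/-- Outcomes are typical with high probability. -/
lemma Params.Valid.law_not_typical_le {l : ℝ} (hl : 0 < l) (b : ℝ) :
    law P {ω | ¬ Typical ω l b} ≤
      ENNReal.ofReal (7 * ((∑ i, numCells P i : ℕ) + 1) ^ 3 * 2 ^ (-l)) +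
      ENNReal.ofReal
        (2 ^ (numAnnuli P + ∑ i, numCells P i) * (2 / (2 - (P.q : ℝ))) ^ (-b)) := by
  set X := ∑ i, numCells P i with hX
  set ε := ENNReal.ofReal (2 ^ (-l)) with hε
  have hMX : ∀ i, numCells P i ≤ X := fun i =>
    Finset.single_le_sum (fun j _ => Nat.zero_le _) (Finset.mem_univ i)
  have hkX : numAnnuli P ≤ X := by
    have h := Finset.card_nsmul_le_sum Finset.univ (numCells P) 1 fun i _ => numCells_pos i
    simpa using h
  have hA := measure_exists_le (law P) Finset.univ (fun i ω => AtypicalAnnulus ω l i)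
    fun i _ => hP.law_annulus_le hl i
  have hW := measure_exists_le (law P)
    ((Finset.univ : Finset (Fin (numAnnuli P))) ×ˢ Finset.range (X + 1) ×ˢ Finset.range (X + 1))
    (fun x ω => AtypicalWindow ω l x.1 x.2.1 x.2.2) fun x _ => hP.law_windows_le l x.1 x.2.1 x.2.2
  have hC := measure_exists_le (law P)
    ((Finset.univ : Finset (Fin (numAnnuli P))) ×ˢ (Finset.univ : Finset (Fin (numAnnuli P))) ×ˢ
      Finset.range (X + 1)) (fun x ω => AtypicalCross ω l x.1 x.2.1 x.2.2)
    fun x _ => hP.law_cross_le l x.1 x.2.1 x.2.2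
  have hT := hP.law_lt_trials b
  have h0 : law P {ω | ¬ (InCells ω ∧ ω.1 ∈ (sampleCounts P).support)} = 0 :=
    ae_iff.1 hP.ae_inCells
  set SA := {ω : Outcome P | ∃ i ∈ (Finset.univ : Finset (Fin (numAnnuli P))),
    AtypicalAnnulus ω l i}
  set SW := {ω : Outcome P | ∃ x ∈ (Finset.univ : Finset (Fin (numAnnuli P))) ×ˢ
    Finset.range (X + 1) ×ˢ Finset.range (X + 1), AtypicalWindow ω l x.1 x.2.1 x.2.2}
  set SC := {ω : Outcome P | ∃ x ∈ (Finset.univ : Finset (Fin (numAnnuli P))) ×ˢ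
    (Finset.univ : Finset (Fin (numAnnuli P))) ×ˢ Finset.range (X + 1),
    AtypicalCross ω l x.1 x.2.1 x.2.2}
  set ST := {ω : Outcome P | b < ω.1.2}
  set S0 := {ω : Outcome P | ¬ (InCells ω ∧ ω.1 ∈ (sampleCounts P).support)}
  have hsub : {ω : Outcome P | ¬ Typical ω l b} ⊆ S0 ∪ (SA ∪ (SW ∪ (SC ∪ ST))) := by
    intro ω hω
    by_contra hnot
    simp only [Set.mem_union, not_or] at hnot
    obtain ⟨n0, nA, nW, nC, nT⟩ := hnot
    have n0' : InCells ω ∧ ω.1 ∈ (sampleCounts P).support := not_not.1 n0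
    refine hω (typical_of_not_atypical n0'.1 (hP.card_of_mem_support n0'.2) (not_lt.1 nT)
      (fun i hi => nA ⟨i, Finset.mem_univ _, hi⟩) (fun j τ s hτ hs h => nW ⟨(j, τ, s), ?_, h⟩)
      (fun i j e he h => nC ⟨(i, j, e), ?_, h⟩))
    · have := hMX j
      simp only [Finset.mem_product, Finset.mem_univ, Finset.mem_range, true_and]
      omega
    · have := hMX j
      simp only [Finset.mem_product, Finset.mem_univ, Finset.mem_range, true_and]
      omega
  -- Three bad events per annulus, two per window and two per pair with shift; each index set has at
  -- most (X + 1)³ elements, hence 7.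
  have hcard : (Finset.univ : Finset (Fin (numAnnuli P))).card * 3 +
      ((Finset.univ : Finset (Fin (numAnnuli P))) ×ˢ Finset.range (X + 1) ×ˢ
        Finset.range (X + 1)).card * 2 +
      ((Finset.univ : Finset (Fin (numAnnuli P))) ×ˢ (Finset.univ : Finset (Fin (numAnnuli P))) ×ˢ
      Finset.range (X + 1)).card * 2 ≤ 7 * (X + 1) ^ 3 := by
    simp only [Finset.card_product, Finset.card_univ, Fintype.card_fin, Finset.card_range]
    have h1 : numAnnuli P ≤ X + 1 := by omega
    have h2 : 1 ≤ X + 1 := by omega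
    have e1 : numAnnuli P ≤ (X + 1) ^ 3 := h1.trans (Nat.le_self_pow (by norm_num) _)
    have e2 : numAnnuli P * ((X + 1) * (X + 1)) ≤ (X + 1) ^ 3 :=
      (Nat.mul_le_mul_right _ h1).trans_eq (by ring)
    have e3 : numAnnuli P * (numAnnuli P * (X + 1)) ≤ (X + 1) ^ 3 :=
      (Nat.mul_le_mul h1 (Nat.mul_le_mul_right _ h1)).trans_eq (by ring)
    omega
  calc law P {ω | ¬ Typical ω l b} ≤ law P (S0 ∪ (SA ∪ (SW ∪ (SC ∪ ST)))) := measure_mono hsub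
    _ ≤ law P S0 + (law P SA + (law P SW + (law P SC + law P ST))) :=
      (measure_union_le _ _).trans (add_le_add le_rfl ((measure_union_le _ _).trans
        (add_le_add le_rfl ((measure_union_le _ _).trans
          (add_le_add le_rfl (measure_union_le _ _))))))
    _ ≤ 0 + (_ + (_ + (_ + _))) := add_le_add h0.le (add_le_add hA (add_le_add hW
      (add_le_add hC hT)))
    _ = ((((Finset.univ : Finset (Fin (numAnnuli P))).card * 3 +
      ((Finset.univ : Finset (Fin (numAnnuli P))) ×ˢ Finset.range (X + 1) ×ˢ
        Finset.range (X + 1)).card * 2 +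
      ((Finset.univ : Finset (Fin (numAnnuli P))) ×ˢ (Finset.univ : Finset (Fin (numAnnuli P))) ×ˢ
      Finset.range (X + 1)).card * 2 : ℕ) : ℝ≥0∞)) * ε + ENNReal.ofReal
        (2 ^ (numAnnuli P + X) * (2 / (2 - (P.q : ℝ))) ^ (-b)) := by
      push_cast
      ring
    _ ≤ ((7 * (X + 1) ^ 3 : ℕ) : ℝ≥0∞) * ε + _ := by
      gcongr
    _ = _ := by
      rw [hε, ← ENNReal.ofReal_natCast, ← ENNReal.ofReal_mul (Nat.cast_nonneg _)]
      push_cast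
      rfl

end Typical

end RHG

namespace RHG

open Real MeasureTheory ProbabilityTheory

/-! ## Comparisons between two annuli -/

section Pairs

variable {P : Params}

lemma annulusSum_mono {ω : Outcome P} {i j : Fin (numAnnuli P)} {g g' : ℕ → ℝ}
    (h : ∀ s, g s ≤ g' s) : annulusSum ω i j g ≤ annulusSum ω i j g' :=
  Finset.sum_le_sum fun v _ => by split_ifs; exacts [h _, le_rfl]

lemma annulusSum_const (ω : Outcome P) (i j : Fin (numAnnuli P)) (c : ℝ) :
    annulusSum ω i j (fun _ => c) = annulusCount ω.1.1 i * c := by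
  unfold annulusSum annulusCount
  rw [Fintype.sum_sigma, Fintype.sum_sigma, Finset.sum_eq_single i]
  · simp [Finset.sum_mul]
  · intro b _ hb
    simp [hb]
  · simp

lemma annulusSum_nonneg {ω : Outcome P} {i j : Fin (numAnnuli P)} {g : ℕ → ℝ}
    (h : ∀ s, 0 ≤ g s) : 0 ≤ annulusSum ω i j g :=
  Finset.sum_nonneg fun v _ => by split_ifs; exacts [h _, le_rfl]

lemma windowSum_load_le_count (N : Counts P) {j : Fin (numAnnuli P)} {τ : ℕ}
    (hτ : τ ≤ numCells P j) (s : ℕ) : windowSum (load N j) τ s ≤ annulusCount N j := by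
  rw [← sum_load, ← sum_range_add_of_periodic _ (load_periodic N j) s]
  simp_rw [add_comm _ s]
  exact Finset.sum_le_sum_of_subset_of_nonneg (Finset.range_subset_range.2 hτ)
    fun t _ _ => load_nonneg N j _

lemma windowSum_one (f : ℕ → ℝ) (s : ℕ) : windowSum f 1 s = f s := by simp [windowSum]

/-- The constant in the bounds for the comparisons between two annuli. -/
noncomputable def pairConst (κ : ℝ) : ℝ := 1200 * (1 + 1 / κ) * exp (3 * κ)

lemma pairConst_bounds {κ : ℝ} (hκ : 0 < κ) :
    1200 * (1 / κ) + 1200 ≤ pairConst κ ∧ 6 * κ + 2 ≤ pairConst κ ∧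
      512 * (exp (3 * κ) / κ) + 128 ≤ pairConst κ := by
  have h1 := add_one_le_exp (3 * κ)
  have h2 : 0 < 1 / κ := by positivity
  have h3 : exp (3 * κ) / κ = 1 / κ * exp (3 * κ) := by ring
  rw [h3]
  unfold pairConst
  have h4 : 1 / κ ≤ 1 / κ * exp (3 * κ) := le_mul_of_one_le_right h2.le (by linarith)
  refine ⟨?_, ?_, ?_⟩ <;> nlinarith

variable (hP : P.Valid)
include hP

/-- The mean dominates the additive error l, so the annulus count is within constant factors of its
mean and the average cell load lies between κ/16 and 3κ. -/
lemma Params.Valid.load_dense {ω : Outcome P} {l b : ℝ} (ht : Typical ω l b) (hl : 0 ≤ l)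
    {j : Fin (numAnnuli P)} (hμ : 8 * l + P.κ ≤ P.n * annulusProb P j) :
    P.n * annulusProb P j / 8 ≤ annulusCount ω.1.1 j ∧
      P.κ * numCells P j ≤ 16 * annulusCount ω.1.1 j ∧
      (annulusCount ω.1.1 j : ℝ) ≤ 3 * P.κ * numCells P j := by
  have hκ := hP.κ_pos
  have h1 := ht.count_le j
  have h2 := ht.le_count j
  have h3 := hP.numCells_le j
  have h4 := lt_numCells (P := P) j
  set μ := P.n * annulusProb P j
  rw [div_lt_iff₀ hκ] at h4
  have h5 : P.κ * numCells P j ≤ μ + P.κ := by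
    calc P.κ * numCells P j ≤ P.κ * (μ / P.κ + 1) := by gcongr
      _ = μ + P.κ := by field_simp
  refine ⟨?_, ?_, ?_⟩ <;> linarith

/-- In an annulus with few vertices, all counts are small. -/
lemma Params.Valid.pair_sparse {ω : Outcome P} {l b : ℝ} (ht : Typical ω l b) (hl : 1 ≤ l)
    (hlκ : 6 * P.κ ≤ l) {i j : Fin (numAnnuli P)} (hij : i ≤ j)
    (hμ : P.n * annulusProb P j < 8 * l + P.κ) :
    blockLen i j * annulusCount ω.1.1 i ≤ pairConst P.κ * l ^ 2 ∧
      ∀ e, annulusSum ω i j (fun s => windowSum (load ω.1.1 j) (blockLen i j) (s + e)) ≤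
        pairConst P.κ * l ^ 2 := by
  have hκ := hP.κ_pos
  obtain ⟨hC, -, -⟩ := pairConst_bounds hκ
  have hpij : P.n * annulusProb P i ≤ P.n * annulusProb P j :=
    mul_le_mul_of_nonneg_left (hP.annulusProb_mono hij) (Nat.cast_nonneg _)
  -- 2(8l + κ) + l ≤ 18l because 6κ ≤ l.
  have hni : (annulusCount ω.1.1 i : ℝ) ≤ 18 * l := by
    have := ht.count_le i
    linarith
  have hnj : (annulusCount ω.1.1 j : ℝ) ≤ 18 * l := by
    have := ht.count_le j
    linarith
  have hni0 : (0 : ℝ) ≤ annulusCount ω.1.1 i := Nat.cast_nonneg _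
  have hτM := blockLen_le_numCells i j
  have hκi : 0 < 1 / P.κ := by positivity
  constructor
  · have h1 : (blockLen i j : ℝ) ≤ 8 * (1 / P.κ) * l + 2 := by
      have h2 : (blockLen i j : ℝ) ≤ numCells P j := by exact_mod_cast hτM
      refine h2.trans ((hP.numCells_le j).trans ?_)
      have h3 : P.n * annulusProb P j / P.κ ≤ (8 * l + P.κ) / P.κ := by gcongr
      have h4 : (8 * l + P.κ) / P.κ = 8 * (1 / P.κ) * l + 1 := by field_simp
      linarith
    calc blockLen i j * (annulusCount ω.1.1 i : ℝ)
        ≤ (8 * (1 / P.κ) * l + 2) * (18 * l) := by gcongr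
      _ ≤ (1200 * (1 / P.κ) + 1200) * l ^ 2 := by nlinarith [mul_nonneg hκi.le (sq_nonneg l)]
      _ ≤ _ := by gcongr
  · intro e
    refine (annulusSum_mono fun s => (windowSum_load_le_count ω.1.1 hτM _).trans hnj).trans ?_
    rw [annulusSum_const]
    calc annulusCount ω.1.1 i * (18 * l) ≤ 18 * l * (18 * l) := by gcongr
      _ ≤ (1200 * (1 / P.κ) + 1200) * l ^ 2 := by nlinarith [mul_nonneg hκi.le (sq_nonneg l)]
      _ ≤ _ := by gcongr

/-- If the cells are wide, then few vertices are visited from each vertex. -/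
lemma Params.Valid.pair_wide {ω : Outcome P} {l b : ℝ} (ht : Typical ω l b) (hl : 1 ≤ l)
    (hlκ : 6 * P.κ ≤ l) {i j : Fin (numAnnuli P)}
    (hμ : 8 * l + P.κ ≤ P.n * annulusProb P j) (hw : ¬ Narrow i j) (e : ℕ) :
    annulusSum ω i j (fun s => windowSum (load ω.1.1 j) (blockLen i j) (s + e)) ≤
      pairConst P.κ * (annulusCount ω.1.1 i + l ^ 2) := by
  have hκ := hP.κ_pos
  obtain ⟨-, hC1, hC2⟩ := pairConst_bounds hκ
  obtain ⟨-, hd1, hd2⟩ := hP.load_dense ht (by linarith) hμ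
  have hM : (0 : ℝ) < numCells P j := by exact_mod_cast numCells_pos j
  have hni0 : (0 : ℝ) ≤ annulusCount ω.1.1 i := Nat.cast_nonneg _
  have hdens : (annulusCount ω.1.1 j : ℝ) / numCells P j ≤ 3 * P.κ := by
    rw [div_le_iff₀ hM]
    exact hd2
  -- A cell has average load at most 3κ, so its load is at most 6κ + l ≤ 2l: the truncation required
  -- by the second-moment bound.
  have hone : ∀ s, windowSum (load ω.1.1 j) 1 s ≤ 2 * l := by
    intro s
    have h := ht.window_le j 1 s (numCells_pos j)
    rw [Nat.cast_one, mul_one_div] at h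
    linarith
  have hl2 : 0 ≤ l ^ 2 := sq_nonneg l
  rw [blockLen_of_not_narrow hw]
  by_cases hij : i = j
  · subst hij
    rw [annulusSum_self ht.inCells]
    simp_rw [windowSum_one]
    -- Within one annulus a shifted product of loads is bounded by the sum of their squares.
    refine (sum_mul_shift_le (load_periodic _ i) e).trans ?_
    rw [sum_load_sq]
    refine (ht.sum_sq_le i fun a => ?_).trans ?_
    · rw [← load_fin, ← windowSum_one (load ω.1.1 i)]
      exact hone _
    · have h1 : numCells P i * exp (annulusCount ω.1.1 i / numCells P i) ≤
          16 * (exp (3 * P.κ) / P.κ) * annulusCount ω.1.1 i := by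
        calc numCells P i * exp (annulusCount ω.1.1 i / numCells P i)
            ≤ numCells P i * exp (3 * P.κ) := by gcongr
          _ = P.κ * numCells P i * (exp (3 * P.κ) / P.κ) := by field_simp
          _ ≤ 16 * annulusCount ω.1.1 i * (exp (3 * P.κ) / P.κ) := by gcongr
          _ = _ := by ring
      have h2 : 0 < exp (3 * P.κ) / P.κ := by positivity
      calc _ ≤ 32 * (16 * (exp (3 * P.κ) / P.κ) * annulusCount ω.1.1 i + (2 * l) ^ 2) := by gcongr
        _ ≤ (512 * (exp (3 * P.κ) / P.κ) + 128) * (annulusCount ω.1.1 i + l ^ 2) := by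
          nlinarith [mul_nonneg h2.le hl2]
        _ ≤ _ := by gcongr
  · have h := ht.cross_le i j hij e
    rw [blockLen_of_not_narrow hw, Nat.cast_one, mul_one_div] at h
    have hmax : maxWindow ω.1.1 j 1 ≤ 2 * l := maxWindow_le hone
    calc _ ≤ _ := h
      _ ≤ 2 * (annulusCount ω.1.1 i * (3 * P.κ)) + 2 * l * l := by gcongr
      _ ≤ (6 * P.κ + 2) * (annulusCount ω.1.1 i + l ^ 2) := by nlinarith [mul_nonneg hκ.le hl2]
      _ ≤ _ := by gcongr

/-- If the cells are narrow, then the visited vertices are comparable to the neighbors. -/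
lemma Params.Valid.pair_narrow {ω : Outcome P} {l b : ℝ} (ht : Typical ω l b) (hl : 1 ≤ l)
    {i j : Fin (numAnnuli P)} (hμ : 8 * l + P.κ ≤ P.n * annulusProb P j) :
    blockLen i j * annulusCount ω.1.1 i ≤ pairConst P.κ *
        (annulusSum ω i j (windowSum (load ω.1.1 j) (blockLen i j)) + l ^ 2) ∧
      ∀ e, annulusSum ω i j (fun s => windowSum (load ω.1.1 j) (blockLen i j) (s + e)) ≤
        pairConst P.κ *
          (annulusSum ω i j (windowSum (load ω.1.1 j) (blockLen i j)) + l ^ 2) := by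
  have hκ := hP.κ_pos
  obtain ⟨hC, -, -⟩ := pairConst_bounds hκ
  obtain ⟨hd0, hd1, hd2⟩ := hP.load_dense ht (by linarith) hμ
  have hM : (0 : ℝ) < numCells P j := by exact_mod_cast numCells_pos j
  have hni0 : (0 : ℝ) ≤ annulusCount ω.1.1 i := Nat.cast_nonneg _
  have hnj0 : (0 : ℝ) < annulusCount ω.1.1 j := by linarith
  have hτM := blockLen_le_numCells i j
  have hτ1 := one_le_blockLen i j
  set τ := blockLen i j with hτ
  set B := annulusSum ω i j (windowSum (load ω.1.1 j) τ) with hB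
  have hB0 : 0 ≤ B := annulusSum_nonneg fun s => windowSum_load_nonneg _ _ _ _
  have hl2 : 0 ≤ l ^ 2 := sq_nonneg l
  have hκi : 0 < 1 / P.κ := by positivity
  have hC0 : 0 ≤ pairConst P.κ := by linarith
  have hC1 : 1200 ≤ pairConst P.κ := by linarith
  by_cases hij : i = j
  · subst hij
    rw [annulusSum_self ht.inCells] at hB
    constructor
    · have h1 := sq_sum_le_sum_mul_windowSum (load_periodic ω.1.1 i) (load_nonneg ω.1.1 i)
        (τ := τ) hτ1
      rw [← hB, sum_load] at h1
      have h2 : τ * (annulusCount ω.1.1 i : ℝ) ≤ 32 * (1 / P.κ) * B := by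
        refine le_of_mul_le_mul_left ?_ hnj0
        calc (annulusCount ω.1.1 i : ℝ) * (τ * annulusCount ω.1.1 i)
            = τ * (annulusCount ω.1.1 i : ℝ) ^ 2 := by ring
          _ ≤ 2 * numCells P i * B := h1
          _ = P.κ * numCells P i * (2 * (1 / P.κ) * B) := by field_simp
          _ ≤ 16 * annulusCount ω.1.1 i * (2 * (1 / P.κ) * B) := by gcongr
          _ = _ := by ring
      calc _ ≤ _ := h2
        _ ≤ (1200 * (1 / P.κ) + 1200) * (B + l ^ 2) := by
          nlinarith [mul_nonneg hκi.le hB0, mul_nonneg hκi.le hl2]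
        _ ≤ _ := by gcongr
    · intro e
      rw [annulusSum_self ht.inCells]
      have h1 := sum_mul_windowSum_shift_le (load_periodic ω.1.1 i) (load_nonneg ω.1.1 i)
        (τ := τ) hτ1 e
      rw [← hB] at h1
      nlinarith
  · set w := annulusCount ω.1.1 j * (τ / numCells P j : ℝ) with hw
    have hw0 : 0 ≤ w := by positivity
    have hτw : (τ : ℝ) ≤ 16 * (1 / P.κ) * w := by
      have h1 : (τ : ℝ) = 1 / P.κ * (P.κ * numCells P j) * (τ / numCells P j) := by
        field_simp
      calc (τ : ℝ) = 1 / P.κ * (P.κ * numCells P j) * (τ / numCells P j) := h1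
        _ ≤ 1 / P.κ * (16 * annulusCount ω.1.1 j) * (τ / numCells P j) := by gcongr
        _ = _ := by rw [hw]; ring
    have hτn : τ * (annulusCount ω.1.1 i : ℝ) ≤
        16 * (1 / P.κ) * (annulusCount ω.1.1 i * w) := by
      calc τ * (annulusCount ω.1.1 i : ℝ) ≤ 16 * (1 / P.κ) * w * annulusCount ω.1.1 i := by gcongr
        _ = _ := by ring
    -- Here `w` is the mean load of a block. If w ≥ 8l, every single block has load between w/8 and
    -- 3w. Otherwise no block exceeds 17l, and the sums over annulus i have error at most 17l².
    rcases le_total (8 * l) w with hwl | hwl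
    · have hBw : annulusCount ω.1.1 i * w ≤ 8 * B := by
        have h1 : annulusCount ω.1.1 i * (w / 8) ≤ B := by
          rw [← annulusSum_const ω i j]
          refine annulusSum_mono fun s => ?_
          have := ht.le_window j τ s hτM
          rw [← hw] at this
          linarith
        linarith
      constructor
      · calc _ ≤ _ := hτn
          _ ≤ 16 * (1 / P.κ) * (8 * B) := by gcongr
          _ ≤ (1200 * (1 / P.κ) + 1200) * (B + l ^ 2) := by
            nlinarith [mul_nonneg hκi.le hB0, mul_nonneg hκi.le hl2]
          _ ≤ _ := by gcongr
      · intro e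
        have h1 : annulusSum ω i j (fun s => windowSum (load ω.1.1 j) τ (s + e)) ≤
            annulusCount ω.1.1 i * (3 * w) := by
          rw [← annulusSum_const ω i j]
          refine annulusSum_mono fun s => ?_
          have := ht.window_le j τ (s + e) hτM
          rw [← hw] at this
          linarith
        nlinarith
    · have hmax : maxWindow ω.1.1 j τ ≤ 17 * l := maxWindow_le fun s => by
        have := ht.window_le j τ s hτM
        rw [← hw] at this
        linarith
      have hmaxl : maxWindow ω.1.1 j τ * l ≤ 17 * l ^ 2 := by nlinarith
      have hlow := ht.le_cross i j hij
      rw [← hτ, ← hw, ← hB] at hlow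
      have hBw : annulusCount ω.1.1 i * w ≤ 4 * B + 68 * l ^ 2 := by linarith
      constructor
      · calc _ ≤ _ := hτn
          _ ≤ 16 * (1 / P.κ) * (4 * B + 68 * l ^ 2) := by gcongr
          _ ≤ (1200 * (1 / P.κ) + 1200) * (B + l ^ 2) := by
            nlinarith [mul_nonneg hκi.le hB0, mul_nonneg hκi.le hl2]
          _ ≤ _ := by gcongr
      · intro e
        have hup := ht.cross_le i j hij e
        rw [← hτ, ← hw] at hup
        nlinarith

/-- The comparisons between two annuli. -/
lemma Params.Valid.pair_le {ω : Outcome P} {l b : ℝ} (ht : Typical ω l b) (hl : 1 ≤ l)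
    (hlκ : 6 * P.κ ≤ l) {i j : Fin (numAnnuli P)} (hij : i ≤ j) {B : ℝ} (hB0 : 0 ≤ B)
    (hB : Narrow i j → annulusSum ω i j (windowSum (load ω.1.1 j) (blockLen i j)) ≤ B) :
    blockLen i j * annulusCount ω.1.1 i ≤
        pairConst P.κ * (B + annulusCount ω.1.1 i + l ^ 2) ∧
      ∀ e, annulusSum ω i j (fun s => windowSum (load ω.1.1 j) (blockLen i j) (s + e)) ≤
        pairConst P.κ * (B + annulusCount ω.1.1 i + l ^ 2) := by
  have hκ := hP.κ_pos
  obtain ⟨hC, -, -⟩ := pairConst_bounds hκ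
  have hκi : 0 < 1 / P.κ := by positivity
  have hC1 : 1200 ≤ pairConst P.κ := by linarith
  have hC0 : 0 ≤ pairConst P.κ := by linarith
  have hl2 : 0 ≤ l ^ 2 := sq_nonneg l
  have hni0 : (0 : ℝ) ≤ annulusCount ω.1.1 i := Nat.cast_nonneg _
  rcases lt_or_ge (P.n * annulusProb P j) (8 * l + P.κ) with hμ | hμ
  · obtain ⟨h1, h2⟩ := hP.pair_sparse ht hl hlκ hij hμ
    have h3 : pairConst P.κ * l ^ 2 ≤ pairConst P.κ * (B + annulusCount ω.1.1 i + l ^ 2) := by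
      gcongr
      linarith
    exact ⟨h1.trans h3, fun e => (h2 e).trans h3⟩
  by_cases hw : Narrow i j
  · obtain ⟨h1, h2⟩ := hP.pair_narrow (i := i) ht hl hμ
    have h3 : pairConst P.κ *
        (annulusSum ω i j (windowSum (load ω.1.1 j) (blockLen i j)) + l ^ 2) ≤
        pairConst P.κ * (B + annulusCount ω.1.1 i + l ^ 2) := by
      have := hB hw
      gcongr
      linarith
    exact ⟨h1.trans h3, fun e => (h2 e).trans h3⟩
  · refine ⟨?_, fun e => (hP.pair_wide ht hl hlκ hμ hw e).trans ?_⟩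
    · rw [blockLen_of_not_narrow hw, Nat.cast_one, one_mul]
      nlinarith
    · gcongr
      linarith

end Pairs

end RHG

namespace RHG

open Real MeasureTheory ProbabilityTheory

/-! ## The running time of typical outcomes -/

section RunningTime

variable {P : Params}

lemma sum_annulusSum (ω : Outcome P) (p : Fin (numAnnuli P) → Fin (numAnnuli P) → Prop)
    [∀ i j, Decidable (p i j)]
    (f : Fin (numAnnuli P) → Fin (numAnnuli P) → ℕ → ℝ) :
    ∑ v : Vertex ω.1.1, ∑ j with p v.1.1 j, f v.1.1 j (angularIndex j (ω.2 v)) =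
      ∑ i, ∑ j with p i j, annulusSum ω i j (f i j) := by
  have h : ∀ v : Vertex ω.1.1, ∑ j with p v.1.1 j, f v.1.1 j (angularIndex j (ω.2 v)) =
      ∑ i, ∑ j with p i j, if v.1.1 = i then f i j (angularIndex j (ω.2 v)) else 0 := by
    intro v
    refine ((Finset.sum_eq_single v.1.1 (fun i _ hi => ?_)
      (fun h => absurd (Finset.mem_univ _) h)).trans ?_).symm
    · exact Finset.sum_eq_zero fun j _ => if_neg hi.symm
    · exact Finset.sum_congr rfl fun j _ => if_pos rfl
  simp_rw [h, annulusSum]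
  rw [Finset.sum_comm]
  exact Finset.sum_congr rfl fun i _ => Finset.sum_comm

lemma sum_range_mul_half_pow (k : ℕ) :
    ∑ t ∈ Finset.range k, ((t + 1 : ℕ) : ℝ) * (1 / 2) ^ (t + 1) ≤ 2 := by
  have h : ∑ t ∈ Finset.range k, ((t + 1 : ℕ) : ℝ) * (1 / 2) ^ (t + 1) =
      2 - (k + 2) * (1 / 2) ^ k := by
    induction k with
    | zero => norm_num
    | succ k ih =>
      rw [Finset.sum_range_succ, ih]
      push_cast
      ring
  rw [h]
  have : (0 : ℝ) ≤ (k + 2) * (1 / 2) ^ k := by positivity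
  linarith

lemma annulusSum_add (ω : Outcome P) (i j : Fin (numAnnuli P)) (g g' : ℕ → ℝ) :
    annulusSum ω i j (fun s => g s + g' s) = annulusSum ω i j g + annulusSum ω i j g' := by
  unfold annulusSum
  rw [← Finset.sum_add_distrib]
  exact Finset.sum_congr rfl fun v _ => by split_ifs <;> simp

lemma annulusSum_sum (ω : Outcome P) (i j : Fin (numAnnuli P)) {ι : Type} (F : Finset ι)
    (g : ι → ℕ → ℝ) :
    annulusSum ω i j (fun s => ∑ a ∈ F, g a s) = ∑ a ∈ F, annulusSum ω i j (g a) := by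
  unfold annulusSum
  rw [Finset.sum_comm]
  exact Finset.sum_congr rfl fun v _ => by split_ifs <;> simp

variable (hP : P.Valid)
include hP

/-- Annulus i is counted k - i times, against a probability of at most 16 · 2^(-(k - i)); the series
∑ t 2^(-t) ≤ 2 keeps the total linear in n without a factor k. -/
lemma Params.Valid.sum_annulusCount_mul_le {ω : Outcome P} {l b : ℝ} (ht : Typical ω l b)
    (hl : 0 ≤ l) :
    ∑ i, ∑ j with i ≤ j, (annulusCount ω.1.1 i : ℝ) ≤ 64 * P.n + (numAnnuli P : ℝ) ^ 2 * l := by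
  set k := numAnnuli P with hk
  have h1 : ∀ i : Fin k, ∑ j with i ≤ j, (annulusCount ω.1.1 i : ℝ) ≤
      32 * P.n * ((k - i : ℕ) * (1 / 2) ^ (k - i)) + k * l := by
    intro i
    rw [Finset.sum_const, nsmul_eq_mul]
    have hc : (Finset.univ.filter fun j => i ≤ j).card = k - i := by
      rw [← Fin.card_Ici]
      congr 1
      ext j
      simp
    rw [hc]
    have h2 := ht.count_le i
    have h3 := hP.annulusProb_upper i
    have h4 : ((k - i : ℕ) : ℝ) ≤ k := by exact_mod_cast Nat.sub_le _ _
    have h5 : (annulusCount ω.1.1 i : ℝ) ≤ 2 * (P.n * (16 * (1 / 2 : ℝ) ^ (k - i))) + l := by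
      refine h2.trans ?_
      gcongr
    calc ((k - i : ℕ) : ℝ) * annulusCount ω.1.1 i
        ≤ (k - i : ℕ) * (2 * (P.n * (16 * (1 / 2 : ℝ) ^ (k - i))) + l) := by gcongr
      _ = 32 * P.n * ((k - i : ℕ) * (1 / 2) ^ (k - i)) + (k - i : ℕ) * l := by ring
      _ ≤ _ := by gcongr
  refine (Finset.sum_le_sum fun i _ => h1 i).trans ?_
  rw [Finset.sum_add_distrib, ← Finset.mul_sum]
  have h6 : ∑ i : Fin k, ((k - i : ℕ) : ℝ) * (1 / 2 : ℝ) ^ (k - i : ℕ) ≤ 2 := by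
    rw [Fin.sum_univ_eq_sum_range (fun i => ((k - i : ℕ) : ℝ) * (1 / 2 : ℝ) ^ (k - i)) k,
      ← Finset.sum_range_reflect]
    refine le_of_eq_of_le (Finset.sum_congr rfl fun t ht => ?_) (sum_range_mul_half_pow k)
    have := Finset.mem_range.1 ht
    rw [show k - (k - 1 - t) = t + 1 by omega]
  have h7 : ∑ _i : Fin k, (k : ℝ) * l = (k : ℝ) ^ 2 * l := by
    rw [Finset.sum_const, Finset.card_univ, Fintype.card_fin, nsmul_eq_mul]
    ring
  rw [h7]
  have : (0 : ℝ) ≤ 32 * P.n := by positivity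
  nlinarith

open Classical in
lemma Params.Valid.sum_narrow_le {ω : Outcome P} (hω : InCells ω) :
    ∑ i, ∑ j with Narrow i j, annulusSum ω i j (windowSum (load ω.1.1 j) (blockLen i j)) ≤
      Fintype.card (Vertex ω.1.1) + 2 * numEdges ω := by
  rw [← sum_annulusSum ω Narrow fun i j => windowSum (load ω.1.1 j) (blockLen i j)]
  simp_rw [windowSum_load]
  exact_mod_cast hP.sum_windowLoad_le hω

/-- Sums `pair_le` over all pairs i ≤ j with `B` the load of the first blocks if the cells are
narrow and 0 otherwise; the total of `B` is at most n + 2m, and k² l² ≤ n absorbs the errors. -/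
lemma Params.Valid.sum_steps_query_le {ω : Outcome P} {l b : ℝ} (ht : Typical ω l b) (hl : 1 ≤ l)
    (hlκ : 6 * P.κ ≤ l) (hk : ((numAnnuli P : ℝ) * l) ^ 2 ≤ P.n) :
    ∑ v, ((query ω v).steps : ℝ) ≤
      65 * P.n + 3 * numBlocks P.α * pairConst P.κ * (67 * P.n + 2 * numEdges ω) := by
  classical
  set K := numBlocks P.α with hK
  set C := pairConst P.κ with hC
  have hC0 : 0 ≤ C := by
    have h1 := (pairConst_bounds hP.κ_pos).1
    have h2 : 0 < 1 / P.κ := one_div_pos.2 hP.κ_pos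
    linarith
  set B : Fin (numAnnuli P) → Fin (numAnnuli P) → ℝ := fun i j =>
    if Narrow i j then annulusSum ω i j (windowSum (load ω.1.1 j) (blockLen i j)) else 0 with hB
  have hB0 : ∀ i j, 0 ≤ B i j := fun i j => by
    simp only [hB]
    split_ifs
    exacts [annulusSum_nonneg fun s => windowSum_load_nonneg _ _ _ _, le_rfl]
  set e : Fin (numAnnuli P) → Fin (numAnnuli P) → ℕ → ℕ := fun i j a =>
    numCells P j - walkBound i j + a * blockLen i j with he
  set f : Fin (numAnnuli P) → Fin (numAnnuli P) → ℕ → ℝ := fun i j s =>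
    (1 + 2 * K * blockLen i j) + ∑ a ∈ Finset.range K,
      windowSum (load ω.1.1 j) (blockLen i j) (s + e i j a) with hf
  have h1 : ∑ v, ((query ω v).steps : ℝ) ≤ ∑ i, ∑ j with i ≤ j, annulusSum ω i j (f i j) := by
    rw [← sum_annulusSum ω (· ≤ ·) f]
    refine Finset.sum_le_sum fun v _ => ?_
    rw [steps_query]
    push_cast
    refine Finset.sum_le_sum fun j _ => ?_
    have h2 := hP.steps_queryAnnulus_le ht.inCells v j
    have h3 : ((queryAnnulus ω v j).steps : ℝ) ≤ 2 * (K * blockLen v.1.1 j) +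
        ∑ a ∈ Finset.range K, (windowLoad ω.1.1 j (blockLen v.1.1 j)
          (angularIndex j (ω.2 v) + e v.1.1 j a) : ℝ) := by
      exact_mod_cast h2
    simp only [hf, windowSum_load]
    linarith
  -- 3K is composed of 2K for the tests and iterations over cells and K for the comparisons in the K
  -- blocks.
  have h2 : ∀ i j, i ≤ j → annulusSum ω i j (f i j) ≤
      annulusCount ω.1.1 i + 3 * K * C * (B i j + annulusCount ω.1.1 i + l ^ 2) := by
    intro i j hij
    obtain ⟨h3, h4⟩ := hP.pair_le ht hl hlκ hij (hB0 i j) (fun hw => by simp [hB, hw])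
    simp only [hf]
    rw [annulusSum_add, annulusSum_const, annulusSum_sum]
    have h5 := Finset.sum_le_sum fun a (_ : a ∈ Finset.range K) => h4 (e i j a)
    rw [Finset.sum_const, Finset.card_range, nsmul_eq_mul] at h5
    have h6 : 2 * (K : ℝ) * (blockLen i j * annulusCount ω.1.1 i) ≤
        2 * K * (C * (B i j + annulusCount ω.1.1 i + l ^ 2)) := by gcongr
    linarith
  have h3 : ∑ i, ∑ j with i ≤ j, B i j ≤ P.n + 2 * numEdges ω := by
    rw [← ht.card_eq]
    refine le_trans (Finset.sum_le_sum fun i _ => ?_) (hP.sum_narrow_le ht.inCells)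
    refine le_trans ?_ (Finset.sum_filter (Narrow i) _).ge
    exact Finset.sum_le_sum_of_subset_of_nonneg (Finset.filter_subset _ _) fun j _ _ => hB0 i j
  have h4 := hP.sum_annulusCount_mul_le ht (by linarith)
  have h5 : ∑ i : Fin (numAnnuli P), ∑ j with i ≤ j, l ^ 2 ≤ ((numAnnuli P : ℝ) * l) ^ 2 := by
    calc ∑ i : Fin (numAnnuli P), ∑ j with i ≤ j, l ^ 2
        ≤ ∑ i : Fin (numAnnuli P), ∑ j : Fin (numAnnuli P), l ^ 2 :=
          Finset.sum_le_sum fun i _ => Finset.sum_le_sum_of_subset_of_nonneg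
            (Finset.filter_subset _ _) fun j _ _ => sq_nonneg l
      _ = _ := by
        simp only [Finset.sum_const, Finset.card_univ, Fintype.card_fin, nsmul_eq_mul]
        ring
  have h6 : (numAnnuli P : ℝ) ^ 2 * l ≤ P.n := by
    refine le_trans ?_ hk
    rw [mul_pow]
    gcongr
    nlinarith
  have h7 : ∑ i, ∑ j with i ≤ j, (annulusCount ω.1.1 i : ℝ) ≤ 65 * P.n := by linarith
  calc _ ≤ _ := h1
    _ ≤ ∑ i, ∑ j with i ≤ j, ((annulusCount ω.1.1 i : ℝ) +
          3 * K * C * (B i j + annulusCount ω.1.1 i + l ^ 2)) :=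
        Finset.sum_le_sum fun i _ => Finset.sum_le_sum fun j hj => h2 i j (by simpa using hj)
    _ = ∑ i, ∑ j with i ≤ j, (annulusCount ω.1.1 i : ℝ) +
          3 * K * C * (∑ i, ∑ j with i ≤ j, B i j +
            ∑ i, ∑ j with i ≤ j, (annulusCount ω.1.1 i : ℝ) +
            ∑ i : Fin (numAnnuli P), ∑ j with i ≤ j, l ^ 2) := by
        rw [← Finset.sum_add_distrib, ← Finset.sum_add_distrib, Finset.mul_sum,
          ← Finset.sum_add_distrib]
        refine Finset.sum_congr rfl fun i _ => ?_
        rw [← Finset.sum_add_distrib, ← Finset.sum_add_distrib, Finset.mul_sum,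
          ← Finset.sum_add_distrib]
    _ ≤ 65 * P.n + 3 * K * C * ((P.n + 2 * numEdges ω) + 65 * P.n + P.n) := by
        gcongr
        exact h5.trans hk
    _ = _ := by ring

/-- The running time in terms of the numbers of trials, vertices and edges. -/
lemma Params.Valid.runningTime_le {ω : Outcome P} {l b : ℝ} (ht : Typical ω l b) (hl : 1 ≤ l)
    (hlκ : 6 * P.κ ≤ l) (hk : ((numAnnuli P : ℝ) * l) ^ 2 ≤ P.n) :
    (runningTime ω : ℝ) ≤ b + (69 + 1 / P.κ) * P.n +
      3 * numBlocks P.α * pairConst P.κ * (67 * P.n + 2 * numEdges ω) := by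
  have h1 := hP.sum_steps_query_le ht hl hlκ hk
  have h2 := hP.sum_numCells_le
  have h3 := ht.trials_le
  have h4 : (numAnnuli P : ℝ) ≤ P.n := by
    have h5 : (1 : ℝ) ≤ numAnnuli P := by exact_mod_cast hP.numAnnuli_pos
    have h6 : (numAnnuli P : ℝ) ≤ numAnnuli P * l := le_mul_of_one_le_right (by linarith) hl
    nlinarith
  have h6 : (P.n : ℝ) / P.κ = 1 / P.κ * P.n := by ring
  unfold runningTime
  rw [steps_queryAll, ht.card_eq]
  push_cast
  linarith

end RunningTime

end RHG

namespace RHG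

open Real MeasureTheory ProbabilityTheory

/-! ## The number of edges of typical outcomes -/

section Edges

variable {P : Params}

variable (hP : P.Valid)
include hP

/-- The cells of the outermost annulus are narrow compared to the angular deviation from an annulus
that is `s` annuli further in. -/
lemma Params.Valid.narrow_of_le {s : ℕ} {D : ℝ} (hD : 0 < D) (hR : exp (P.R / 2) ≤ D * P.n)
    (hs : 64 * π * P.κ * D ≤ innerConst P.α * exp (s * minWidth P.α / 2)) (hn : 0 < P.n)
    (ha : 64 * π * P.κ ≤ innerConst P.α * P.n) {i j : Fin (numAnnuli P)}
    (hj : (j : ℕ) = numAnnuli P - 1) (hi : (i : ℕ) = numAnnuli P - 1 - s)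
    (hp : 1 / 32 ≤ annulusProb P j) : Narrow i j := by
  have hκ := hP.κ_pos
  have hn' : (0 : ℝ) < P.n := by exact_mod_cast hn
  have hk := hP.numAnnuli_pos
  have ha0 := innerConst_pos hP.α_pos
  -- An annulus of probability at least 1/32 has more than n/(32κ) cells.
  have hw : cellWidth P j ≤ 64 * π * P.κ / P.n := by
    have h1 := lt_numCells j
    have h2 : P.n * (1 / 32) / P.κ ≤ P.n * annulusProb P j / P.κ := by gcongr
    unfold cellWidth
    calc 2 * π / numCells P j ≤ 2 * π / (P.n * (1 / 32) / P.κ) := by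
          gcongr
          exact h2.trans h1.le
      _ = _ := by field_simp; norm_num
  unfold Narrow angleScale
  rw [mul_min_of_nonneg _ _ ha0.le, mul_one]
  have h1 : 64 * π * P.κ / P.n ≤ innerConst P.α := by rwa [div_le_iff₀ hn']
  refine hw.trans (le_min h1 ?_)
  rcases le_or_gt s (numAnnuli P - 1) with hsk | hsk
  · have hkR := hP.numAnnuli_mul_radialWidth
    have hsum : P.R - radialBound P i - radialBound P j = -P.R + (s + 2) * radialWidth P := by
      rw [radialBound_eq, radialBound_eq, hj, hi, Nat.cast_sub hsk, Nat.cast_sub hk, ← hkR]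
      push_cast
      ring
    have hw0 := hP.radialWidth_pos
    have hmw := hP.minWidth_le
    have h2 : (s : ℝ) * minWidth P.α ≤ (s + 2) * radialWidth P := by
      have : (s : ℝ) * minWidth P.α ≤ s * radialWidth P := by gcongr
      linarith
    have h3 : exp (s * minWidth P.α / 2) ≤
        exp ((P.R - radialBound P i - radialBound P j) / 2) * exp (P.R / 2) := by
      rw [← exp_add, exp_le_exp, hsum]
      linarith
    rw [div_le_iff₀ hn']
    refine le_of_mul_le_mul_right ?_ hD
    calc 64 * π * P.κ * D ≤ innerConst P.α * exp (s * minWidth P.α / 2) := hs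
      _ ≤ innerConst P.α * (exp ((P.R - radialBound P i - radialBound P j) / 2) * (D * P.n)) := by
        gcongr
        exact h3.trans (by gcongr)
      _ = _ := by ring
  -- If fewer than `s` annuli lie further in, truncated subtraction selects annulus 0, where the
  -- angular scale is 1.
  · have h2 : radialBound P i = 0 := by
      rw [radialBound_eq, hi, Nat.sub_eq_zero_of_le hsk.le]
      simp
    have h3 := hP.radialBound_le j.2.le
    have h4 : 1 ≤ exp ((P.R - radialBound P i - radialBound P j) / 2) := by
      rw [h2]
      exact one_le_exp (by linarith)
    exact h1.trans (le_mul_of_one_le_right ha0.le h4)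

/-- The number of vertices is at most proportional to the number of edges. -/
lemma Params.Valid.vertices_le {ω : Outcome P} {l b : ℝ} (ht : Typical ω l b) (hl : 1 ≤ l)
    {s : ℕ} (hs1 : 1 ≤ s) {D c : ℝ} (hD : 0 < D) (hR : exp (P.R / 2) ≤ D * P.n)
    (hs : 64 * π * P.κ * D ≤ innerConst P.α * exp (s * minWidth P.α / 2)) (hn : 0 < P.n)
    (ha : 64 * π * P.κ ≤ innerConst P.α * P.n) (hal : 8192 * π * l ≤ innerConst P.α * P.n)
    (hc : c = 1 / 8 * (1 / 4) ^ (s + 1)) (hcl : 16 / c ≤ l) (hcn : 8 / c * l ≤ P.n)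
    (hd : 32 * (8 * l + P.κ) ≤ P.n) (hl2 : 17 * 1024 / (c * P.κ) * l ^ 2 ≤ P.n) :
    (P.n : ℝ) ≤ (2 + 2048 / (c * P.κ)) * numEdges ω := by
  classical
  have hκ := hP.κ_pos
  have hc0 : 0 < c := by rw [hc]; positivity
  have hn' : (0 : ℝ) < P.n := by exact_mod_cast hn
  have hk := hP.numAnnuli_pos
  have ha0 := innerConst_pos hP.α_pos
  obtain ⟨j, hj⟩ : ∃ j : Fin (numAnnuli P), (j : ℕ) = numAnnuli P - 1 :=
    ⟨⟨numAnnuli P - 1, by omega⟩, rfl⟩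
  obtain ⟨i, hi⟩ : ∃ i : Fin (numAnnuli P), (i : ℕ) = numAnnuli P - 1 - s :=
    ⟨⟨numAnnuli P - 1 - s, by omega⟩, rfl⟩
  have hpj : 1 / 32 ≤ annulusProb P j := by
    have h := hP.annulusProb_lower j
    rw [show numAnnuli P - j = 1 by omega] at h
    norm_num at h ⊢
    exact h
  have hpi : c ≤ annulusProb P i := by
    refine le_trans ?_ (hP.annulusProb_lower i)
    rw [hc]
    gcongr 1 / 8 * ?_
    exact pow_le_pow_of_le_one (by norm_num) (by norm_num) (by omega)
  have hN := hP.narrow_of_le hD hR hs hn ha hj hi hpj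
  have hnp : P.n * (1 / 32) ≤ P.n * annulusProb P j := by gcongr
  obtain ⟨hd1, hd2, -⟩ := hP.load_dense (j := j) ht (by linarith) (by linarith)
  have hni : c * P.n / 8 ≤ annulusCount ω.1.1 i := by
    have h1 := ht.le_count i
    have h2 : P.n * c ≤ P.n * annulusProb P i := by gcongr
    have h3 : 8 / c * l = 8 * l / c := by ring
    rw [h3, div_le_iff₀ hc0] at hcn
    linarith
  have hM : (0 : ℝ) < numCells P j := by exact_mod_cast numCells_pos j
  have hτM := blockLen_le_numCells i j
  have hτ1 : (1 : ℝ) ≤ blockLen i j := by exact_mod_cast one_le_blockLen i j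
  set τ := blockLen i j with hτ
  set w := annulusCount ω.1.1 j * (τ / numCells P j : ℝ) with hw
  set B := annulusSum ω i j (windowSum (load ω.1.1 j) τ) with hB
  have hm0 : (0 : ℝ) ≤ numEdges ω := Nat.cast_nonneg _
  rcases le_or_gt (8 * l) w with hwl | hwl
  -- Heavy blocks: every vertex of annulus i sees at least w/8 ≥ l vertices in its first block, so
  -- 2n ≤ B ≤ n + 2m.
  · have hBn : B ≤ P.n + 2 * numEdges ω := by
      rw [← ht.card_eq]
      refine le_trans ?_ (hP.sum_narrow_le ht.inCells)
      have h0 : ∀ i' j', 0 ≤ annulusSum ω i' j' (windowSum (load ω.1.1 j') (blockLen i' j')) :=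
        fun i' j' => annulusSum_nonneg fun s => windowSum_load_nonneg _ _ _ _
      refine le_trans ?_ (Finset.single_le_sum
        (fun i' _ => Finset.sum_nonneg fun j' _ => h0 i' j') (Finset.mem_univ i))
      exact Finset.single_le_sum (f := fun j' =>
        annulusSum ω i j' (windowSum (load ω.1.1 j') (blockLen i j'))) (fun j' _ => h0 i j')
        (Finset.mem_filter.2 ⟨Finset.mem_univ j, hN⟩)
    have hBl : annulusCount ω.1.1 i * l ≤ B := by
      rw [← annulusSum_const ω i j]
      refine annulusSum_mono fun s => ?_
      have := ht.le_window j τ s hτM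
      rw [← hw] at this
      linarith
    have h1 : 2 * P.n ≤ annulusCount ω.1.1 i * l := by
      rw [div_le_iff₀ hc0] at hcl
      calc (2 : ℝ) * P.n = 16 * (P.n / 8) := by ring
        _ ≤ l * c * (P.n / 8) := by gcongr
        _ = c * P.n / 8 * l := by ring
        _ ≤ _ := by gcongr
    have h2 : 0 ≤ 2048 / (c * P.κ) * numEdges ω := by positivity
    linarith
  -- As s ≥ 1, i = j only if k = 1. Then the scale is 1 and a block spans a constant fraction of the
  -- circle, so its mean load is of order n, contrary to w < 8l.
  · have hij : i ≠ j := by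
      rintro rfl
      have hk1 : numAnnuli P = 1 := by omega
      have hsc : angleScale i i = 1 := by
        have h1 : radialBound P i = 0 := by
          rw [radialBound_eq, hi, hk1]
          simp
        unfold angleScale
        rw [h1]
        exact min_eq_left (one_le_exp (by linarith [hP.R_pos]))
      have hx : 1 ≤ innerConst P.α / cellWidth P i := by
        rw [Narrow, hsc, mul_one] at hN
        exact (one_le_div (cellWidth_pos i)).2 hN
      have h1 : innerConst P.α / cellWidth P i / 2 ≤ τ := by
        have h2 : (⌊innerConst P.α / cellWidth P i⌋₊ : ℝ) ≤ τ := by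
          rw [hτ, blockLen, hsc, mul_one]
          exact_mod_cast le_max_right _ _
        have h3 := Nat.lt_floor_add_one (innerConst P.α / cellWidth P i)
        linarith
      have h2 : innerConst P.α / (4 * π) ≤ τ / numCells P i := by
        rw [le_div_iff₀ hM]
        refine le_trans (le_of_eq ?_) h1
        unfold cellWidth
        field_simp
        ring
      have h3 : P.n / 256 * (innerConst P.α / (4 * π)) ≤ w := by
        rw [hw]
        have : (P.n : ℝ) / 256 ≤ annulusCount ω.1.1 i := by linarith
        gcongr
      have h4 : P.n / 256 * (innerConst P.α / (4 * π)) = innerConst P.α * P.n / (1024 * π) := by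
        field_simp
        ring
      rw [h4, div_le_iff₀ (by positivity)] at h3
      have h5 : 8 * l * (1024 * π) = 8192 * π * l := by ring
      have h6 : w * (1024 * π) < 8 * l * (1024 * π) := by gcongr
      linarith
    have hB2 : B ≤ 2 * numEdges ω := by
      have h := hP.sum_windowLoad_annulus_le ht.inCells hij hN
      have h2 : ((∑ v : Vertex ω.1.1, if v.1.1 = i then
          windowLoad ω.1.1 j (blockLen i j) (angularIndex j (ω.2 v)) else 0 : ℕ) : ℝ) ≤
          2 * numEdges ω := by exact_mod_cast h
      rw [hB, annulusSum]
      simp_rw [windowSum_load]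
      push_cast at h2
      exact h2
    have hmax : maxWindow ω.1.1 j τ ≤ 17 * l := maxWindow_le fun s => by
      have := ht.window_le j τ s hτM
      rw [← hw] at this
      linarith
    have hmaxl : maxWindow ω.1.1 j τ * l ≤ 17 * l ^ 2 := by
      rw [sq, ← mul_assoc]
      gcongr
    have hlow := ht.le_cross i j hij
    rw [← hτ, ← hw, ← hB] at hlow
    -- A block has at least one cell, so its mean load is at least κ/16 and the expected number of
    -- close pairs is of order n, beyond the error 17l².
    have hwκ : P.κ / 16 ≤ w := by
      have h1 : P.κ / 16 ≤ annulusCount ω.1.1 j / numCells P j := by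
        rw [le_div_iff₀ hM]
        linarith
      calc P.κ / 16 ≤ _ := h1
        _ = annulusCount ω.1.1 j * (1 / numCells P j) := by ring
        _ ≤ w := by rw [hw]; gcongr
    have h1 : c * P.n / 8 * (P.κ / 16) ≤ annulusCount ω.1.1 i * w := by gcongr
    have hcκ : 0 < c * P.κ := by positivity
    have h2 : 17 * 1024 / (c * P.κ) * l ^ 2 = 17 * 1024 * l ^ 2 / (c * P.κ) := by ring
    rw [h2, div_le_iff₀ hcκ] at hl2
    have h3 : c * P.κ * P.n ≤ 2048 * numEdges ω := by linarith
    have h4 : (P.n : ℝ) ≤ 2048 / (c * P.κ) * numEdges ω := by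
      have h5 : 2048 / (c * P.κ) * numEdges ω = 2048 * numEdges ω / (c * P.κ) := by ring
      rw [h5, le_div_iff₀ hcκ]
      linarith
    linarith

end Edges

end RHG

namespace RHG

open Real MeasureTheory ProbabilityTheory

/-! ## The running time is linear in the number of edges -/

section Main

/-- The factor by which the number of trials may exceed the number of vertices. -/
noncomputable def trialConst (κ q : ℝ) : ℝ := (1 / κ + 3) * log 2 / log (2 / (2 - q))

/-- `trialConst` converts the trial tail with base 2/(2 - q) to base 2, so that it can beat the
factor 2^(number of variates). -/
lemma rpow_neg_trialConst_mul {κ q : ℝ} (hq : 0 < q) (hq1 : q ≤ 1) (n : ℝ) :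
    (2 / (2 - q)) ^ (-(trialConst κ q * n)) = (2 : ℝ) ^ (-((1 / κ + 3) * n)) := by
  have h1 : 1 < 2 / (2 - q) := by
    rw [one_lt_div (by linarith)]
    linarith
  have h2 := log_pos h1
  rw [rpow_def_of_pos (by linarith), rpow_def_of_pos two_pos, trialConst]
  congr 1
  field_simp

variable {P : Params}

lemma Params.Valid.law_not_typical_le_rpow (hP : P.Valid) {c l : ℝ} (hn : 3 ≤ (P.n : ℝ))
    (hl : 0 < l) (hln : l ≤ P.n) (hk : (numAnnuli P : ℝ) ≤ P.n) (hκn : 1 / P.κ + 3 ≤ P.n)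
    (h2l : (2 : ℝ) ^ (-l) ≤ (P.n : ℝ) ^ (-(c + 8))) :
    law P {ω | ¬ Typical ω l (trialConst P.κ P.q * P.n)} ≤
      ENNReal.ofReal ((P.n : ℝ) ^ (-c)) := by
  refine (hP.law_not_typical_le hl _).trans ?_
  have hκ := hP.κ_pos
  have hn0 : (0 : ℝ) < P.n := by linarith
  have hq0 : 0 < (P.q : ℝ) := unitInterval.pos_iff_ne_zero.2 hP.q_ne
  have hz : 0 < 2 / (2 - (P.q : ℝ)) := div_pos two_pos (by linarith [P.q.2.2])
  rw [← ENNReal.ofReal_add (by positivity) (mul_nonneg (by positivity) (rpow_nonneg hz.le _))]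
  apply ENNReal.ofReal_le_ofReal
  have hX := hP.sum_numCells_le
  rw [show (P.n : ℝ) / P.κ = P.n * (1 / P.κ) by ring] at hX
  have hX' : ((∑ i, numCells P i : ℕ) : ℝ) ≤ P.n * (1 / P.κ) + numAnnuli P := by
    exact_mod_cast hX
  set X := ∑ i, numCells P i
  have h1 : (X : ℝ) + 1 ≤ (P.n : ℝ) ^ 2 := by nlinarith
  have hpow : (P.n : ℝ) ^ (-(c + 8)) * (P.n : ℝ) ^ 8 = (P.n : ℝ) ^ (-c) := by
    rw [← rpow_natCast, ← rpow_add hn0]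
    norm_num
  have h2 : 7 * ((X : ℝ) + 1) ^ 3 * 2 ^ (-l) ≤ 7 * (P.n : ℝ) ^ 6 * (P.n : ℝ) ^ (-(c + 8)) := by
    have h3 : ((X : ℝ) + 1) ^ 3 ≤ (P.n : ℝ) ^ 6 := by
      calc ((X : ℝ) + 1) ^ 3 ≤ ((P.n : ℝ) ^ 2) ^ 3 := by gcongr
        _ = _ := by ring
    gcongr
  -- There are at most (1/κ + 2) n variates, so the exponent of 2 is at most -n ≤ -l.
  have h4 : (2 : ℝ) ^ (numAnnuli P + X) * (2 / (2 - (P.q : ℝ))) ^ (-(trialConst P.κ P.q * P.n)) ≤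
      (P.n : ℝ) ^ (-(c + 8)) := by
    rw [rpow_neg_trialConst_mul hq0 P.q.2.2, ← rpow_natCast, ← rpow_add two_pos]
    refine le_trans (rpow_le_rpow_of_exponent_le one_le_two ?_) h2l
    push_cast
    linarith
  have hy : 0 ≤ (P.n : ℝ) ^ (-(c + 8)) := rpow_nonneg hn0.le _
  set y := (P.n : ℝ) ^ (-(c + 8))
  rw [← hpow]
  have h5 : 7 * (P.n : ℝ) ^ 6 + 1 ≤ (P.n : ℝ) ^ 8 := by
    have h6 : (1 : ℝ) ≤ (P.n : ℝ) ^ 6 := one_le_pow₀ (by linarith)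
    have h7 : (9 : ℝ) ≤ (P.n : ℝ) ^ 2 := by nlinarith
    calc 7 * (P.n : ℝ) ^ 6 + 1 ≤ (P.n : ℝ) ^ 6 * 9 := by linarith
      _ ≤ (P.n : ℝ) ^ 6 * (P.n : ℝ) ^ 2 := by gcongr
      _ = _ := by ring
  nlinarith

lemma eventually_mul_log_pow_le (B : ℝ) (p : ℕ) :
    ∀ᶠ n : ℕ in Filter.atTop, B * log n ^ p ≤ n := by
  have h := (isLittleO_pow_log_id_atTop (n := p)).def (c := (|B| + 1)⁻¹) (by positivity)
  filter_upwards [tendsto_natCast_atTop_atTop.eventually h] with n hn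
  rw [id, Real.norm_natCast, inv_mul_eq_div, le_div_iff₀ (by positivity)] at hn
  calc B * log n ^ p ≤ |B| * ‖log (n : ℝ) ^ p‖ := (le_abs_self _).trans (abs_mul _ _).le
    _ ≤ ‖log (n : ℝ) ^ p‖ * (|B| + 1) := by nlinarith [norm_nonneg (log (n : ℝ) ^ p)]
    _ ≤ n := hn

lemma one_sub_le_real_of_compl_subset {Ω : Type} [MeasurableSpace Ω] (μ : Measure Ω)
    [IsProbabilityMeasure μ] {S T : Set Ω} {x : ℝ} (hx : 0 ≤ x) (hST : Sᶜ ⊆ T)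
    (hT : μ T ≤ ENNReal.ofReal x) : 1 - x ≤ μ.real S := by
  have h1 := measureReal_union_le (μ := μ) S T
  have h2 : S ∪ T = Set.univ :=
    Set.eq_univ_of_forall fun ω => (em (ω ∈ S)).imp_right fun h => hST h
  have h3 : μ.real T ≤ x := ENNReal.toReal_le_of_le_ofReal hx hT
  rw [h2, probReal_univ] at h1
  linarith

end Main

end RHG

/-! ### Choice of the constants and of n₀ -/

theorem mainTheorem7 (γ : ℝ) (hγ : 2 ≤ γ) (C₀ : ℝ) (κ : ℝ) (hκ : 0 < κ)
    (q : unitInterval) (hq : q ≠ 0) :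
    ∃ K : ℝ, ∀ c : ℝ, 0 < c → ∃ n₀ : ℕ, ∀ n : ℕ, n₀ ≤ n → ∀ C : ℝ, C ≤ C₀ →
      ∀ P : RHG.Params,
        P = { n := n, R := 2 * Real.log n + C, α := (γ - 1) / 2, κ := κ, q := q } →
        Real.log 2 ≤ P.α * P.R →
        1 - (n : ℝ) ^ (-c) ≤
          (RHG.law P).real {ω | (RHG.runningTime ω : ℝ) ≤ K * (RHG.numEdges ω : ℝ)} := by
  open Real RHG in
  set α := (γ - 1) / 2 with hα
  have hα1 : 1 / 2 ≤ α := by rw [hα]; linarith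
  have hα0 : 0 < α := by linarith
  set a := innerConst α with ha
  have ha0 : 0 < a := innerConst_pos hα0
  have hmw := minWidth_pos hα0
  set D := exp (C₀ / 2) with hD
  have hD0 : 0 < D := exp_pos _
  -- Moving s annuli inwards widens the search angle by at least exp(s · `minWidth` / 2) until the
  -- scale saturates at 1; s is chosen to compensate D = exp(C₀/2), since exp(R/2) ≤ D n.
  obtain ⟨s, hs1, hs⟩ : ∃ s : ℕ, 1 ≤ s ∧ 64 * π * κ * D ≤ a * exp (s * minWidth α / 2) := by
    obtain ⟨N, hN⟩ := exists_nat_ge (64 * π * κ * D / (a * (minWidth α / 2)))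
    refine ⟨N + 1, by omega, ?_⟩
    rw [div_le_iff₀ (by positivity)] at hN
    have h1 := add_one_le_exp (((N + 1 : ℕ) : ℝ) * minWidth α / 2)
    calc _ ≤ _ := hN
      _ = a * (N * minWidth α / 2) := by ring
      _ ≤ _ := by
        gcongr
        push_cast at h1 ⊢
        linarith
  set c₁ : ℝ := 1 / 8 * (1 / 4) ^ (s + 1) with hc₁
  have hc₁0 : 0 < c₁ := by positivity
  -- k ≤ αR / ln 2 ≤ A log n once log n ≥ 1; only the upper bound on C is used.
  set A := α * (2 + |C₀|) / log 2 with hA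
  set V := 2 + 2048 / (c₁ * κ) with hV
  set K₀ := 3 * numBlocks α * pairConst κ with hK₀
  set K₁ := trialConst κ q + (69 + 1 / κ) with hK₁
  -- T ≤ (K₁ + 67 K₀) n + 2 K₀ m with n ≤ V m; `c` enters only afterwards, through n₀.
  refine ⟨(K₁ + 67 * K₀) * V + 2 * K₀, fun c hc => ?_⟩
  have hlog : Filter.Tendsto (fun n : ℕ => log n) Filter.atTop Filter.atTop :=
    tendsto_log_atTop.comp tendsto_natCast_atTop_atTop
  obtain ⟨n₀, hn₀⟩ := Filter.eventually_atTop.1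
    ((hlog.eventually_ge_atTop 1).and <| (hlog.eventually_ge_atTop (6 * κ)).and <|
      (hlog.eventually_ge_atTop (16 / c₁)).and <|
      (hlog.eventually_ge_atTop ((c + 8) / log 2)).and <|
      (eventually_mul_log_pow_le 1 2).and <| (eventually_mul_log_pow_le A 1).and <|
      (eventually_mul_log_pow_le (A ^ 2) 6).and <|
      (eventually_mul_log_pow_le (8192 * π / a) 2).and <|
      (eventually_mul_log_pow_le (8 / c₁) 2).and <|
      (eventually_mul_log_pow_le (32 * (8 + κ)) 2).and <|
      (eventually_mul_log_pow_le (17 * 1024 / (c₁ * κ)) 4).and <|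
      (tendsto_natCast_atTop_atTop (R := ℝ)).eventually_ge_atTop
        (64 * π * κ / a + (1 / κ + 3)))
  refine ⟨n₀, fun n hn C hC P hPdef hR => ?_⟩
  obtain ⟨e1, e2, e3, e4, e5, e6, e7, e8, e9, e10, e11, e12⟩ := hn₀ n hn
  have hPn : P.n = n := by rw [hPdef]
  have hPα : P.α = α := by rw [hPdef]
  have hPκ : P.κ = κ := by rw [hPdef]
  have hPq : P.q = q := by rw [hPdef]
  have hPR : P.R = 2 * log n + C := by rw [hPdef]
  have hP : P.Valid := ⟨by rwa [hPα], hR, by rwa [hPκ], by rwa [hPq]⟩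
  have hx1 : 0 ≤ 64 * π * κ / a := by positivity
  have hx2 : 0 < 1 / κ := by positivity
  have hn0 : (0 : ℝ) < n := by linarith
  set L := log (n : ℝ) with hL
  have hLl : L ≤ L ^ 2 := by nlinarith
  have hk : (numAnnuli P : ℝ) ≤ A * L := by
    have h1 := hP.numAnnuli_mul_le
    rw [hA, div_mul_eq_mul_div, le_div_iff₀ (log_pos one_lt_two)]
    refine h1.trans ?_
    rw [hPα, hPR, mul_assoc]
    gcongr
    have h2 := le_abs_self C₀
    have h3 : |C₀| ≤ |C₀| * L := le_mul_of_one_le_right (abs_nonneg _) e1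
    linarith
  have hkn : (numAnnuli P : ℝ) ≤ n := hk.trans (by simpa using e6)
  have := hP.isProbabilityMeasure_law
  -- The deviation parameter is l = (log n)²: superlogarithmic, so that 2^(-l) ≤ n^(-(c + 8)) for
  -- every c eventually, and still polylogarithmic.
  refine one_sub_le_real_of_compl_subset (T := {ω | ¬ Typical ω (L ^ 2) (trialConst P.κ P.q * P.n)})
    (law P) (rpow_nonneg hn0.le _) ?_ ?_
  · rw [Set.compl_subset_comm]
    intro ω hω
    have ht : Typical ω (L ^ 2) (trialConst P.κ P.q * P.n) := by simpa using hω
    have hn1 : 0 < P.n := by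
      rw [hPn]
      exact_mod_cast hn0
    have hkl : ((numAnnuli P : ℝ) * L ^ 2) ^ 2 ≤ P.n := by
      rw [hPn]
      refine le_trans ?_ e7
      calc ((numAnnuli P : ℝ) * L ^ 2) ^ 2 ≤ (A * L * L ^ 2) ^ 2 := by gcongr
        _ = _ := by ring
    have hT := hP.runningTime_le ht (e1.trans hLl) (by rw [hPκ]; exact e2.trans hLl) hkl
    have hRn : exp (P.R / 2) ≤ D * P.n := by
      have h1 : exp L = n := exp_log hn0
      rw [hPn, hPR, ← h1, hD, ← exp_add]
      exact exp_le_exp.2 (by linarith)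
    have ha1 : 64 * π * κ ≤ a * n := by
      rw [mul_comm a, ← div_le_iff₀ ha0]
      linarith
    have ha2 : 8192 * π * L ^ 2 ≤ a * n := by
      rw [mul_comm a, ← div_le_iff₀ ha0]
      exact le_of_eq_of_le (by ring) e8
    have hd : 32 * (8 * L ^ 2 + κ) ≤ n := by
      refine le_trans ?_ e10
      have : κ ≤ κ * L ^ 2 := le_mul_of_one_le_right hκ.le (e1.trans hLl)
      linarith
    have hm := hP.vertices_le ht (e1.trans hLl) hs1 hD0 hRn (by rwa [hPα, hPκ]) hn1
      (by rwa [hPα, hPκ, hPn]) (by rwa [hPα, hPn]) hc₁ (e3.trans hLl) (by rwa [hPn])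
      (by rwa [hPκ, hPn]) (by rw [hPκ, hPn]; exact le_of_eq_of_le (by ring) e11)
    rw [hPκ, hPq, hPα, hPn] at hT
    rw [hPκ, hPn] at hm
    have hK₀0 : 0 ≤ K₀ := by
      have h1 := (pairConst_bounds hκ).2.1
      have h2 : 0 ≤ pairConst κ := by linarith
      positivity
    have hK₁0 : 0 ≤ K₁ := by
      have h1 : 1 ≤ 2 / (2 - (q : ℝ)) := by
        rw [one_le_div (by linarith [q.2.2])]
        linarith [q.2.1]
      have h2 := log_nonneg h1
      have h3 : 0 ≤ trialConst κ q := by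
        unfold trialConst
        positivity
      linarith
    change (runningTime ω : ℝ) ≤ _
    calc (runningTime ω : ℝ) ≤ (K₁ + 67 * K₀) * n + 2 * K₀ * numEdges ω := by linarith
      _ ≤ (K₁ + 67 * K₀) * (V * numEdges ω) + 2 * K₀ * numEdges ω := by gcongr
      _ = _ := by ring
  · rw [← hPn]
    refine hP.law_not_typical_le_rpow ?_ (by positivity) ?_ ?_ ?_ ?_
    · rw [hPn]; linarith
    · rw [hPn]; linarith
    · rwa [hPn]
    · rw [hPn, hPκ]; linarith
    · rw [hPn, rpow_def_of_pos two_pos, rpow_def_of_pos hn0, exp_le_exp]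
      rw [div_le_iff₀ (log_pos one_lt_two)] at e4
      have h1 : L * (c + 8) ≤ L * (L * log 2) := by gcongr
      linarith
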